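/- Let $G\subset SL(2,\mathbb C)$ be a finite cyclic subgroup, $R=\mathbb C[x_0,x_1]$ the coordinate ring of $\mathbb C^2$ with the induced $G$-action $(g\cdot f)(v)=f(g^{-1}v)$, and $\widehat R=\mathbb C[[x_0,x_1]]$ its completion at the origin. Let $D^G(\mathbb C^2)$ be the bounded derived category of the abelian category $\operatorname{Coh}^G(\mathbb C^2)$ of $G$-equivariant coherent sheaves on $\mathbb C^2$, and $D^G_{\{0\}}(\mathbb C^2)\subset D^G(\mathbb C^2)$ the full triangulated subcategory of objects whose cohomology sheaves are supported on the set $\{0\}$. For a representation $\rho$ of $G$ let $\rho\otimes\mathcal O_0$ denote the skyscraper sheaf at $0$ with fibre $\rho$, placed in degree $0$. Let $Y=\operatorname{Spec}\widehat R^{G}$ be the germ of the quotient singularity $\mathbb C^2/G$ (the $A_n$-singularity if $G$ has order $n+1$), and let $\operatorname{Aut}Y$ be the group of its automorphisms over $\mathbb C$. It acts on $D^G_{\{0\}}(\mathbb C^2)$ as follows. Every $\sigma\in\operatorname{Aut}Y$ lifts to an automorphism $\tau$ of $\operatorname{Spec}\widehat R$ over $\mathbb C$ that normalizes $G$, and $\tau$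 is unique up to composition with elements of $G$. Every object $\alpha$ of $D^G_{\{0\}}(\mathbb C^2)$ is represented by a bounded complex $K$ of $G$-equivariant $\widehat R$-modules of finite length (equivalently, of equivariant coherent sheaves on $\mathbb C^2$ supported on $\{0\}$), and $\sigma^*\alpha$ is the object represented by $\tau^*K$; up to isomorphism it depends neither on $\tau$ nor on $K$. Let $\Phi$ be an autoequivalence of $D^G_{\{0\}}(\mathbb C^2)$ (as a $\mathbb C$-linear triangulated category) such that $\Phi(\rho\otimes\mathcal O_0)\cong\rho\otimes\mathcal O_0$ for every irreducible representation $\rho$ of $G$. Then there is an automorphism $\sigma\in\operatorname{Aut}Y$ such that $$\Phi(\alpha)\cong\sigma^*\alpha\qquad\text{for all objects }\alpha\in D^G_{\{0\}}(\mathbb C^2).$$ -/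

import Mathlib

open CategoryTheory Limits

universe w

noncomputable section

namespace KleinianSurface

/-- The special linear group `SL(2, ℂ)`. -/
abbrev SL₂ := Matrix.SpecialLinearGroup (Fin 2) ℂ

/-- The coordinate ring `R = ℂ[x₀, x₁]` of the affine plane `ℂ²`. -/
abbrev Poly := MvPolynomial (Fin 2) ℂ

/-- The completion `R̂ = ℂ⟦x₀, x₁⟧` of `R` at the origin. -/
abbrev Pow := MvPowerSeries (Fin 2) ℂ

/-! ### The action of `SL(2, ℂ)` on functions: `(g • f)(v) = f (g⁻¹ v)` -/

/-- The linear form `g • xᵢ = ∑ⱼ (g⁻¹)ᵢⱼ xⱼ`. -/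
def linForm (g : SL₂) (i : Fin 2) : Poly :=
  ∑ j, MvPolynomial.C ((g⁻¹ : SL₂).1 i j) * MvPolynomial.X j

lemma linForm_one (i : Fin 2) : linForm 1 i = MvPolynomial.X i := by
  fin_cases i <;> simp [linForm, Fin.sum_univ_two]

lemma aeval_linForm (g h : SL₂) (i : Fin 2) :
    MvPolynomial.aeval (linForm g) (linForm h i) = linForm (g * h) i := by
  simp only [linForm, map_sum, map_mul, MvPolynomial.aeval_X, mul_inv_rev,
    Matrix.SpecialLinearGroup.coe_mul, Matrix.mul_apply, MvPolynomial.aeval_C,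
    MvPolynomial.algebraMap_eq, Finset.mul_sum, Finset.sum_mul]
  rw [Finset.sum_comm]
  simp only [mul_assoc]

/-- The linear substitution `f ↦ g • f` on `ℂ[x₀, x₁]`. -/
def polySubst (g : SL₂) : Poly →ₐ[ℂ] Poly := MvPolynomial.aeval (linForm g)

lemma polySubst_one : polySubst 1 = AlgHom.id ℂ Poly := by
  ext i : 1
  rw [polySubst, MvPolynomial.aeval_X, linForm_one, AlgHom.id_apply]

lemma polySubst_mul (g h : SL₂) : polySubst (g * h) = (polySubst g).comp (polySubst h) := by
  ext i : 1
  rw [AlgHom.comp_apply, polySubst, polySubst, polySubst, MvPolynomial.aeval_X,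
    MvPolynomial.aeval_X, aeval_linForm]

/-- The action of `SL(2, ℂ)` on `ℂ[x₀, x₁]` by linear substitutions. -/
instance polyAction : MulSemiringAction SL₂ Poly where
  smul g f := polySubst g f
  one_smul f := DFunLike.congr_fun polySubst_one f
  mul_smul g h f := DFunLike.congr_fun (polySubst_mul g h) f
  smul_zero g := map_zero (polySubst g)
  smul_add g := map_add (polySubst g)
  smul_one g := map_one (polySubst g)
  smul_mul g := map_mul (polySubst g)

lemma poly_smul_def (g : SL₂) (f : Poly) : g • f = polySubst g f := rfl

instance : SMulCommClass SL₂ ℂ Poly where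
  smul_comm g c f := by simp only [poly_smul_def, map_smul]

/-- The linear forms `g • xᵢ`, as power series. -/
def linSeries (g : SL₂) (i : Fin 2) : Pow := (linForm g i : Poly)

lemma hasSubst (g : SL₂) : MvPowerSeries.HasSubst (linSeries g) :=
  MvPowerSeries.hasSubst_of_constantCoeff_zero fun i => by
    simp [linSeries, linForm, Fin.sum_univ_two]

/-- The linear substitution `f ↦ g • f` on `ℂ⟦x₀, x₁⟧`. -/
def powSubst (g : SL₂) : Pow →ₐ[ℂ] Pow := MvPowerSeries.substAlgHom (hasSubst g)

lemma powSubst_coe (g : SL₂) (f : Poly) : powSubst g (f : Pow) = (polySubst g f : Poly) := by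
  have h : (powSubst g).comp (MvPolynomial.coeToMvPowerSeries.algHom ℂ) =
      (MvPolynomial.coeToMvPowerSeries.algHom ℂ).comp (polySubst g) := by
    ext i : 1
    simp [powSubst, polySubst, MvPowerSeries.subst_X (hasSubst g), linSeries]
  simpa using DFunLike.congr_fun h f

lemma powSubst_one : powSubst 1 = AlgHom.id ℂ Pow := by
  ext1 f
  rw [powSubst, MvPowerSeries.substAlgHom_apply, show linSeries 1 = MvPowerSeries.X from
    funext fun i => by simp [linSeries, linForm_one], MvPowerSeries.subst_self]
  rfl

lemma powSubst_mul (g h : SL₂) : powSubst (g * h) = (powSubst g).comp (powSubst h) := by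
  ext1 f
  rw [AlgHom.comp_apply]
  simp only [powSubst, MvPowerSeries.substAlgHom_apply]
  rw [MvPowerSeries.subst_comp_subst_apply (hasSubst h) (hasSubst g)]
  congr 1
  ext1 i
  have := powSubst_coe g (linForm h i)
  rw [powSubst, MvPowerSeries.substAlgHom_apply, polySubst, aeval_linForm] at this
  exact this.symm

/-- The action of `SL(2, ℂ)` on `ℂ⟦x₀, x₁⟧` by linear substitutions. -/
instance powAction : MulSemiringAction SL₂ Pow where
  smul g f := powSubst g f
  one_smul f := DFunLike.congr_fun powSubst_one f
  mul_smul g h f := DFunLike.congr_fun (powSubst_mul g h) f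
  smul_zero g := map_zero (powSubst g)
  smul_add g := map_add (powSubst g)
  smul_one g := map_one (powSubst g)
  smul_mul g := map_mul (powSubst g)

lemma pow_smul_def (g : SL₂) (f : Pow) : g • f = powSubst g f := rfl

instance : SMulCommClass SL₂ ℂ Pow where
  smul_comm g c f := by simp only [pow_smul_def, map_smul]

lemma coe_smul (g : SL₂) (f : Poly) : ((g • f : Poly) : Pow) = g • (f : Pow) :=
  (powSubst_coe g f).symm

variable (G : Subgroup SL₂)

/-- The skew group ring `R ⋊ G`, with `g * f = (g • f) * g`. A module over it is the same as a
`G`-equivariant `R`-module, that is, a `G`-equivariant quasi-coherent sheaf on `ℂ²`. -/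
abbrev SkewPoly := SkewMonoidAlgebra Poly G

/-- The skew group ring `R̂ ⋊ G`. -/
abbrev SkewPow := SkewMonoidAlgebra Pow G

/-! ### Equivariant coherent sheaves on `ℂ²` -/

/-- The underlying `R`-module of a `G`-equivariant `R`-module. -/
abbrev forgetEquivariance : ModuleCat.{0} (SkewPoly G) ⥤ ModuleCat.{0} Poly :=
  ModuleCat.restrictScalars SkewMonoidAlgebra.singleOneRingHom

/-- Finitely generated `R`-modules. -/
def finGen : ObjectProperty (ModuleCat.{0} Poly) := fun M => Module.Finite Poly M

/-- `R`-modules whose support is contained in `{0} ⊆ ℂ²`, the closed set `x₀ = x₁ = 0`. -/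
def suppZero : ObjectProperty (ModuleCat.{0} Poly) := fun M =>
  Module.support Poly M ⊆ PrimeSpectrum.zeroLocus (Set.range MvPolynomial.X)

instance : (forgetEquivariance G).PreservesHomology :=
  ((Functor.exact_tfae (forgetEquivariance G)).out 1 2).1 fun S hS => by
    rw [ShortComplex.ShortExact.moduleCat_exact_iff_function_exact] at hS ⊢
    exact hS

instance : PreservesFiniteLimits (forgetEquivariance G) :=
  Functor.preservesFiniteLimits_of_preservesHomology _

instance : PreservesFiniteColimits (forgetEquivariance G) :=
  Functor.preservesFiniteColimits_of_preservesHomology _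

instance : finGen.IsSerreClass where
  exists_zero := ⟨.of _ PUnit, ModuleCat.isZero_of_subsingleton _, by
    dsimp [finGen]; infer_instance⟩
  prop_of_mono {M N} f hf hN := by
    rw [ModuleCat.mono_iff_injective] at hf
    dsimp [finGen] at hN ⊢
    exact Module.Finite.of_injective f.hom hf
  prop_of_epi {M N} f hf hM := by
    rw [ModuleCat.epi_iff_surjective] at hf
    dsimp [finGen] at hM ⊢
    exact Module.Finite.of_surjective f.hom hf
  prop_X₂_of_shortExact {S} hS h₁ h₃ := by
    dsimp [finGen] at h₁ h₃ ⊢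
    exact Module.Finite.of_exact
      ((ShortComplex.ShortExact.moduleCat_exact_iff_function_exact S).1 hS.exact)
      hS.moduleCat_surjective_g

instance : suppZero.IsSerreClass where
  exists_zero := ⟨.of _ PUnit, ModuleCat.isZero_of_subsingleton _, by
    dsimp [suppZero]; rw [Module.support_eq_empty]; exact Set.empty_subset _⟩
  prop_of_mono {M N} f hf hN := by
    rw [ModuleCat.mono_iff_injective] at hf
    exact (Module.support_subset_of_injective f.hom hf).trans hN
  prop_of_epi {M N} f hf hM := by
    rw [ModuleCat.epi_iff_surjective] at hf
    exact (Module.support_subset_of_surjective f.hom hf).trans hM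
  prop_X₂_of_shortExact {S} hS h₁ h₃ := by
    dsimp [suppZero] at h₁ h₃ ⊢
    rw [Module.support_of_exact
      ((ShortComplex.ShortExact.moduleCat_exact_iff_function_exact S).1 hS.exact)
      hS.moduleCat_injective_f hS.moduleCat_surjective_g]
    exact Set.union_subset h₁ h₃

/-- Equivariant modules which are coherent, i.e. finitely generated over `R`. -/
abbrev isCoh : ObjectProperty (ModuleCat.{0} (SkewPoly G)) :=
  finGen.inverseImage (forgetEquivariance G)

instance : (isCoh G).IsClosedUnderBinaryProducts where
  limitsOfShape_le := by
    rintro X ⟨p⟩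
    exact (isCoh G).prop_of_iso
      ((biprod.isoProd _ _).trans
        (((limit.isLimit _).conePointUniqueUpToIso
          ((IsLimit.postcomposeHomEquiv (diagramIsoPair p.diag) _).symm p.isLimit))))
      ((isCoh G).prop_biprod (p.prop_diag_obj _) (p.prop_diag_obj _))

instance : (isCoh G).IsClosedUnderFiniteProducts := .mk'

/-- The abelian category `Coh^G(ℂ²)` of `G`-equivariant coherent sheaves on `ℂ²`. -/
abbrev CohG : Type 1 := (isCoh G).FullSubcategory

instance : Abelian (CohG G) := inferInstance

instance : Linear ℂ (CohG G) := inferInstance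

instance : (isCoh G).ι.PreservesHomology where
  preservesKernels _ _ f := (isCoh G).preservesKernels_ι f
  preservesCokernels _ _ f := (isCoh G).preservesCokernels_ι f

instance : PreservesFiniteLimits (isCoh G).ι :=
  Functor.preservesFiniteLimits_of_preservesHomology _

instance : PreservesFiniteColimits (isCoh G).ι :=
  Functor.preservesFiniteColimits_of_preservesHomology _

/-- Equivariant coherent sheaves supported on the set `{0}`. -/
abbrev isSuppZero : ObjectProperty (CohG G) :=
  (suppZero.inverseImage (forgetEquivariance G)).inverseImage (isCoh G).ι

/-! ### The triangulated category `D^G_{0}(ℂ²)` -/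

section

open DerivedCategory Pretriangulated ZeroObject

variable {A : Type*} [Category* A] [Abelian A] [HasDerivedCategory A]

/-- Objects of the derived category all of whose cohomology objects satisfy `P`. -/
def cohomologyIn (P : ObjectProperty A) : ObjectProperty (DerivedCategory A) := fun X =>
  ∀ n : ℤ, P ((homologyFunctor A n).obj X)

variable (P : ObjectProperty A) [P.IsSerreClass]

instance : (cohomologyIn P).IsClosedUnderIsomorphisms where
  of_iso e h n := P.prop_of_iso ((homologyFunctor A n).mapIso e) (h n)

instance : (cohomologyIn P).ContainsZero where
  exists_zero := ⟨0, isZero_zero _, fun n =>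
    P.prop_of_isZero ((homologyFunctor A n).map_isZero (isZero_zero _))⟩

instance : (cohomologyIn P).IsStableUnderShift ℤ where
  isStableUnderShiftBy a :=
    { le_shift := fun X h n => P.prop_of_iso
        (((homologyFunctor A 0).shiftIso a n (a + n) rfl).app X).symm (h (a + n)) }

instance : (cohomologyIn P).IsTriangulatedClosed₂ :=
  .mk' fun T hT h₁ h₃ n => P.prop_X₂_of_exact (HomologySequence.exact₂ T hT n) (h₁ n) (h₃ n)

instance : (cohomologyIn P).IsTriangulated where

end

/-- The bounded objects of the derived category of `Coh^G(ℂ²)`, i.e. the objects of `D^G(ℂ²)`,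
whose cohomology sheaves are supported on `{0}`. -/
abbrev boundedSuppZero [HasDerivedCategory.{w} (CohG G)] : ObjectProperty (DerivedCategory (CohG G)) :=
  DerivedCategory.TStructure.t.bounded ⊓ cohomologyIn (isSuppZero G)

/-- The triangulated category `D^G_{0}(ℂ²)`: the full subcategory of the bounded derived category
`D^G(ℂ²)` of `Coh^G(ℂ²)` consisting of the objects supported on `{0}`. -/
abbrev DG₀ [HasDerivedCategory.{w} (CohG G)] : Type 1 := (boundedSuppZero G).FullSubcategory

/-! ### The sheaves `ρ ⊗ 𝒪₀` -/

section

variable {G} {V : Type} [AddCommGroup V] [Module ℂ V] (ρ : Representation ℂ G V)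

/-- The `R ⋊ G`-module structure on `ρ ⊗ R/m`: a function `f` acts as the scalar `f(0)` and
`g : G` acts as `ρ g`. -/
def simpleAction : SkewPoly G →+* Module.End ℂ V :=
  SkewMonoidAlgebra.liftNCRingHom
    ((algebraMap ℂ (Module.End ℂ V)).comp MvPolynomial.constantCoeff) ρ fun {x y} => by
    have h : MvPolynomial.constantCoeff (y • x) = MvPolynomial.constantCoeff x := by
      change MvPolynomial.constantCoeff (polySubst (y : SL₂) x) = _
      induction x using MvPolynomial.induction_on with
      | C a => simp [polySubst]
      | add p q hp hq => rw [map_add, map_add, hp, hq, map_add]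
      | mul_X p n hp =>
        rw [map_mul, map_mul, map_mul, MvPolynomial.constantCoeff_X, polySubst,
          MvPolynomial.aeval_X]
        simp [linForm, Fin.sum_univ_two]
    rw [RingHom.comp_apply, RingHom.comp_apply, h]
    exact Algebra.commutes _ _

lemma simpleAction_single_one (f : Poly) (v : V) :
    simpleAction ρ (SkewMonoidAlgebra.single 1 f) v = MvPolynomial.constantCoeff f • v := by
  simp [simpleAction, SkewMonoidAlgebra.liftNCRingHom]

/-- The equivariant `R`-module `ρ ⊗ R/m`. -/
def simpleModule : ModuleCat.{0} (SkewPoly G) :=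
  (ModuleCat.restrictScalars (simpleAction ρ)).obj (ModuleCat.of (Module.End ℂ V) V)

variable [FiniteDimensional ℂ V]

/-- The skyscraper sheaf `ρ ⊗ 𝒪₀ ∈ Coh^G(ℂ²)`. -/
def simpleSheaf : CohG G where
  obj := simpleModule ρ
  property := by
    change Module.Finite Poly ((forgetEquivariance G).obj (simpleModule ρ))
    let _ : Module Poly V :=
      Module.compHom V ((simpleAction ρ).comp SkewMonoidAlgebra.singleOneRingHom)
    have : IsScalarTower ℂ Poly V := ⟨fun c f v => by
      change simpleAction ρ (SkewMonoidAlgebra.single 1 (c • f)) v =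
        c • simpleAction ρ (SkewMonoidAlgebra.single 1 f) v
      simp [simpleAction_single_one, mul_smul]⟩
    exact Module.Finite.of_restrictScalars_finite ℂ Poly V

lemma isSuppZero_simpleSheaf : isSuppZero G (simpleSheaf ρ) := by
  intro p hp
  obtain ⟨v, hv⟩ := Module.mem_support_iff_exists_annihilator.1 hp
  rintro _ ⟨i, rfl⟩
  refine hv ((Submodule.mem_annihilator_span_singleton _ _).2 ?_)
  refine (simpleAction_single_one ρ (MvPolynomial.X i) v).trans ?_
  rw [MvPolynomial.constantCoeff_X]
  exact zero_smul ℂ _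

/-- The object `ρ ⊗ 𝒪₀` of `D^G_{0}(ℂ²)`, a complex concentrated in degree `0`. -/
def simpleObject [HasDerivedCategory.{w} (CohG G)] : DG₀ G where
  obj := (DerivedCategory.singleFunctor (CohG G) 0).obj (simpleSheaf ρ)
  property := by
    refine ⟨⟨⟨0, inferInstance⟩, ⟨0, inferInstance⟩⟩, fun n => ?_⟩
    rcases lt_trichotomy n 0 with h | rfl | h
    · exact (isSuppZero G).prop_of_isZero (DerivedCategory.isZero_of_isGE _ 0 n h)
    · exact (isSuppZero G).prop_of_iso
        ((DerivedCategory.singleFunctorCompHomologyFunctorIso (CohG G) 0).app _).symm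
        (isSuppZero_simpleSheaf ρ)
    · exact (isSuppZero G).prop_of_isZero (DerivedCategory.isZero_of_isLE _ 0 n h)

end

/-! ### Automorphisms of `Y` and their action -/

/-- The ring of functions `R̂^G` on the germ `Y = Spec R̂^G` of the quotient singularity `ℂ²/G`. -/
abbrev invariants : Subalgebra ℂ Pow := FixedPoints.subalgebra ℂ Pow G

/-- Automorphisms of `Y` over `ℂ`, given by their action on functions. -/
abbrev AutY := invariants G ≃ₐ[ℂ] invariants G

variable {G}

/-- A lift of the automorphism `σ` of `Y` to the formal neighbourhood `Spec R̂` of `0` in `ℂ²`: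
an automorphism `τ` that restricts to `σ` on invariant functions and normalizes `G`. -/
structure Lift (σ : AutY G) where
  /-- the action of the lift on functions -/
  τ : Pow ≃ₐ[ℂ] Pow
  /-- the automorphism of `G` induced by the lift -/
  θ : G ≃* G
  equivariant : ∀ (g : G) (f : Pow), τ (g • f) = θ g • τ f
  restricts : ∀ f : invariants G, τ f = (σ f : Pow)

/-- The ring homomorphism `f * g ↦ φ(f) * θ(g)` of skew group rings. -/
def skewMap {A B : Type} [CommRing A] [CommRing B] [MulSemiringAction G A] [MulSemiringAction G B]
    (φ : A →+* B) (θ : G →* G) (h : ∀ (g : G) (f : A), φ (g • f) = θ g • φ f) :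
    SkewMonoidAlgebra A G →+* SkewMonoidAlgebra B G :=
  SkewMonoidAlgebra.liftNCRingHom (SkewMonoidAlgebra.singleOneRingHom.comp φ)
    ((SkewMonoidAlgebra.of B G).comp θ) fun {x y} => by
    simp [SkewMonoidAlgebra.singleOneRingHom, SkewMonoidAlgebra.single_mul_single, h]

lemma skewMap_single {A B : Type} [CommRing A] [CommRing B] [MulSemiringAction G A]
    [MulSemiringAction G B] (φ : A →+* B) (θ : G →* G)
    (h : ∀ (g : G) (f : A), φ (g • f) = θ g • φ f) (g : G) (f : A) :
    skewMap φ θ h (SkewMonoidAlgebra.single g f) = SkewMonoidAlgebra.single (θ g) (φ f) := by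
  simp [skewMap, SkewMonoidAlgebra.liftNCRingHom, SkewMonoidAlgebra.singleOneRingHom,
    SkewMonoidAlgebra.single_mul_single]

variable (G)

/-- The inclusion `R ⋊ G → R̂ ⋊ G`. -/
def completion : SkewPoly G →+* SkewPow G :=
  skewMap MvPolynomial.coeToMvPowerSeries.ringHom (MonoidHom.id G) fun g f => coe_smul (g : SL₂) f

lemma completion_single (g : G) (f : Poly) :
    completion G (SkewMonoidAlgebra.single g f) = SkewMonoidAlgebra.single g (f : Pow) :=
  skewMap_single _ _ _ g f

/-- Equivariant `R̂`-modules of finite length, i.e. of finite dimension over `ℂ`. -/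
abbrev isFinDim : ObjectProperty (ModuleCat.{0} (SkewPow G)) := fun M =>
  Module.Finite ℂ ((ModuleCat.restrictScalars (algebraMap ℂ (SkewPow G))).obj M)

/-- The category of `G`-equivariant `R̂`-modules of finite length. Restriction of scalars to `R`
identifies it with the category `Coh^G_{0}(ℂ²)` of equivariant coherent sheaves supported
on `{0}`. -/
abbrev FinLen : Type 1 := (isFinDim G).FullSubcategory

/-- Restriction of scalars along `R → R̂`. -/
def toCoh : FinLen G ⥤ CohG G :=
  (isCoh G).lift ((isFinDim G).ι ⋙ ModuleCat.restrictScalars (completion G)) fun M => by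
    have hM := M.property
    change Module.Finite Poly
      ((forgetEquivariance G).obj ((ModuleCat.restrictScalars (completion G)).obj M.obj))
    let _ : Module ℂ M.obj := Module.compHom M.obj (algebraMap ℂ (SkewPow G))
    let _ : Module Poly M.obj :=
      Module.compHom M.obj ((completion G).comp SkewMonoidAlgebra.singleOneRingHom)
    have : Module.Finite ℂ M.obj := hM
    have : IsScalarTower ℂ Poly M.obj := ⟨fun c f v => by
      change (completion G (SkewMonoidAlgebra.single 1 (c • f))) • v =
        (algebraMap ℂ (SkewPow G) c) • (completion G (SkewMonoidAlgebra.single 1 f)) • v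
      rw [smul_smul, completion_single, completion_single, SkewMonoidAlgebra.coe_algebraMap,
        Function.comp_apply, SkewMonoidAlgebra.single_mul_single, one_mul, one_smul,
        ← Algebra.smul_def]
      congr 2⟩
    exact Module.Finite.of_restrictScalars_finite ℂ Poly M.obj

instance : (toCoh G).Additive where

variable {G}

/-- The automorphism `f * g ↦ τ⁻¹(f) * θ⁻¹(g)` of `R̂ ⋊ G` attached to a lift. -/
def Lift.skewInv {σ : AutY G} (t : Lift σ) : SkewPow G →+* SkewPow G :=
  skewMap (t.τ.symm : Pow →+* Pow) (t.θ.symm : G →* G) fun g f => by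
    apply t.τ.injective
    simp [t.equivariant]

lemma Lift.skewInv_single {σ : AutY G} (t : Lift σ) (g : G) (f : Pow) :
    t.skewInv (SkewMonoidAlgebra.single g f) =
      SkewMonoidAlgebra.single (t.θ.symm g) (t.τ.symm f) :=
  skewMap_single _ _ _ g f

lemma Lift.skewInv_comp_algebraMap {σ : AutY G} (t : Lift σ) :
    t.skewInv.comp (algebraMap ℂ (SkewPow G)) = algebraMap ℂ (SkewPow G) := by
  ext1 c
  refine (t.skewInv_single 1 (algebraMap ℂ Pow c)).trans ?_
  rw [map_one]
  exact congrArg (SkewMonoidAlgebra.single 1) (t.τ.symm.commutes c)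

/-- Pullback `τ^*` of equivariant modules along a lift `τ` of an automorphism of `Y`. As `τ` is
invertible, `τ^* M` is `M` with `f` acting as `τ⁻¹(f)` and `g : G` acting as `θ⁻¹(g)`. -/
def Lift.pullback {σ : AutY G} (t : Lift σ) : FinLen G ⥤ FinLen G :=
  (isFinDim G).lift ((isFinDim G).ι ⋙ ModuleCat.restrictScalars t.skewInv) fun M => by
    have hM := M.property
    change Module.Finite ℂ ((ModuleCat.restrictScalars
      (t.skewInv.comp (algebraMap ℂ (SkewPow G)))).obj M.obj)
    rw [t.skewInv_comp_algebraMap]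
    exact hM

instance {σ : AutY G} (t : Lift σ) : t.pullback.Additive where

variable [HasDerivedCategory.{w} (CohG G)]

/-- A bounded complex of equivariant modules of finite length. -/
def IsBounded (K : CochainComplex (FinLen G) ℤ) : Prop :=
  ∃ a b : ℤ, ∀ i, i < a ∨ b < i → IsZero (K.X i)

/-- The object `α` of `D^G_{0}(ℂ²)` is represented by the complex `K` of equivariant modules of
finite length, regarded as a complex of equivariant coherent sheaves on `ℂ²`. -/
def Represents (K : CochainComplex (FinLen G) ℤ) (α : DG₀ G) : Prop :=
  Nonempty (DerivedCategory.Q.obj (((toCoh G).mapHomologicalComplex _).obj K) ≅ α.obj)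

/-- The relation `β ≅ σ^* α` for the action of `Aut Y` on `D^G_{0}(ℂ²)`. As `Spec R̂ → Y` is the
quotient by `G` and is étale outside the closed point, with simply connected punctured source,
`σ` has a lift `τ` to `Spec R̂`, unique up to `G`. The object `σ^* α` is obtained by applying `τ^*`
termwise to a bounded complex `K` of equivariant modules of finite length that represents `α`.
Here `α` is required to have such a `K`, `σ` is required to have a lift, and `β` has to be the
result for every choice of `K` and of the lift. -/
def IsPullback (σ : AutY G) (α β : DG₀ G) : Prop :=
  (∃ K : CochainComplex (FinLen G) ℤ, IsBounded K ∧ Represents K α) ∧ Nonempty (Lift σ) ∧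
    ∀ (t : Lift σ) (K : CochainComplex (FinLen G) ℤ), IsBounded K → Represents K α →
      Represents ((t.pullback.mapHomologicalComplex _).obj K) β

end KleinianSurface

end

/-!
The proof has three steps: the autoequivalence `Φ` is restricted to the equivariant modules of
finite length, the restriction is identified with the pullback along an automorphism, and the result
is extended from modules to complexes. Write `R̂ = ℂ⟦x₀, x₁⟧`, with maximal ideal `m`.

*Restriction to the heart.* The irreducible representations of the cyclic group `G` are its
characters `κ`, and the sheaf `κ ⊗ 𝒪₀` is the simple module `κ ⊗ R̂/m`, the case `n = 1` of the
modules `jet n κ = κ ⊗ R̂/mⁿ`. All modules of finite length are iterated extensions of simple ones,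
so `Φ` and its inverse preserve the objects with cohomology in degree `0` only
(`map_deg₀_mem_heart`). These form the category of equivariant `R̂`-modules of finite length, since
power series act on a sheaf supported at the origin (`exists_toCoh_iso`). Thus `Φ` restricts to an
autoequivalence `E` of this category (`exists_restriction`).

*Autoequivalences of the category of modules.* A vector of weight `κ` in a module killed by `mⁿ` is
a morphism from `jet n κ`. Lifting a basis vector of `E (jet 1 κ) ≅ jet 1 κ` along the surjections
`E (jet (n + 1) κ) → E (jet n κ)` gives a compatible system of vectors of weight `κ` (a `Framing`),
and hence a natural bijection `M → E M` (`Framing.eta`), which is linear over `ℂ` and `G` but not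
over `R̂`. Any natural operator on vectors of weight `κ` is multiplication by a unique power series
(`exists_series`), so the bijection carries the multiplication by `f` on vectors of weight `κ` in
`E M` to the multiplication by a power series `ψ κ f`. The maps `ψ κ` form a `WeightedAut`: they
satisfy `ψ κ (f' f) = ψ (κ μ) f' ψ κ f` for `f` of weight `μ`.

It remains to rescale the framing by units so that `ψ κ` becomes independent of `κ`. On invariants
it already is. On the functions of a fixed weight the ratio `r` of two components is an element of
the fraction field of `R̂` whose powers have a common denominator, because multiplication by `r`
preserves the weight space. As `R̂` is completely integrally closed
(`powDvdClosed_pow`), `r` is a unit. For a generator `χ` of the character group, the ratios of the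
components on the functions of weight `χ` can be evened out along the cyclic group if their product
has a root of order `|G|`, which Hensel's lemma provides (`exists_pow_eq_of_invariant`). The rescaled
components are a single `G`-equivariant automorphism `τ` of `R̂` (`WeightedAut.exists_algEquiv`), and
`E` lets `f` act as `τ f`, which is the pullback along `τ⁻¹` (`exists_iso_pullback`). The automorphism
`σ` is the restriction of `τ⁻¹` to the invariants. Any other lift of `σ` differs from `τ⁻¹` by an
element of `G` and has an isomorphic pullback (`nonempty_pullback_iso`).

*Extension to complexes.* A bounded complex of modules is an iterated cone of its terms
(`isIteratedCone_Q`), triangulated functors preserve iterated cones, and these are unique because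
there are no morphisms of negative degree between objects of the heart
(`IsIteratedCone.exists_iso`). So `Φ` acts on an object represented by a complex `K` as `E` acts on
the terms of `K` (`Represents.map`). Every object is represented by such a complex: by the Artin–Rees
lemma, a bounded complex of coherent sheaves with cohomology supported at the origin has an acyclic
subcomplex whose quotient has terms supported at the origin (`exists_represents`).
-/

noncomputable section

namespace KleinianSurface

/-! ### Complete integral closedness of power series rings -/

/-- A commutative ring is *completely integrally closed* in the sense used here if `b` divides `a`
as soon as some nonzero `d` is a common denominator for all powers of the fraction `a / b`. -/
def PowDvdClosed (A : Type*) [CommRing A] : Prop :=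
  ∀ a b d : A, b ≠ 0 → d ≠ 0 → (∀ n : ℕ, b ^ n ∣ d * a ^ n) → b ∣ a

lemma PowDvdClosed.of_field (K : Type*) [Field K] : PowDvdClosed K :=
  fun _ _ _ hb _ _ => (isUnit_iff_ne_zero.2 hb).dvd

lemma PowDvdClosed.of_equiv {A B : Type*} [CommRing A] [CommRing B] (e : A ≃+* B)
    (h : PowDvdClosed A) : PowDvdClosed B := fun a b d hb hd H => by
  have := h (e.symm a) (e.symm b) (e.symm d) (by simpa) (by simpa) fun n => by
    simpa using map_dvd e.symm (H n)
  simpa using map_dvd e this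

section

variable {A : Type*} [CommRing A]

open PowerSeries in
lemma exists_eq_X_pow_mul_constantCoeff_ne_zero {f : A⟦X⟧} (hf : f ≠ 0) :
    ∃ (k : ℕ) (g : A⟦X⟧), f = X ^ k * g ∧ constantCoeff g ≠ 0 := by
  refine ⟨f.order.toNat, f.divXPowOrder, (X_pow_order_mul_divXPowOrder).symm, ?_⟩
  rw [constantCoeff_divXPowOrder]
  exact coeff_order hf

variable [IsDomain A]

open PowerSeries in
lemma not_X_dvd_pow {b : A⟦X⟧} (hb : constantCoeff b ≠ 0) (n : ℕ) : ¬ X ∣ b ^ n := fun h =>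
  hb (X_dvd_iff.1 (X_prime.dvd_of_dvd_pow h))

open PowerSeries in
lemma dvd_of_dvd_X_pow_mul {b c : A⟦X⟧} (hb : ¬ X ∣ b) (k : ℕ) (h : b ∣ X ^ k * c) : b ∣ c := by
  induction k with
  | zero => simpa using h
  | succ k ih =>
    apply ih
    obtain ⟨e, he⟩ := h
    have : X ∣ b * e := ⟨X ^ k * c, by rw [← he]; ring⟩
    obtain ⟨e', rfl⟩ := (X_prime.dvd_or_dvd this).resolve_left hb
    refine ⟨e', mul_left_cancel₀ X_ne_zero (a := X) ?_⟩
    linear_combination he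

open PowerSeries in
/-- One step of the power series division of `a` by `b`: dividing the constant terms gives the
constant term `q` of the quotient, and the remainder satisfies the same divisibilities. -/
lemma PowDvdClosed.step (hA : PowDvdClosed A) {a b d : A⟦X⟧} (hb : constantCoeff b ≠ 0)
    (hd : constantCoeff d ≠ 0) (H : ∀ n : ℕ, b ^ n ∣ d * a ^ n) :
    ∃ (q : A) (a' : A⟦X⟧), a = C q * b + X * a' ∧ ∀ n : ℕ, b ^ n ∣ d * a' ^ n := by
  obtain ⟨q, hq⟩ := hA (constantCoeff a) (constantCoeff b) (constantCoeff d) hb hd fun n => by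
    simpa using map_dvd (constantCoeff (R := A)) (H n)
  obtain ⟨a', ha'⟩ := X_dvd_iff.2 (show constantCoeff (a - C q * b) = 0 by
    simp [hq, mul_comm])
  refine ⟨q, a', by rw [← ha']; ring, fun n => ?_⟩
  refine dvd_of_dvd_X_pow_mul (not_X_dvd_pow hb n) n ?_
  have : X ^ n * (d * a' ^ n) = d * (a + (-C q * b)) ^ n := by
    rw [show a + (-C q * b) = X * a' by rw [← ha']; ring]; ring
  rw [this, add_pow, Finset.mul_sum]
  refine Finset.dvd_sum fun i hi => ?_
  have hi : i ≤ n := Nat.lt_succ_iff.1 (Finset.mem_range.1 hi)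
  obtain ⟨c, hc⟩ := H i
  refine ⟨c * (-C q) ^ (n - i) * (n.choose i : A⟦X⟧), ?_⟩
  rw [← Nat.add_sub_of_le hi, Nat.add_sub_cancel_left, pow_add, mul_pow]
  linear_combination (-C q) ^ (n - i) * b ^ (n - i) * ((i + (n - i)).choose i : A⟦X⟧) * hc

open PowerSeries in
/-- Power series over a completely integrally closed domain are completely integrally closed: the
quotient `a / b` is computed one coefficient at a time. -/
lemma PowDvdClosed.powerSeries (hA : PowDvdClosed A) : PowDvdClosed A⟦X⟧ := by
  intro a b d hb hd H
  by_cases ha : a = 0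
  · simp [ha]
  obtain ⟨k, b, rfl, hb'⟩ := exists_eq_X_pow_mul_constantCoeff_ne_zero hb
  obtain ⟨m, d, rfl, hd'⟩ := exists_eq_X_pow_mul_constantCoeff_ne_zero hd
  obtain ⟨j, a, rfl, ha'⟩ := exists_eq_X_pow_mul_constantCoeff_ne_zero ha
  -- comparing the orders of vanishing for the power `m + 1` gives `k ≤ j`
  have hkj : k ≤ j := by
    by_contra! hlt
    obtain ⟨c, hc⟩ := H (m + 1)
    have h1 : X ^ (k * (m + 1)) ∣ X ^ (m + j * (m + 1)) * (d * a ^ (m + 1)) :=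
      ⟨b ^ (m + 1) * c, by rw [pow_add, pow_mul, pow_mul]; linear_combination hc⟩
    have h2 : m + j * (m + 1) + 1 ≤ k * (m + 1) := by nlinarith
    obtain ⟨e, he⟩ := (pow_dvd_pow X h2).trans h1
    have h3 : d * a ^ (m + 1) = X * e := by
      refine mul_left_cancel₀ (pow_ne_zero (m + j * (m + 1)) X_ne_zero) (he.trans ?_)
      rw [pow_succ]; ring
    have h4 := congrArg constantCoeff h3
    simp only [map_mul, map_pow, constantCoeff_X, zero_mul] at h4
    exact mul_ne_zero hd' (pow_ne_zero _ ha') h4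
  obtain ⟨j, rfl⟩ := Nat.exists_eq_add_of_le hkj
  have H' : ∀ n : ℕ, b ^ n ∣ d * (X ^ j * a) ^ n := fun n => by
    refine dvd_of_dvd_X_pow_mul (not_X_dvd_pow hb' n) m ?_
    obtain ⟨c, hc⟩ := H n
    refine ⟨c, mul_left_cancel₀ (pow_ne_zero (k * n) X_ne_zero) ?_⟩
    rw [pow_add] at hc
    rw [pow_mul]
    linear_combination hc
  rw [pow_add, mul_assoc]
  refine mul_dvd_mul_left _ ?_
  generalize X ^ j * a = a at H'
  let St := {a : A⟦X⟧ // ∀ n : ℕ, b ^ n ∣ d * a ^ n}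
  choose q a' h1 h2 using fun s : St => hA.step hb' hd' s.2
  let s : ℕ → St := fun n => Nat.rec ⟨a, H'⟩ (fun _ s => ⟨a' s, h2 s⟩) n
  have hs : ∀ n, (s n).1 = C (q (s n)) * b + X * (s (n + 1)).1 := fun n => h1 (s n)
  have hsum : ∀ n, a = (∑ i ∈ Finset.range n, C (q (s i)) * X ^ i) * b + X ^ n * (s n).1 := by
    intro n
    induction n with
    | zero => simp [s]
    | succ n ih =>
      rw [Finset.sum_range_succ]
      conv_lhs => rw [ih, hs n]
      ring
  -- the successive constant terms are the coefficients of the quotient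
  refine ⟨PowerSeries.mk fun i => q (s i), ?_⟩
  ext n
  have hdiv : X ^ (n + 1) ∣ a - b * PowerSeries.mk fun i => q (s i) := by
    have h3 : X ^ (n + 1) ∣ (PowerSeries.mk fun i => q (s i)) -
        ∑ i ∈ Finset.range (n + 1), C (q (s i)) * X ^ i := by
      rw [X_pow_dvd_iff]
      intro m hm
      simp [coeff_C_mul, coeff_X_pow, hm]
    obtain ⟨e, he⟩ := h3
    refine ⟨(s (n + 1)).1 - b * e, ?_⟩
    linear_combination hsum (n + 1) - b * he
  have := X_pow_dvd_iff.1 hdiv n n.lt_succ_self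
  rwa [map_sub, sub_eq_zero] at this

end

instance (n : ℕ) : IsDomain (MvPowerSeries (Fin n) ℂ) := NoZeroDivisors.to_isDomain _

/-- The ring `ℂ⟦x₀, x₁⟧` is completely integrally closed. -/
lemma powDvdClosed_pow : PowDvdClosed Pow := by
  have h0 : PowDvdClosed (MvPowerSeries (Fin 0) ℂ) :=
    (PowDvdClosed.of_field ℂ).of_equiv (MvPowerSeries.isEmptyEquiv (Fin 0) ℂ).symm.toRingEquiv
  have h1 : PowDvdClosed (MvPowerSeries (Fin 1) ℂ) :=
    h0.powerSeries.of_equiv (MvPowerSeries.finSuccEquiv ℂ 0).symm.toRingEquiv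
  exact h1.powerSeries.of_equiv (MvPowerSeries.finSuccEquiv ℂ 1).symm.toRingEquiv

end KleinianSurface

end

noncomputable section

namespace KleinianSurface

/-! ### Characters and weight spaces -/

/-- The one-dimensional complex characters of a group. -/
def Character (H : Type*) [Group H] : Type _ := H →* ℂˣ

namespace Character

variable {H : Type*} [Group H]

instance : CommGroup (Character H) := inferInstanceAs (CommGroup (H →* ℂˣ))

instance : FunLike (Character H) H ℂˣ := inferInstanceAs (FunLike (H →* ℂˣ) H ℂˣ)

instance : MonoidHomClass (Character H) H ℂˣ := inferInstanceAs (MonoidHomClass (H →* ℂˣ) H ℂˣ)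

/-- A character as a homomorphism to the multiplicative monoid of `ℂ`. -/
def toComplex (κ : Character H) : H →* ℂ := (Units.coeHom ℂ).comp (show H →* ℂˣ from κ)

lemma toComplex_apply (κ : Character H) (h : H) : κ.toComplex h = (κ h : ℂ) := rfl

lemma mul_apply (κ μ : Character H) (h : H) : (κ * μ) h = κ h * μ h := rfl

lemma div_apply (κ μ : Character H) (h : H) : (κ / μ) h = κ h / μ h := rfl

/-- Evaluation of characters at a group element, with values in `ℂ`. -/
def eval (h : H) : Character H →* ℂ where
  toFun κ := (κ h : ℂ)
  map_one' := rfl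
  map_mul' _ _ := Units.val_mul _ _

instance [Finite H] : Finite (Character H) := inferInstanceAs (Finite (H →* ℂˣ))

end Character

section Weights

variable {H : Type*} [Group H] {V W : Type*} [AddCommGroup V] [Module ℂ V] [AddCommGroup W]
  [Module ℂ W]

/-- The vector `v` is an eigenvector of weight `κ` of the representation `ρ`. -/
def IsWt (ρ : Representation ℂ H V) (κ : Character H) (v : V) : Prop :=
  ∀ h, ρ h v = (κ h : ℂ) • v

variable {ρ : Representation ℂ H V} {κ μ : Character H} {v : V}

lemma IsWt.smul (hv : IsWt ρ κ v) (c : ℂ) : IsWt ρ κ (c • v) := fun h => by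
  rw [map_smul, hv, smul_comm]

attribute [local instance] Fintype.ofFinite

variable [Finite H]

variable (ρ κ) in
/-- The projection of a representation onto its part of weight `κ`. -/
def wtProj : V →ₗ[ℂ] V := (Nat.card H : ℂ)⁻¹ • ∑ h : H, ((κ h)⁻¹ : ℂ) • ρ h

lemma wtProj_apply (v : V) :
    wtProj ρ κ v = (Nat.card H : ℂ)⁻¹ • ∑ h : H, ((κ h)⁻¹ : ℂ) • ρ h v := by
  simp [wtProj]

lemma isWt_wtProj (v : V) : IsWt ρ κ (wtProj ρ κ v) := fun h => by
  rw [wtProj_apply, map_smul, map_sum, smul_comm]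
  congr 1
  rw [Finset.smul_sum]
  refine Fintype.sum_equiv (Equiv.mulLeft h) _ _ fun g => ?_
  rw [map_smul, Equiv.coe_mulLeft, map_mul, map_mul, smul_smul, Module.End.mul_apply,
    Units.val_mul]
  congr 1
  field_simp

lemma card_ne_zero_complex : (Nat.card H : ℂ) ≠ 0 := Nat.cast_ne_zero.2 Nat.card_pos.ne'

lemma IsWt.wtProj_eq (hv : IsWt ρ κ v) : wtProj ρ κ v = v := by
  rw [wtProj_apply, Finset.sum_congr rfl fun h _ => show ((κ h)⁻¹ : ℂ) • ρ h v = v by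
    rw [hv, smul_smul, inv_mul_cancel₀ (Units.ne_zero _), one_smul]]
  rw [Finset.sum_const, Finset.card_univ, ← Nat.card_eq_fintype_card, ← Nat.cast_smul_eq_nsmul ℂ,
    smul_smul, inv_mul_cancel₀ card_ne_zero_complex, one_smul]

lemma IsWt.wtProj_eq_zero (hv : IsWt ρ κ v) (h : κ ≠ μ) : wtProj ρ μ v = 0 := by
  have hne : (κ / μ).toComplex ≠ 1 := fun h' => h <| by
    rw [← div_eq_one]
    refine DFunLike.ext _ _ fun g => Units.ext ?_
    exact DFunLike.congr_fun h' g
  have := sum_hom_units_eq_zero _ hne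
  rw [wtProj_apply, Finset.sum_congr rfl fun g _ => show ((μ g)⁻¹ : ℂ) • ρ g v =
    (κ / μ).toComplex g • v by
      rw [hv, smul_smul, mul_comm, Character.toComplex_apply, Character.div_apply]
      simp [div_eq_mul_inv], ← Finset.sum_smul, this, zero_smul, smul_zero]

lemma map_wtProj {ρ' : Representation ℂ H W} (f : V →ₗ[ℂ] W) (hf : ∀ h v, f (ρ h v) = ρ' h (f v))
    (v : V) : f (wtProj ρ κ v) = wtProj ρ' κ (f v) := by
  simp [wtProj_apply, hf]

variable [IsCyclic H]

variable (H) in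
lemma nonempty_dual_mulEquiv : Nonempty ((Character H) ≃* H) := by
  let _ : CommGroup H := IsCyclic.commGroup
  have : NeZero (Monoid.exponent H) := ⟨Monoid.exponent_ne_zero_of_finite⟩
  exact CommGroup.monoidHom_mulEquiv_of_hasEnoughRootsOfUnity H ℂ

instance isCyclic_dual : IsCyclic (Character H) :=
  let ⟨e⟩ := nonempty_dual_mulEquiv H
  isCyclic_of_surjective e.symm e.symm.surjective

/-- Orthogonality of the columns of the character table. -/
lemma sum_dual_apply {h : H} (hh : h ≠ 1) : ∑ κ : Character H, (κ h : ℂ) = 0 := by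
  let _ : CommGroup H := IsCyclic.commGroup
  have : NeZero (Monoid.exponent H) := ⟨Monoid.exponent_ne_zero_of_finite⟩
  obtain ⟨φ, hφ⟩ := CommGroup.exists_apply_ne_one_of_hasEnoughRootsOfUnity H ℂ hh
  exact sum_hom_units_eq_zero (Character.eval h) fun h' => hφ <| Units.ext <|
    DFunLike.congr_fun h' (show Character H from φ)

/-- A representation of a finite cyclic group is the sum of its weight spaces. -/
lemma sum_wtProj (v : V) : ∑ κ, wtProj ρ κ v = v := by
  have hinv (h : H) : ∑ κ : Character H, ((κ h)⁻¹ : ℂ) = ∑ κ : Character H, (κ h : ℂ) :=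
    Fintype.sum_equiv (Equiv.inv _) _ _ fun κ => by exact (Units.val_inv_eq_inv_val _).symm
  simp only [wtProj_apply]
  rw [← Finset.smul_sum, Finset.sum_comm]
  simp only [← Finset.sum_smul, hinv]
  rw [Finset.sum_eq_single 1 (fun h _ hh => by rw [sum_dual_apply hh, zero_smul]) (by simp)]
  obtain ⟨e⟩ := nonempty_dual_mulEquiv H
  simp only [map_one, Units.val_one, Finset.sum_const, Finset.card_univ,
    ← Nat.card_eq_fintype_card, Nat.card_congr e.toEquiv, nsmul_eq_mul, mul_one]
  rw [Module.End.one_apply, smul_smul, inv_mul_cancel₀ card_ne_zero_complex, one_smul]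

omit [IsCyclic H] in
/-- The components of a sum of weight vectors of different weights. -/
lemma wtProj_sum {f : (Character H) → V} (hf : ∀ κ, IsWt ρ κ (f κ)) (μ : Character H) :
    wtProj ρ μ (∑ κ, f κ) = f μ := by
  rw [map_sum, Finset.sum_eq_single μ (fun κ _ h => (hf κ).wtProj_eq_zero h) (by simp)]
  exact (hf μ).wtProj_eq

end Weights

/-! ### The maximal ideal of `ℂ⟦x₀, x₁⟧` and the action of `G` -/

/-- The maximal ideal of `ℂ⟦x₀, x₁⟧`. -/
abbrev maxIdeal : Ideal Pow := .span (.range MvPowerSeries.X)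

/-- The ideal of power series of order at least `n`. -/
def orderIdeal (n : ℕ) : Ideal Pow where
  carrier := {f | n ≤ f.order}
  zero_mem' := by simp
  add_mem' ha hb := (le_min ha hb).trans MvPowerSeries.min_order_le_add
  smul_mem' c f hf := le_trans (le_trans hf le_add_self) MvPowerSeries.le_order_mul

open MvPowerSeries in
lemma mem_orderIdeal_iff {n : ℕ} {f : Pow} :
    f ∈ orderIdeal n ↔ ∀ d : Fin 2 →₀ ℕ, d.degree < n → coeff d f = 0 :=
  ⟨fun h d hd => coeff_of_lt_order (lt_of_lt_of_le (by exact_mod_cast hd) h),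
    fun h => nat_le_order h⟩

open MvPowerSeries in
lemma maxIdeal_pow (n : ℕ) : maxIdeal ^ n = orderIdeal n := by
  have hX : maxIdeal ≤ orderIdeal 1 := by
    rw [Ideal.span_le]
    rintro _ ⟨i, rfl⟩
    rw [SetLike.mem_coe, mem_orderIdeal_iff]
    intro d hd
    rw [Nat.lt_one_iff, Finsupp.degree_eq_zero_iff] at hd
    simp [hd]
  induction n with
  | zero =>
    ext f
    simp [mem_orderIdeal_iff]
  | succ n ih =>
    rw [pow_succ, ih]
    apply le_antisymm
    · rw [Ideal.mul_le]
      intro r hr s hs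
      refine le_trans ?_ le_order_mul
      rw [Nat.cast_add]
      exact add_le_add hr (hX hs)
    · intro f hf
      rw [mem_orderIdeal_iff] at hf
      -- split `f` as `x₀ f₀ + x₁ f₁` with the monomials divisible by `x₀` collected in `x₀ f₀`
      let f₀ : Pow := fun d => coeff (d + Finsupp.single 0 1) f
      let f₁ : Pow := fun d => if d 0 = 0 then coeff (d + Finsupp.single 1 1) f else 0
      have h₀ (d) : coeff d f₀ = coeff (d + Finsupp.single 0 1) f := rfl
      have h₁ (d) : coeff d f₁ = if d 0 = 0 then coeff (d + Finsupp.single 1 1) f else 0 := rfl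
      have hle (d : Fin 2 →₀ ℕ) (i : Fin 2) : Finsupp.single i 1 ≤ d ↔ d i ≠ 0 := by
        rw [Finsupp.single_le_iff, Nat.one_le_iff_ne_zero]
      have hsplit : f = f₀ * X 0 + f₁ * X 1 := by
        ext d
        rw [map_add, X, X, coeff_mul_monomial, coeff_mul_monomial]
        simp only [hle]
        by_cases hd0 : d 0 = 0
        · by_cases hd1 : d 1 = 0
          · have : d = 0 := by ext i; fin_cases i <;> simp [hd0, hd1]
            simp [hd0, hd1, hf d (by simp [this])]
          · have : Finsupp.single 1 1 ≤ d := (hle d 1).2 hd1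
            simp [hd0, hd1, h₁, tsub_add_cancel_of_le this]
        · have : Finsupp.single 0 1 ≤ d := (hle d 0).2 hd0
          have hne : d 1 ≠ 0 → (d - Finsupp.single 1 1 : Fin 2 →₀ ℕ) 0 ≠ 0 := by simp [hd0]
          by_cases hd1 : d 1 = 0
          · simp [hd0, hd1, h₀, tsub_add_cancel_of_le this]
          · rw [if_pos hd0, if_pos hd1, h₁, if_neg (hne hd1), h₀, tsub_add_cancel_of_le this]
            simp
      rw [hsplit]
      refine add_mem (Ideal.mul_mem_mul ?_ (Ideal.subset_span ⟨0, rfl⟩))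
        (Ideal.mul_mem_mul ?_ (Ideal.subset_span ⟨1, rfl⟩))
      · rw [mem_orderIdeal_iff]
        intro d hd
        rw [h₀]
        exact hf _ (by rw [map_add, Finsupp.degree_single]; omega)
      · rw [mem_orderIdeal_iff]
        intro d hd
        rw [h₁]
        split_ifs
        · exact hf _ (by rw [map_add, Finsupp.degree_single]; omega)
        · rfl

lemma mem_maxIdeal_pow_iff {n : ℕ} {f : Pow} :
    f ∈ maxIdeal ^ n ↔ ∀ d : Fin 2 →₀ ℕ, d.degree < n → MvPowerSeries.coeff d f = 0 := by
  rw [maxIdeal_pow, mem_orderIdeal_iff]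

lemma mem_maxIdeal_iff {f : Pow} : f ∈ maxIdeal ↔ MvPowerSeries.constantCoeff f = 0 := by
  rw [← pow_one maxIdeal, mem_maxIdeal_pow_iff]
  simp [Finsupp.degree_eq_zero_iff]

lemma isUnit_iff_notMem_maxIdeal {f : Pow} : IsUnit f ↔ f ∉ maxIdeal := by
  rw [mem_maxIdeal_iff, MvPowerSeries.isUnit_iff_constantCoeff, isUnit_iff_ne_zero]

variable (G : Subgroup SL₂)

/-- The action of `G` on `ℂ⟦x₀, x₁⟧` as a complex representation. -/
def powRep : Representation ℂ G Pow where
  toFun g := (powSubst (g : SL₂)).toLinearMap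
  map_one' := by ext1 f; exact one_smul G f
  map_mul' g h := by ext1 f; exact mul_smul g h f

variable {G}

lemma powRep_apply (g : G) (f : Pow) : powRep G g f = g • f := rfl

lemma smul_C (g : G) (c : ℂ) : g • (MvPowerSeries.C c : Pow) = MvPowerSeries.C c :=
  (powSubst (g : SL₂)).commutes c

lemma constantCoeff_smul (g : G) (f : Pow) :
    MvPowerSeries.constantCoeff (g • f) = MvPowerSeries.constantCoeff f := by
  -- the difference `f - f(0)` is a nonunit, and so is its image under `g`
  have h (f : Pow) (hf : MvPowerSeries.constantCoeff f = 0) :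
      MvPowerSeries.constantCoeff (g • f) = 0 := by
    by_contra hne
    have h1 : IsUnit (g • f) := MvPowerSeries.isUnit_iff_constantCoeff.2 (isUnit_iff_ne_zero.2 hne)
    have h2 : IsUnit f := by
      have := h1.map (MulSemiringAction.toRingHom G Pow g⁻¹)
      simpa using this
    exact (MvPowerSeries.isUnit_iff_constantCoeff.1 h2).ne_zero hf
  have := h (f - MvPowerSeries.C (MvPowerSeries.constantCoeff f)) (by simp)
  rwa [smul_sub, smul_C, map_sub, MvPowerSeries.constantCoeff_C, sub_eq_zero] at this

/-- The action of `G` on `ℂ⟦x₀, x₁⟧` is faithful. -/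
lemma eq_one_of_smul_X (g : G) (h : ∀ i, g • (MvPowerSeries.X i : Pow) = MvPowerSeries.X i) :
    g = 1 := by
  have h1 (i : Fin 2) : linForm (g : SL₂) i = MvPolynomial.X i := by
    apply MvPolynomial.coe_injective
    have := h i
    rw [← MvPolynomial.coe_X, show g • ((MvPolynomial.X i : Poly) : Pow) =
      ((g : SL₂) • ((MvPolynomial.X i : Poly)) : Poly) from (coe_smul _ _).symm, poly_smul_def,
      polySubst, MvPolynomial.aeval_X] at this
    exact this
  have h2 : ((g⁻¹ : G) : SL₂) = 1 := by
    ext i j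
    have := congrArg (MvPolynomial.coeff (Finsupp.single j 1)) (h1 i)
    rw [linForm, MvPolynomial.coeff_sum] at this
    simp only [MvPolynomial.coeff_C_mul, MvPolynomial.coeff_X,
      Finsupp.single_left_inj one_ne_zero] at this
    simpa [Matrix.one_apply] using this
  simpa using h2

lemma IsWt.mul {κ μ : Character G} {f f' : Pow} (h : IsWt (powRep G) κ f)
    (h' : IsWt (powRep G) μ f') : IsWt (powRep G) (κ * μ) (f * f') := fun g => by
  have h1 := h g
  have h2 := h' g
  rw [powRep_apply] at *
  rw [smul_mul', h1, h2, smul_mul_smul_comm]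
  rfl

lemma isWt_one_iff {f : Pow} : IsWt (powRep G) 1 f ↔ ∀ g : G, g • f = f := by
  simp only [IsWt, powRep_apply]
  exact forall_congr' fun g => by rw [show ((1 : Character G) g : ℂ) = 1 from rfl, one_smul]

lemma IsWt.pow {κ : Character G} {f : Pow} (h : IsWt (powRep G) κ f) (n : ℕ) :
    IsWt (powRep G) (κ ^ n) (f ^ n) := by
  induction n with
  | zero => simp [isWt_one_iff]
  | succ n ih => rw [pow_succ, pow_succ]; exact ih.mul h

variable [Finite G]

/-- Every character of `G` occurs in `ℂ⟦x₀, x₁⟧`: the elements of `G` act by distinct ring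
homomorphisms, which are linearly independent by Dedekind's lemma, so the projection to the
weight space is not zero. -/
lemma exists_isWt_ne_zero (κ : Character G) : ∃ f : Pow, f ≠ 0 ∧ IsWt (powRep G) κ f := by
  by_contra! hne
  have h0 (f : Pow) : wtProj (powRep G) κ f = 0 := by
    by_contra h
    exact hne _ h (isWt_wtProj f)
  let φ : G → (Pow →* Pow) := fun g => (MulSemiringAction.toRingHom G Pow g : Pow →* Pow)
  have hφ : Function.Injective φ := fun g h hgh => by
    rw [← inv_mul_eq_one]
    refine eq_one_of_smul_X _ fun i => ?_
    rw [mul_smul, inv_smul_eq_iff]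
    exact (DFunLike.congr_fun hgh _).symm
  have hli := (linearIndependent_monoidHom Pow Pow).comp φ hφ
  let _ := Fintype.ofFinite G
  rw [Fintype.linearIndependent_iff] at hli
  have := hli (fun g => MvPowerSeries.C ((κ g)⁻¹ : ℂ)) (by
    ext1 f
    have := h0 f
    rw [wtProj_apply, smul_eq_zero_iff_right (inv_ne_zero card_ne_zero_complex)] at this
    simp only [Function.comp_apply, Finset.sum_apply, Pi.smul_apply, smul_eq_mul, Pi.zero_apply]
    rw [← this]
    refine Finset.sum_congr (by congr) fun g _ => ?_
    rw [MvPowerSeries.smul_eq_C_mul]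
    rfl) 1
  simp at this

omit [Finite G] in
/-- Units of `ℂ⟦x₀, x₁⟧` have roots of all orders by Hensel's lemma; a root of an invariant unit is
invariant since the group fixes its constant term. -/
lemma exists_pow_eq_of_invariant {n : ℕ} (hn : n ≠ 0) (c : Powˣ) (hc : ∀ g : G, g • (c : Pow) = c) :
    ∃ d : Powˣ, (∀ g : G, g • (d : Pow) = d) ∧ d ^ n = c := by
  have : HenselianRing Pow maxIdeal := inferInstance
  have hc0 : MvPowerSeries.constantCoeff (c : Pow) ≠ 0 :=
    (MvPowerSeries.isUnit_iff_constantCoeff.1 c.isUnit).ne_zero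
  obtain ⟨a, ha⟩ := IsAlgClosed.exists_pow_nat_eq (MvPowerSeries.constantCoeff (c : Pow))
    (Nat.pos_of_ne_zero hn)
  have ha0 : a ≠ 0 := by rintro rfl; rw [zero_pow hn] at ha; exact hc0 ha.symm
  obtain ⟨d, hd, hda⟩ := HenselianRing.is_henselian (I := maxIdeal)
    (Polynomial.X ^ n - Polynomial.C (c : Pow)) (Polynomial.monic_X_pow_sub_C _ hn)
    (MvPowerSeries.C a) (mem_maxIdeal_iff.2 (by simp [ha])) (by
      refine IsUnit.map _ (MvPowerSeries.isUnit_iff_constantCoeff.2 (isUnit_iff_ne_zero.2 ?_))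
      simp [Polynomial.derivative_X_pow, hn, ha0])
  have hd : d ^ n = c := by simpa [sub_eq_zero] using hd
  have hdu : IsUnit d := (isUnit_pow_iff hn).1 (hd ▸ c.isUnit)
  refine ⟨hdu.unit, fun g => ?_, by ext1; simpa using hd⟩
  rw [IsUnit.unit_spec]
  -- `g • d` and `d` are both `n`-th roots of `c`, with the same constant term
  have hprod : (Polynomial.X ^ n - Polynomial.C (d ^ n) : Polynomial Pow).eval (g • d) = 0 := by
    have := hc g
    rw [← hd, smul_pow'] at this
    simp [this]
  have hcd : MvPowerSeries.constantCoeff (g • d) = MvPowerSeries.constantCoeff d :=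
    constantCoeff_smul g d
  have hd0 : MvPowerSeries.constantCoeff d ≠ 0 :=
    (MvPowerSeries.isUnit_iff_constantCoeff.1 hdu).ne_zero
  have hfac : (g • d - d) * (∑ i ∈ Finset.range n, (g • d) ^ i * d ^ (n - 1 - i)) = 0 := by
    rw [mul_comm, (Commute.all _ _).geom_sum₂_mul, sub_eq_zero]
    simpa [sub_eq_zero] using hprod
  rcases mul_eq_zero.1 hfac with h | h
  · exact sub_eq_zero.1 h
  · have h2 := congrArg MvPowerSeries.constantCoeff h
    rw [map_sum, Finset.sum_congr rfl fun i hi => show MvPowerSeries.constantCoeff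
      ((g • d) ^ i * d ^ (n - 1 - i)) = MvPowerSeries.constantCoeff d ^ (n - 1) by
        rw [map_mul, map_pow, map_pow, hcd, ← pow_add]
        congr 1
        have := Finset.mem_range.1 hi
        omega] at h2
    simp [hn, hd0] at h2

end KleinianSurface

end

noncomputable section

namespace KleinianSurface

/-! ### Weighted automorphisms of `ℂ⟦x₀, x₁⟧` -/

variable {G : Subgroup SL₂}

/-- A family of `G`-equivariant linear bijections of `ℂ⟦x₀, x₁⟧`, indexed by the characters of `G`,
with the composition rule of the homogeneous components of a ring homomorphism: `ψ κ f` stands for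
the value of an automorphism of the skew group ring on `f`, viewed as an operator on vectors of
weight `κ`. -/
structure WeightedAut (G : Subgroup SL₂) where
  /-- the component at a character -/
  ψ : (Character G) → (Pow ≃ₗ[ℂ] Pow)
  smul (κ : Character G) (g : G) (f : Pow) : ψ κ (g • f) = g • ψ κ f
  mul (κ μ : Character G) (f f' : Pow) : IsWt (powRep G) μ f → ψ κ (f' * f) = ψ (κ * μ) f' * ψ κ f

namespace WeightedAut

variable (Ψ : WeightedAut G)

lemma one (κ : Character G) : Ψ.ψ κ 1 = 1 := by
  have h := Ψ.mul κ 1 1 ((Ψ.ψ κ).symm 1) (isWt_one_iff.2 fun g => smul_one g)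
  rw [mul_one, mul_one, LinearEquiv.apply_symm_apply, one_mul] at h
  exact h.symm

lemma isWt {κ μ : Character G} {f : Pow} (hf : IsWt (powRep G) μ f) :
    IsWt (powRep G) μ (Ψ.ψ κ f) := fun g => by
  rw [powRep_apply, ← Ψ.smul, ← powRep_apply, hf, map_smul]

lemma isWt_symm {κ μ : Character G} {f : Pow} (hf : IsWt (powRep G) μ f) :
    IsWt (powRep G) μ ((Ψ.ψ κ).symm f) := fun g => by
  rw [powRep_apply]
  apply (Ψ.ψ κ).injective
  rw [Ψ.smul, LinearEquiv.apply_symm_apply, map_smul, LinearEquiv.apply_symm_apply]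
  exact hf g

lemma ne_zero {κ : Character G} {f : Pow} (hf : f ≠ 0) : Ψ.ψ κ f ≠ 0 := by simpa

variable [Finite G]

/-- On invariant functions all components agree. -/
lemma eq_of_invariant {z : Pow} (hz : IsWt (powRep G) 1 z) (κ μ : Character G) :
    Ψ.ψ κ z = Ψ.ψ μ z := by
  obtain ⟨f, hf, hf'⟩ := exists_isWt_ne_zero (κ⁻¹ * μ)
  have h1 := Ψ.mul κ _ f z hf'
  have h2 := Ψ.mul κ _ z f hz
  rw [mul_comm, h2, mul_one, mul_inv_cancel_left, mul_comm] at h1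
  exact mul_right_cancel₀ (Ψ.ne_zero hf) h1

/-- The ratio `ψ μ f / ψ κ f` depends only on the weight `ν` of `f`: multiplied by the ratio of the
values of a function of weight `ν⁻¹`, it becomes `1`, as the components agree on invariants. -/
lemma mul_eq_mul {κ μ ν : Character G} {f b : Pow} (hf : IsWt (powRep G) ν f)
    (hb : IsWt (powRep G) ν b) : Ψ.ψ μ f * Ψ.ψ κ b = Ψ.ψ κ f * Ψ.ψ μ b := by
  obtain ⟨c, hc, hc'⟩ := exists_isWt_ne_zero ν⁻¹
  have h (f : Pow) (hf : IsWt (powRep G) ν f) :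
      Ψ.ψ (κ * ν) c * Ψ.ψ κ f = Ψ.ψ (μ * ν) c * Ψ.ψ μ f := by
    rw [← Ψ.mul κ ν f c hf, ← Ψ.mul μ ν f c hf]
    refine Ψ.eq_of_invariant ?_ κ μ
    rw [← inv_mul_cancel ν]
    exact hc'.mul hf
  have h1 : Ψ.ψ (κ * ν) c ≠ 0 := Ψ.ne_zero hc
  have h2 : Ψ.ψ (μ * ν) c ≠ 0 := Ψ.ne_zero hc
  refine mul_left_cancel₀ (mul_ne_zero h1 h2) ?_
  linear_combination (Ψ.ψ (κ * ν) c * Ψ.ψ κ b) * (- h f hf) +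
    (Ψ.ψ (κ * ν) c * Ψ.ψ κ f) * (h b hb)

/-- Multiplication by the fraction `ψ μ b / ψ κ b` preserves the weight space of `b`, so that
`b` is a common denominator for all its powers. -/
lemma dvd {κ μ ν : Character G} {b : Pow} (hb : IsWt (powRep G) ν b) (hb0 : b ≠ 0) :
    Ψ.ψ κ b ∣ Ψ.ψ μ b := by
  refine powDvdClosed_pow _ _ b (Ψ.ne_zero hb0) hb0 fun n => ?_
  suffices ∃ f, IsWt (powRep G) ν f ∧ f * Ψ.ψ κ b ^ n = b * Ψ.ψ μ b ^ n by
    obtain ⟨f, -, hf⟩ := this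
    exact ⟨f, by rw [← hf, mul_comm]⟩
  induction n with
  | zero => exact ⟨b, hb, by simp⟩
  | succ n ih =>
    obtain ⟨f, hf, h⟩ := ih
    refine ⟨Ψ.ψ μ ((Ψ.ψ κ).symm f), Ψ.isWt (Ψ.isWt_symm hf), ?_⟩
    have := Ψ.mul_eq_mul (κ := κ) (μ := μ) (Ψ.isWt_symm (κ := κ) hf) hb
    rw [LinearEquiv.apply_symm_apply] at this
    linear_combination Ψ.ψ κ b ^ n * this + Ψ.ψ μ b * h

/-- The components on a fixed weight space differ by multiplication by an invariant unit. -/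
lemma exists_ratio (κ μ ν : Character G) :
    ∃ r : Powˣ, (∀ g : G, g • (r : Pow) = r) ∧
      ∀ f, IsWt (powRep G) ν f → Ψ.ψ μ f = r * Ψ.ψ κ f := by
  obtain ⟨b, hb0, hb⟩ := exists_isWt_ne_zero ν
  obtain ⟨r, hr⟩ := associated_of_dvd_dvd (Ψ.dvd (κ := κ) (μ := μ) hb hb0) (Ψ.dvd hb hb0)
  have hb1 : Ψ.ψ κ b ≠ 0 := Ψ.ne_zero hb0
  refine ⟨r, fun g => ?_, fun f hf => ?_⟩
  · have h1 := Ψ.isWt (κ := μ) hb g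
    have h2 := Ψ.isWt (κ := κ) hb g
    rw [powRep_apply] at h1 h2
    rw [← hr, smul_mul', h2, smul_mul_assoc] at h1
    exact mul_left_cancel₀ hb1 (smul_right_injective _ (Units.ne_zero (ν g)) h1)
  · have h1 := Ψ.mul_eq_mul (κ := κ) (μ := μ) hf hb
    rw [← hr] at h1
    refine mul_right_cancel₀ hb1 ?_
    rw [h1]; ring

/-- The components on the weight space of a generator `χ` of the dual group differ by invariant
units `w κ`, and after rescaling by suitable units `u κ` they agree. The product of the `w κ` over
the cyclic group has to be distributed evenly, which takes a root of a unit. -/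
lemma exists_rescaling {χ : Character G} (hχ : ∀ κ, κ ∈ Subgroup.zpowers χ) :
    ∃ (u : (Character G) → Powˣ) (c : Powˣ), (∀ κ (g : G), g • (u κ : Pow) = u κ) ∧
      ∀ κ f, IsWt (powRep G) χ f → u (κ * χ) * Ψ.ψ κ f = c * Ψ.ψ 1 f * u κ := by
  have hsmul (g : G) (x : Powˣ) : g • (x : Pow) = Units.map
      (MulSemiringAction.toRingHom G Pow g : Pow →* Pow) x := rfl
  classical
  choose w hw hw' using fun κ => Ψ.exists_ratio 1 κ χ
  -- numbering the characters as `χ ^ i`, the `u κ` solve the recursion `u (κ χ) w κ = c u κ`, which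
  -- closes up at `i = N` if `c ^ N` is the product of all `w κ`
  let N := orderOf χ
  have hN : N ≠ 0 := (isOfFinOrder_of_finite χ).orderOf_pos.ne'
  let π (n : ℕ) : Powˣ := ∏ i ∈ Finset.range n, w (χ ^ i)
  have hinv (κ) (g : G) : Units.map (MulSemiringAction.toRingHom G Pow g : Pow →* Pow) (w κ)
      = w κ := Units.ext (hw κ g)
  have hπ (n : ℕ) (g : G) : Units.map (MulSemiringAction.toRingHom G Pow g : Pow →* Pow) (π n)
      = π n := by
    simp only [π, map_prod, hinv]
  obtain ⟨c, hc, hcN⟩ := exists_pow_eq_of_invariant hN (π N) fun g =>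
    congrArg Units.val (hπ N g)
  have hc (g : G) : Units.map (MulSemiringAction.toRingHom G Pow g : Pow →* Pow) c = c :=
    Units.ext (hc g)
  have hex (κ : Character G) : ∃ i : ℕ, i < N ∧ χ ^ i = κ := by
    have := (isOfFinOrder_of_finite χ).mem_zpowers_iff_mem_range_orderOf.1 (hχ κ)
    simpa using this
  choose i hi hi' using hex
  refine ⟨fun κ => c ^ i κ / π (i κ), c, fun κ g => ?_, fun κ f hf => ?_⟩
  · rw [hsmul, map_div, map_pow, hc, hπ]
  · have key : c ^ i (κ * χ) / π (i (κ * χ)) * w κ = c * (c ^ i κ / π (i κ)) := by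
      have hκ : χ ^ (i κ + 1) = κ * χ := by rw [pow_succ, hi']
      have hstep : π (i κ + 1) = π (i κ) * w κ := by
        simp only [π, Finset.prod_range_succ, hi']
      rcases Nat.lt_or_ge (i κ + 1) N with h | h
      · have : i (κ * χ) = i κ + 1 := pow_injOn_Iio_orderOf (hi _) h (by
          change χ ^ i (κ * χ) = χ ^ (i κ + 1)
          rw [hi', hκ])
        rw [this, hstep, pow_succ, mul_comm (c ^ i κ), mul_div_assoc, mul_assoc,
          div_mul_eq_mul_div, mul_div_mul_right_eq_div]
      · have hN' : i κ + 1 = N := le_antisymm (hi κ) h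
        have : i (κ * χ) = 0 := pow_injOn_Iio_orderOf (hi _) (Nat.pos_of_ne_zero hN) (by
          change χ ^ i (κ * χ) = χ ^ 0
          rw [hi', ← hκ, hN', pow_orderOf_eq_one, pow_zero])
        have h0 : π 0 = 1 := by simp [π]
        rw [this, h0, pow_zero, div_one, one_mul, mul_div_assoc', ← pow_succ', hN', hcN, ← hN',
          hstep]
        rw [mul_div_cancel_left]
    have key' := congrArg Units.val key
    rw [Units.val_mul, Units.val_mul] at key'
    rw [hw' κ f hf]
    linear_combination Ψ.ψ 1 f * key'

variable [IsCyclic G]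

/-- After rescaling by invariant units, a weighted automorphism comes from an equivariant
automorphism of `ℂ⟦x₀, x₁⟧`. -/
lemma exists_algEquiv :
    ∃ (u : (Character G) → Powˣ) (τ : Pow ≃ₐ[ℂ] Pow), (∀ κ (g : G), g • (u κ : Pow) = u κ) ∧
      (∀ (g : G) (f : Pow), τ (g • f) = g • τ f) ∧
      ∀ κ μ f, IsWt (powRep G) μ f → u (κ * μ) * Ψ.ψ κ f = τ f * u κ := by
  obtain ⟨χ, hχ⟩ := IsCyclic.exists_generator (α := Character G)
  obtain ⟨u, c, hu, huc⟩ := Ψ.exists_rescaling hχ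
  obtain ⟨a, ha0, ha⟩ := exists_isWt_ne_zero χ
  -- the component at `κ`, rescaled, is multiplicative for products with powers of `a`
  have hpow (κ μ : Character G) (f : Pow) (hf : IsWt (powRep G) μ f) (k : ℕ) :
      u (κ * μ * χ ^ k) * Ψ.ψ κ (a ^ k * f) = (c * Ψ.ψ 1 a) ^ k * (u (κ * μ) * Ψ.ψ κ f) := by
    induction k with
    | zero => simp
    | succ k ih =>
      have hwt : IsWt (powRep G) (χ ^ k * μ) (a ^ k * f) := (ha.pow k).mul hf
      have := huc (κ * (χ ^ k * μ)) a ha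
      rw [show κ * μ * χ ^ k = κ * (χ ^ k * μ) by
        rw [mul_comm (χ ^ k) μ, mul_assoc]] at ih
      rw [show κ * μ * χ ^ (k + 1) = κ * (χ ^ k * μ) * χ by
        rw [pow_succ, mul_comm (χ ^ k) μ, mul_assoc, mul_assoc, mul_assoc], pow_succ' a, mul_assoc a,
        Ψ.mul κ _ _ a hwt, pow_succ', mul_assoc (c * Ψ.ψ 1 a : Pow), ← ih]
      linear_combination Ψ.ψ κ (a ^ k * f) * this
  -- multiplying by a power of `a`, the comparison of components is reduced to invariant functions
  have hindep (κ μ : Character G) (f : Pow) (hf : IsWt (powRep G) μ f) :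
      u (κ * μ) * Ψ.ψ κ f * u 1 = u μ * Ψ.ψ 1 f * u κ := by
    obtain ⟨k, hk⟩ : ∃ k : ℕ, χ ^ k = μ⁻¹ :=
      (isOfFinOrder_of_finite χ).mem_powers_iff_mem_zpowers.2 (hχ μ⁻¹)
    have hinv : IsWt (powRep G) 1 (a ^ k * f) := by
      have := (ha.pow k).mul hf
      rwa [hk, inv_mul_cancel] at this
    have h1 := hpow κ μ f hf k
    have h2 := hpow 1 μ f hf k
    rw [hk, mul_inv_cancel_right] at h1 h2
    rw [one_mul, Ψ.eq_of_invariant hinv 1 κ] at h2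
    have h0 : (c * Ψ.ψ 1 a) ^ k ≠ 0 := pow_ne_zero _ (mul_ne_zero c.ne_zero (Ψ.ne_zero ha0))
    refine mul_left_cancel₀ h0 ?_
    linear_combination - u 1 * h1 + u κ * h2
  let _ := Fintype.ofFinite (Character G)
  let p (κ : Character G) : Pow →ₗ[ℂ] Pow := wtProj (powRep G) κ
  let r (κ : Character G) : Powˣ := u κ / u 1
  have hr (κ : Character G) (g : G) : g • (r κ : Pow) = r κ := by
    have h (x : Powˣ) : g • (x : Pow) = Units.map
      (MulSemiringAction.toRingHom G Pow g : Pow →* Pow) x := rfl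
    have h' (κ) : Units.map (MulSemiringAction.toRingHom G Pow g : Pow →* Pow) (u κ) = u κ :=
      Units.ext (hu κ g)
    rw [h, map_div, h', h']
  have hr1 (κ : Character G) : (r κ : Pow) * u 1 = u κ := by simp [r, ← Units.val_mul]
  let T : Pow →ₗ[ℂ] Pow :=
    ∑ κ, (LinearMap.mulLeft ℂ (r κ : Pow)) ∘ₗ (Ψ.ψ 1).toLinearMap ∘ₗ p κ
  have hwtr (κ : Character G) {f : Pow} (hf : IsWt (powRep G) κ f) :
      IsWt (powRep G) κ (r κ * Ψ.ψ 1 f) := by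
    have := (isWt_one_iff.2 (hr κ)).mul (Ψ.isWt (κ := 1) hf)
    rwa [one_mul] at this
  have hTapply (f : Pow) : T f = ∑ κ, r κ * Ψ.ψ 1 (p κ f) := by simp [T]
  have hT {κ : Character G} {f : Pow} (hf : IsWt (powRep G) κ f) : T f = r κ * Ψ.ψ 1 f := by
    rw [hTapply, Finset.sum_eq_single κ]
    · rw [show p κ f = f from hf.wtProj_eq]
    · intro μ _ hμ
      rw [show p μ f = 0 from hf.wtProj_eq_zero hμ.symm, map_zero, mul_zero]
    · simp
  have hpT (κ : Character G) (f : Pow) : p κ (T f) = r κ * Ψ.ψ 1 (p κ f) := by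
    rw [hTapply]
    exact wtProj_sum (fun κ => hwtr κ (isWt_wtProj f)) κ
  have hsum (f : Pow) : ∑ κ, p κ f = f := sum_wtProj f
  have hTg (g : G) (f : Pow) : T (g • f) = g • T f := by
    rw [← hsum f, Finset.smul_sum, map_sum, map_sum, Finset.smul_sum]
    refine Finset.sum_congr rfl fun κ _ => ?_
    have h : IsWt (powRep G) κ (p κ f) := isWt_wtProj f
    have h2 := hwtr κ h g
    rw [← hT h] at h2
    rw [← powRep_apply, ← powRep_apply, h, h2, map_smul]
  have hT1 : T 1 = 1 := by
    rw [hT (isWt_one_iff.2 fun g => smul_one g), Ψ.one]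
    simp [r]
  have hTmul (f f' : Pow) : T (f * f') = T f * T f' := by
    rw [← hsum f, ← hsum f', Finset.sum_mul_sum]
    simp only [map_sum]
    rw [Finset.sum_mul_sum]
    refine Finset.sum_congr rfl fun κ _ => Finset.sum_congr rfl fun μ _ => ?_
    have h : IsWt (powRep G) κ (p κ f) := isWt_wtProj f
    have h' : IsWt (powRep G) μ (p μ f') := isWt_wtProj f'
    rw [hT h, hT h', hT (h.mul h'), Ψ.mul _ _ _ _ h', one_mul]
    have h3 := hindep μ κ (p κ f) h
    rw [mul_comm μ] at h3
    have h4 := hr1 (κ * μ)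
    refine mul_right_cancel₀ (mul_ne_zero (u 1).ne_zero (u 1).ne_zero) ?_
    linear_combination (u 1 * Ψ.ψ μ (p κ f) * Ψ.ψ 1 (p μ f')) * h4 + Ψ.ψ 1 (p μ f') * h3 -
      (u 1 * Ψ.ψ 1 (p κ f) * Ψ.ψ 1 (p μ f') * r μ) * hr1 κ -
      (Ψ.ψ 1 (p κ f) * Ψ.ψ 1 (p μ f') * u κ) * hr1 μ
  have hinj : Function.Injective T := by
    rw [injective_iff_map_eq_zero]
    intro f hf
    rw [← hsum f]
    refine Finset.sum_eq_zero fun κ _ => ?_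
    have := hpT κ f
    rw [hf, map_zero, eq_comm, mul_eq_zero] at this
    simpa using this.resolve_left (r κ).ne_zero
  have hsurj : Function.Surjective T := fun f => by
    have h (κ : Character G) : ∃ f', T f' = p κ f := by
      have h1 : IsWt (powRep G) κ (((r κ)⁻¹ : Powˣ) * p κ f) := by
        have h2 : IsWt (powRep G) 1 (((r κ)⁻¹ : Powˣ) : Pow) := isWt_one_iff.2 fun g => by
          have h3 := congrArg (g • ·) (Units.mul_inv (r κ))
          simp only [smul_mul', hr, smul_one] at h3
          exact (eq_comm.1 (Units.inv_eq_of_mul_eq_one_right h3))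
        have := h2.mul (isWt_wtProj (κ := κ) (ρ := powRep G) f)
        rwa [one_mul] at this
      refine ⟨(Ψ.ψ 1).symm (((r κ)⁻¹ : Powˣ) * p κ f), ?_⟩
      rw [hT (Ψ.isWt_symm h1), LinearEquiv.apply_symm_apply, Units.mul_inv_cancel_left]
    choose f' hf' using h
    exact ⟨∑ κ, f' κ, by rw [map_sum, Finset.sum_congr rfl fun κ _ => hf' κ, hsum]⟩
  let e : Pow →ₐ[ℂ] Pow := AlgHom.ofLinearMap T hT1 hTmul
  refine ⟨u, AlgEquiv.ofBijective e ⟨hinj, hsurj⟩, hu, hTg, fun κ μ f hf => ?_⟩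
  change _ = T f * u κ
  rw [hT hf]
  refine mul_right_cancel₀ (u 1).ne_zero ?_
  linear_combination hindep κ μ f hf - (Ψ.ψ 1 f * u κ) * hr1 μ

end WeightedAut

end KleinianSurface

end

noncomputable section

namespace KleinianSurface

/-! ### Modules over skew group rings -/

section Skew

open SkewMonoidAlgebra

variable {A H : Type} [CommRing A] [Group H] [MulSemiringAction H A]
  {M N : Type*} [AddCommGroup M] [Module (SkewMonoidAlgebra A H) M]
  [AddCommGroup N] [Module (SkewMonoidAlgebra A H) N]

lemma single_eq_single_one_mul (h : H) (a : A) :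
    (single h a : SkewMonoidAlgebra A H) = single 1 a * single h 1 := by
  rw [single_mul_single, one_mul, one_smul, mul_one]

lemma single_mul_single_one (h : H) (a : A) :
    (single h 1 * single 1 a : SkewMonoidAlgebra A H) = single 1 (h • a) * single h 1 := by
  rw [single_mul_single, single_mul_single, mul_one, one_mul, one_mul, smul_one, mul_one]

/-- An additive map which is compatible with the monomials of a skew group ring is linear. -/
def skewLinearMap (f : M →+ N)
    (hf : ∀ (h : H) (a : A) (m : M), f ((single h a : SkewMonoidAlgebra A H) • m) =
      (single h a : SkewMonoidAlgebra A H) • f m) :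
    M →ₗ[SkewMonoidAlgebra A H] N where
  __ := f
  map_smul' s m := by
    change f (s • m) = s • f m
    induction s using SkewMonoidAlgebra.induction_on with
    | zero => rw [zero_smul, zero_smul, map_zero]
    | single h a => exact hf h a m
    | add s t hs ht => rw [add_smul, map_add, hs, ht, add_smul]

/-- An additive subgroup which is stable under the monomials of a skew group ring is a
submodule. -/
def skewSubmodule (U : AddSubgroup M)
    (hU : ∀ (h : H) (a : A) (m : M), m ∈ U → (single h a : SkewMonoidAlgebra A H) • m ∈ U) :
    Submodule (SkewMonoidAlgebra A H) M where
  __ := U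
  smul_mem' s m hm := by
    change s • m ∈ U
    induction s using SkewMonoidAlgebra.induction_on with
    | zero => rw [zero_smul]; exact U.zero_mem
    | single h a => exact hU h a m hm
    | add s t hs ht => rw [add_smul]; exact U.add_mem hs ht

variable [Algebra ℂ A] [SMulCommClass H ℂ A] [Module ℂ M]
  [IsScalarTower ℂ (SkewMonoidAlgebra A H) M]

variable (A M) in
/-- The representation of the group on a module over a skew group ring. -/
def skewRep : Representation ℂ H M where
  toFun h :=
    { toFun := fun m => (single h 1 : SkewMonoidAlgebra A H) • m
      map_add' := smul_add _
      map_smul' := fun c m => by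
        rw [RingHom.id_apply, ← algebraMap_smul (SkewMonoidAlgebra A H) c m,
          ← algebraMap_smul (SkewMonoidAlgebra A H) c, smul_smul, smul_smul, Algebra.commutes] }
  map_one' := by
    ext m
    exact one_smul _ m
  map_mul' g h := by
    ext m
    change (single (g * h) 1 : SkewMonoidAlgebra A H) • m =
      (single g 1 : SkewMonoidAlgebra A H) • (single h 1 : SkewMonoidAlgebra A H) • m
    rw [smul_smul, single_mul_single, smul_one, mul_one]

lemma skewRep_apply (h : H) (m : M) :
    skewRep A M h m = (single h 1 : SkewMonoidAlgebra A H) • m := rfl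

lemma single_one_algebraMap_smul (c : ℂ) (m : M) :
    (single (1 : H) (algebraMap ℂ A c) : SkewMonoidAlgebra A H) • m = c • m := by
  rw [← algebraMap_smul (SkewMonoidAlgebra A H) c m, coe_algebraMap]
  rfl

lemma isWt_skewRep_single_one_smul {κ μ : Character H} {a : A} {m : M}
    (ha : ∀ h : H, h • a = (μ h : ℂ) • a) (hm : IsWt (skewRep A M) κ m) :
    IsWt (skewRep A M) (κ * μ) ((single 1 a : SkewMonoidAlgebra A H) • m) := fun h => by
  have h1 := hm h
  rw [skewRep_apply] at h1 ⊢
  rw [smul_smul, single_mul_single_one, mul_smul, h1, ha, Character.mul_apply, Units.val_mul,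
    mul_comm, ← smul_smul, Algebra.smul_def (μ h : ℂ) a,
    show (single 1 (algebraMap ℂ A (μ h) * a) : SkewMonoidAlgebra A H) =
      single 1 (algebraMap ℂ A (μ h)) * single 1 a by rw [single_mul_single, one_mul, one_smul],
    mul_smul, single_one_algebraMap_smul]
  congr 1
  rw [← algebraMap_smul (SkewMonoidAlgebra A H) (κ h : ℂ) m,
    ← algebraMap_smul (SkewMonoidAlgebra A H) (κ h : ℂ), smul_smul, smul_smul, Algebra.commutes]

end Skew

attribute [local instance] ModuleCat.moduleOfAlgebraModule
  ModuleCat.isScalarTower_of_algebra_moduleCat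

open SkewMonoidAlgebra

variable {G : Subgroup SL₂}

lemma finite_obj (M : FinLen G) : Module.Finite ℂ M.obj := M.property

/-! ### Equivariant modules of finite length -/

/-- The function `f` acts on the equivariant module `M`. -/
def act (M : FinLen G) (f : Pow) (m : M.obj) : M.obj := (single (1 : G) f : SkewPow G) • m

lemma act_act (M : FinLen G) (f f' : Pow) (m : M.obj) :
    act M f (act M f' m) = act M (f * f') m := by
  rw [act, act, act, smul_smul, single_mul_single, one_mul, one_smul]

lemma act_add (M : FinLen G) (f f' : Pow) (m : M.obj) :
    act M (f + f') m = act M f m + act M f' m := by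
  rw [act, act, act, single_add, add_smul]

lemma act_sub (M : FinLen G) (f f' : Pow) (m : M.obj) :
    act M (f - f') m = act M f m - act M f' m := by
  rw [eq_sub_iff_add_eq, ← act_add, sub_add_cancel]

lemma act_zero_left (M : FinLen G) (m : M.obj) : act M 0 m = 0 := by
  rw [act, single_zero_right]
  exact zero_smul (SkewPow G) m

lemma act_add_right (M : FinLen G) (f : Pow) (m m' : M.obj) :
    act M f (m + m') = act M f m + act M f m' := smul_add _ _ _

lemma act_zero (M : FinLen G) (f : Pow) : act M f 0 = 0 := smul_zero _

lemma act_one (M : FinLen G) (m : M.obj) : act M 1 m = m := one_smul _ m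

lemma act_C (M : FinLen G) (c : ℂ) (m : M.obj) : act M (MvPowerSeries.C c) m = c • m :=
  single_one_algebraMap_smul c m

lemma act_smul_left (M : FinLen G) (c : ℂ) (f : Pow) (m : M.obj) :
    act M (c • f) m = c • act M f m := by
  rw [MvPowerSeries.smul_eq_C_mul, ← act_act, act_C]

lemma act_smul (M : FinLen G) (c : ℂ) (f : Pow) (m : M.obj) :
    act M f (c • m) = c • act M f m := by
  rw [← act_C, ← act_C, act_act, act_act, mul_comm]

/-- The representation of `G` on an equivariant module. -/
abbrev rep (M : FinLen G) : Representation ℂ G M.obj := skewRep Pow M.obj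

lemma single_smul_eq (M : FinLen G) (g : G) (f : Pow) (m : M.obj) :
    (single g f : SkewPow G) • m = act M f (rep M g m) := by
  rw [single_eq_single_one_mul, mul_smul]
  rfl

lemma rep_act (M : FinLen G) (g : G) (f : Pow) (m : M.obj) :
    rep M g (act M f m) = act M (g • f) (rep M g m) := by
  rw [skewRep_apply, act, smul_smul, single_mul_single_one, mul_smul]
  rfl

variable {M N : FinLen G}

lemma map_act (φ : M ⟶ N) (f : Pow) (m : M.obj) : φ.hom (act M f m) = act N f (φ.hom m) :=
  φ.hom.hom.map_smul _ m

lemma map_rep (φ : M ⟶ N) (g : G) (m : M.obj) : φ.hom (rep M g m) = rep N g (φ.hom m) :=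
  φ.hom.hom.map_smul _ m

lemma map_smul_complex (φ : M ⟶ N) (c : ℂ) (m : M.obj) : φ.hom (c • m) = c • φ.hom m := by
  rw [← act_C, map_act, act_C]

lemma IsWt.map {κ : Character G} {m : M.obj} (hm : IsWt (rep M) κ m) (φ : M ⟶ N) :
    IsWt (rep N) κ (φ.hom m) := fun g => by
  rw [← map_rep, hm, map_smul_complex]

lemma IsWt.act {κ μ : Character G} {m : M.obj} {f : Pow} (hm : IsWt (rep M) κ m)
    (hf : IsWt (powRep G) μ f) : IsWt (rep M) (κ * μ) (act M f m) :=
  isWt_skewRep_single_one_smul hf hm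

/-- A morphism of equivariant modules of finite length, from its values. -/
def mkHom (f : M.obj →+ N.obj) (h₁ : ∀ a m, f (act M a m) = act N a (f m))
    (h₂ : ∀ g m, f (rep M g m) = rep N g (f m)) : M ⟶ N :=
  ObjectProperty.homMk (ModuleCat.ofHom (skewLinearMap f fun g a m => by
    rw [single_smul_eq, single_smul_eq, h₁, h₂]))

lemma hom_ext_apply {φ φ' : M ⟶ N} (h : ∀ m, φ.hom m = φ'.hom m) : φ = φ' := by
  ext m
  exact h m

/-- Every equivariant module of finite length is annihilated by a power of the maximal ideal. -/
lemma exists_killed (M : FinLen G) : ∃ n, ∀ f ∈ maxIdeal ^ n, ∀ m, act M f m = 0 := by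
  let _ : Module Pow M.obj := Module.compHom M.obj
    (singleOneRingHom : Pow →+* SkewPow G)
  have hdef (f : Pow) (m : M.obj) : f • m = act M f m := rfl
  have : IsScalarTower ℂ Pow M.obj := ⟨fun c f m => by
    rw [hdef, hdef, act_smul_left]⟩
  have := finite_obj M
  have : Module.Finite Pow M.obj := Module.Finite.of_restrictScalars_finite ℂ Pow M.obj
  have : IsArtinian Pow M.obj := isArtinian_of_tower ℂ inferInstance
  let F : ℕ →o (Submodule Pow M.obj)ᵒᵈ :=
    ⟨fun n => OrderDual.toDual (maxIdeal ^ n • ⊤), fun m n hmn =>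
      Submodule.smul_mono_left (Ideal.pow_le_pow_right hmn)⟩
  obtain ⟨n, hn⟩ := IsArtinian.monotone_stabilizes F
  have h1 : (maxIdeal ^ n • ⊤ : Submodule Pow M.obj) = maxIdeal ^ (n + 1) • ⊤ :=
    hn (n + 1) n.le_succ
  have h2 : (maxIdeal ^ n • ⊤ : Submodule Pow M.obj) = ⊥ := by
    refine Submodule.eq_bot_of_le_smul_of_le_jacobson_bot maxIdeal _
      (IsNoetherian.noetherian _) ?_ ?_
    · rw [← Submodule.mul_smul, ← pow_succ', ← h1]
    · refine le_trans ?_ (IsLocalRing.maximalIdeal_le_jacobson _)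
      intro f hf
      rw [IsLocalRing.mem_maximalIdeal, mem_nonunits_iff, isUnit_iff_notMem_maxIdeal]
      exact not_not.2 hf
  refine ⟨n, fun f hf m => ?_⟩
  have : f • m ∈ (maxIdeal ^ n • ⊤ : Submodule Pow M.obj) :=
    Submodule.smul_mem_smul hf Submodule.mem_top
  rwa [h2, Submodule.mem_bot] at this

/-! ### The modules `R̂/mⁿ ⊗ κ` -/

/-- The action of the skew group ring on `κ ⊗ R̂`. -/
def twistAction (κ : Character G) : SkewPow G →+* Module.End ℂ Pow :=
  liftNCRingHom ((Algebra.lmul ℂ Pow : Pow →ₐ[ℂ] Module.End ℂ Pow) : Pow →+* Module.End ℂ Pow)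
    { toFun := fun g => (κ g : ℂ) • powRep G g
      map_one' := by simp
      map_mul' := fun g h => by simp [smul_smul, mul_comm] } fun {f g} => by
    ext1 x
    simp [powRep_apply, smul_mul']

lemma twistAction_single (κ : Character G) (g : G) (f x : Pow) :
    twistAction κ (single g f) x = f * ((κ g : ℂ) • g • x) := by
  simp [twistAction, liftNCRingHom, powRep_apply]

/-- The equivariant `R̂`-module `κ ⊗ R̂`. -/
def twist (κ : Character G) : ModuleCat.{0} (SkewPow G) :=
  (ModuleCat.restrictScalars (twistAction κ)).obj (ModuleCat.of (Module.End ℂ Pow) Pow)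

/-- A power series as an element of `κ ⊗ R̂`. -/
def toTwist (κ : Character G) : Pow ≃+ twist κ := AddEquiv.refl Pow

lemma single_smul_toTwist (κ : Character G) (g : G) (f x : Pow) :
    (single g f : SkewPow G) • toTwist κ x = toTwist κ (f * ((κ g : ℂ) • g • x)) :=
  twistAction_single κ g f x

lemma smul_mem_maxIdeal_pow (g : G) {n : ℕ} {f : Pow} (hf : f ∈ maxIdeal ^ n) :
    g • f ∈ maxIdeal ^ n := by
  have h : maxIdeal ≤ maxIdeal.comap (MulSemiringAction.toRingHom G Pow g) := fun f hf => by
    rw [Ideal.mem_comap, mem_maxIdeal_iff]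
    rw [mem_maxIdeal_iff] at hf
    exact (constantCoeff_smul g f).trans hf
  exact (Ideal.pow_right_mono h n).trans (Ideal.le_comap_pow _ n) hf

/-- The submodule `κ ⊗ mⁿ` of `κ ⊗ R̂`. -/
def twistPow (n : ℕ) (κ : Character G) : Submodule (SkewPow G) (twist κ) :=
  skewSubmodule ((maxIdeal ^ n).toAddSubgroup.map (toTwist κ).toAddMonoidHom) fun g f x hx => by
    obtain ⟨x, hx, rfl⟩ := hx
    refine ⟨f * ((κ g : ℂ) • g • x), ?_, (single_smul_toTwist κ g f x).symm⟩
    refine Ideal.mul_mem_left _ _ ?_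
    rw [MvPowerSeries.smul_eq_C_mul]
    exact Ideal.mul_mem_left _ _ (smul_mem_maxIdeal_pow g hx)

lemma toTwist_mem_iff {n : ℕ} {κ : Character G} {x : Pow} :
    toTwist κ x ∈ twistPow n κ ↔ x ∈ maxIdeal ^ n := by
  constructor
  · rintro ⟨y, hy, h⟩
    exact (toTwist κ).injective h ▸ hy
  · exact fun h => ⟨x, h, rfl⟩

/-- The class of a power series in `κ ⊗ R̂/mⁿ`. -/
def mkJet (n : ℕ) (κ : Character G) : Pow →+ twist κ ⧸ twistPow n κ :=
  (twistPow n κ).mkQ.toAddMonoidHom.comp (toTwist κ).toAddMonoidHom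

lemma single_smul_mkJet (n : ℕ) (κ : Character G) (g : G) (f x : Pow) :
    (single g f : SkewPow G) • mkJet n κ x = mkJet n κ (f * ((κ g : ℂ) • g • x)) := by
  change _ = (twistPow n κ).mkQ (toTwist κ _)
  rw [← single_smul_toTwist]
  rfl

/-- The equivariant module `κ ⊗ R̂/mⁿ` of finite length. -/
def jet (n : ℕ) (κ : Character G) : FinLen G where
  obj := ModuleCat.of (SkewPow G) (twist κ ⧸ twistPow n κ)
  property := by
    change Module.Finite ℂ (ModuleCat.of (SkewPow G) (twist κ ⧸ twistPow n κ))
    have hfin : Finite {d : Fin 2 →₀ ℕ | d.degree < n} :=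
      Finsupp.finite_of_degree_lt n
    let _ := Fintype.ofFinite {d : Fin 2 →₀ ℕ | d.degree < n}
    let q : Pow →ₗ[ℂ] (ModuleCat.of (SkewPow G) (twist κ ⧸ twistPow n κ)) :=
      { toFun := mkJet n κ
        map_add' := map_add _
        map_smul' := fun c x => by
          refine Eq.trans ?_ (single_one_algebraMap_smul (A := Pow) (H := G)
            (M := ModuleCat.of (SkewPow G) (twist κ ⧸ twistPow n κ)) c (mkJet n κ x))
          refine Eq.trans ?_ (single_smul_mkJet n κ 1 _ x).symm
          rw [map_one, Units.val_one, one_smul, one_smul, ← Algebra.smul_def] }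
    let b := Fintype.linearCombination ℂ
      (fun d : {d : Fin 2 →₀ ℕ | d.degree < n} => (MvPowerSeries.monomial d.1 1 : Pow))
    refine Module.Finite.of_surjective (q ∘ₗ b) fun x => ?_
    obtain ⟨x, rfl⟩ := Submodule.mkQ_surjective _ x
    obtain ⟨x, rfl⟩ := (toTwist κ).surjective x
    refine ⟨fun d => MvPowerSeries.coeff d.1 x, ?_⟩
    refine (Submodule.Quotient.eq _).2 ?_
    change toTwist κ (b _) - toTwist κ x ∈ _
    rw [← map_sub, toTwist_mem_iff, mem_maxIdeal_pow_iff]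
    intro d hd
    rw [map_sub, sub_eq_zero, Fintype.linearCombination_apply, _root_.map_sum,
      Finset.sum_eq_single ⟨d, hd⟩]
    · simp
    · intro d' _ hne
      have : d ≠ d'.1 := fun h => hne (Subtype.ext h.symm)
      simp [MvPowerSeries.coeff_monomial, this]
    · simp

/-- The generator of `κ ⊗ R̂/mⁿ`. -/
def gen (n : ℕ) (κ : Character G) : (jet n κ).obj := mkJet n κ 1

lemma act_gen (n : ℕ) (κ : Character G) (f : Pow) :
    act (jet n κ) f (gen n κ) = mkJet n κ f := by
  refine (single_smul_mkJet n κ 1 f 1).trans ?_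
  rw [map_one, Units.val_one, one_smul, one_smul, mul_one]

lemma isWt_gen (n : ℕ) (κ : Character G) : IsWt (rep (jet n κ)) κ (gen n κ) := fun g => by
  refine (single_smul_mkJet n κ g 1 1).trans ?_
  rw [← act_C, act_gen, smul_one, one_mul, MvPowerSeries.smul_eq_C_mul, mul_one]

lemma act_gen_eq_zero_iff {n : ℕ} {κ : Character G} {f : Pow} :
    act (jet n κ) f (gen n κ) = 0 ↔ f ∈ maxIdeal ^ n := by
  rw [act_gen, ← toTwist_mem_iff (κ := κ)]
  exact Submodule.Quotient.mk_eq_zero _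

lemma exists_act_gen {n : ℕ} {κ : Character G} (x : (jet n κ).obj) :
    ∃ f, act (jet n κ) f (gen n κ) = x := by
  obtain ⟨y, rfl⟩ := Submodule.mkQ_surjective _ x
  obtain ⟨f, rfl⟩ := (toTwist κ).surjective y
  exact ⟨f, act_gen n κ f⟩

lemma killed_jet {n : ℕ} {κ : Character G} {f : Pow} (hf : f ∈ maxIdeal ^ n) (x : (jet n κ).obj) :
    act (jet n κ) f x = 0 := by
  obtain ⟨f', rfl⟩ := exists_act_gen x
  rw [act_act, act_gen_eq_zero_iff]
  exact Ideal.mul_mem_right _ _ hf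

/-- A vector of weight `κ` annihilated by `mⁿ` is the same as a morphism from `κ ⊗ R̂/mⁿ`. -/
def jetHom {n : ℕ} {κ : Character G} (m : M.obj) (hm : IsWt (rep M) κ m)
    (hn : ∀ f ∈ maxIdeal ^ n, act M f m = 0) : jet n κ ⟶ M :=
  ObjectProperty.homMk (ModuleCat.ofHom ((twistPow n κ).liftQ
    (skewLinearMap (M := twist κ)
      { toFun := fun x => act M ((toTwist κ).symm x) m
        map_zero' := by rw [map_zero, act_zero_left]
        map_add' := fun x y => by rw [map_add, act_add] } fun g f x => by
        obtain ⟨x, rfl⟩ := (toTwist κ).surjective x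
        rw [single_smul_toTwist]
        change act M ((toTwist κ).symm _) m = _ • act M ((toTwist κ).symm _) m
        rw [AddEquiv.symm_apply_apply, AddEquiv.symm_apply_apply, single_smul_eq, rep_act, hm,
          act_act, act_smul, mul_smul_comm, act_smul_left]) fun x hx => by
    obtain ⟨y, hy, rfl⟩ := hx
    exact hn y hy))

lemma jetHom_act_gen {n : ℕ} {κ : Character G} {m : M.obj} (hm : IsWt (rep M) κ m)
    (hn : ∀ f ∈ maxIdeal ^ n, act M f m = 0) (f : Pow) :
    (jetHom m hm hn).hom (act _ f (gen n κ)) = act M f m := by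
  rw [act_gen]
  rfl

lemma jetHom_gen {n : ℕ} {κ : Character G} {m : M.obj} (hm : IsWt (rep M) κ m)
    (hn : ∀ f ∈ maxIdeal ^ n, act M f m = 0) : (jetHom m hm hn).hom (gen n κ) = m := by
  have := jetHom_act_gen hm hn 1
  rwa [act_one, act_one] at this

lemma jet_hom_ext {n : ℕ} {κ : Character G} {φ φ' : jet n κ ⟶ M}
    (h : φ.hom (gen n κ) = φ'.hom (gen n κ)) : φ = φ' :=
  hom_ext_apply fun x => by
    obtain ⟨f, rfl⟩ := exists_act_gen x
    rw [map_act, map_act, h]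

end KleinianSurface

end

noncomputable section

namespace KleinianSurface

attribute [local instance] ModuleCat.moduleOfAlgebraModule
  ModuleCat.isScalarTower_of_algebra_moduleCat

/-! ### Morphisms and quotients of equivariant modules -/

variable {G : Subgroup SL₂} {M N : FinLen G}

lemma smul_hom_apply (c : ℂ) (φ : M ⟶ N) (m : M.obj) : (c • φ).hom m = c • φ.hom m := rfl

lemma add_hom_apply (φ φ' : M ⟶ N) (m : M.obj) : (φ + φ').hom m = φ.hom m + φ'.hom m := rfl

lemma comp_hom_apply {L : FinLen G} (φ : M ⟶ N) (φ' : N ⟶ L) (m : M.obj) :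
    (φ ≫ φ').hom m = φ'.hom (φ.hom m) := rfl

/-- The underlying complex linear map of a morphism of equivariant modules. -/
def homLinear (φ : M ⟶ N) : M.obj →ₗ[ℂ] N.obj where
  toFun m := φ.hom m
  map_add' := map_add φ.hom.hom
  map_smul' := map_smul_complex φ

/-- The quotient of an equivariant module of finite length by a submodule. -/
def quot (M : FinLen G) (U : Submodule (SkewPow G) M.obj) : FinLen G where
  obj := ModuleCat.of (SkewPow G) (M.obj ⧸ U)
  property := by
    have := finite_obj M
    change Module.Finite ℂ (ModuleCat.of (SkewPow G) (M.obj ⧸ U))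
    let q : M.obj →ₗ[ℂ] (ModuleCat.of (SkewPow G) (M.obj ⧸ U)) :=
      { toFun := U.mkQ
        map_add' := map_add _
        map_smul' := fun c m => U.mkQ.map_smul (algebraMap ℂ (SkewPow G) c) m }
    exact Module.Finite.of_surjective q U.mkQ_surjective

/-- The projection to a quotient. -/
def quotMk (M : FinLen G) (U : Submodule (SkewPow G) M.obj) : M ⟶ quot M U :=
  ObjectProperty.homMk (ModuleCat.ofHom U.mkQ)

/-- The morphism from a quotient induced by a morphism which is zero on the submodule. -/
def quotDesc (U : Submodule (SkewPow G) M.obj) (φ : M ⟶ N) (h : ∀ m ∈ U, φ.hom m = 0) :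
    quot M U ⟶ N :=
  ObjectProperty.homMk (ModuleCat.ofHom (U.liftQ φ.hom.hom h))

lemma quotMk_eq_zero {U : Submodule (SkewPow G) M.obj} {m : M.obj} :
    (quotMk M U).hom m = 0 ↔ m ∈ U := Submodule.Quotient.mk_eq_zero U

lemma quotMk_surjective (U : Submodule (SkewPow G) M.obj) :
    Function.Surjective (quotMk M U).hom := U.mkQ_surjective

lemma mono_of_injective (φ : M ⟶ N) (h : Function.Injective φ.hom) : Mono φ where
  right_cancellation f g hfg := hom_ext_apply fun m => h <| by
    rw [← comp_hom_apply, hfg, comp_hom_apply]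

lemma surjective_of_epi (φ : M ⟶ N) [Epi φ] : Function.Surjective φ.hom := by
  have h : quotMk N (LinearMap.range φ.hom.hom) = 0 := by
    rw [← cancel_epi φ, comp_zero]
    exact hom_ext_apply fun m => quotMk_eq_zero.2 ⟨m, rfl⟩
  intro n
  have := congrArg (fun f => f.hom n) h
  exact quotMk_eq_zero.1 this

lemma epi_of_surjective (φ : M ⟶ N) (h : Function.Surjective φ.hom) : Epi φ where
  left_cancellation f g hfg := hom_ext_apply fun n => by
    obtain ⟨m, rfl⟩ := h n
    rw [← comp_hom_apply, hfg, comp_hom_apply]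

/-- The isomorphism defined by a bijective morphism. -/
def isoOfBijective (φ : M ⟶ N) (h : Function.Bijective φ.hom) : M ≅ N :=
  (isFinDim G).isoMk (LinearEquiv.ofBijective φ.hom.hom h).toModuleIso

lemma iso_inv_hom_apply (e : M ≅ N) (m : M.obj) : e.inv.hom (e.hom.hom m) = m := by
  rw [← comp_hom_apply, e.hom_inv_id]; rfl

lemma iso_hom_inv_apply (e : M ≅ N) (n : N.obj) : e.hom.hom (e.inv.hom n) = n := by
  rw [← comp_hom_apply, e.inv_hom_id]; rfl

variable [Finite G]

lemma map_wtProj' (φ : M ⟶ N) (κ : Character G) (m : M.obj) :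
    φ.hom (wtProj (rep M) κ m) = wtProj (rep N) κ (φ.hom m) :=
  map_wtProj (homLinear φ) (fun g m => map_rep φ g m) m

/-- Vectors of weight `κ` are morphisms from the modules `κ ⊗ R̂/mⁿ`, which detect the kernel. -/
lemma injective_of_mono [IsCyclic G] (φ : M ⟶ N) [Mono φ] : Function.Injective φ.hom := by
  refine (injective_iff_map_eq_zero φ.hom.hom).2 fun m hm => ?_
  let _ := Fintype.ofFinite (Character G)
  rw [← sum_wtProj (ρ := rep M) m]
  refine Finset.sum_eq_zero fun κ _ => ?_
  obtain ⟨n, hn⟩ := exists_killed M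
  have hw : IsWt (rep M) κ (wtProj (rep M) κ m) := isWt_wtProj m
  have h : jetHom _ hw (fun f hf => hn f hf _) = 0 := by
    rw [← cancel_mono φ, zero_comp]
    refine jet_hom_ext ?_
    rw [comp_hom_apply, jetHom_gen, map_wtProj', show φ.hom m = 0 from hm, map_zero]
    rfl
  rw [← jetHom_gen hw (fun f hf => hn f hf _), h]
  rfl

/-! ### Natural endomorphisms of the underlying vector space -/

omit [Finite G] in
/-- For a full and essentially surjective functor `F`, a natural family of operators on the vectors
of weight `κ` of the modules `F M` is given by a power series: it is determined by its values on the
generators of the modules `κ ⊗ R̂/mⁿ`. -/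
lemma exists_series (F : FinLen G ⥤ FinLen G) [F.Full] [F.EssSurj]
    (β : ∀ M, (F.obj M).obj → (F.obj M).obj)
    (hβ : ∀ (M N : FinLen G) (φ : M ⟶ N) (x : (F.obj M).obj),
      β N ((F.map φ).hom x) = (F.map φ).hom (β M x)) (κ : Character G) :
    ∃! f : Pow, ∀ (M : FinLen G) (x : (F.obj M).obj), IsWt (rep (F.obj M)) κ x →
      β M x = act _ f x := by
  let P (n : ℕ) : FinLen G := F.objPreimage (jet n κ)
  let e (n : ℕ) : F.obj (P n) ≅ jet n κ := F.objObjPreimageIso (jet n κ)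
  let x (n : ℕ) : (F.obj (P n)).obj := (e n).inv.hom (gen n κ)
  have hx (n : ℕ) : (e n).hom.hom (x n) = gen n κ := iso_hom_inv_apply _ _
  have hxw (n : ℕ) : IsWt (rep (F.obj (P n))) κ (x n) := (isWt_gen n κ).map _
  have hxk {n : ℕ} {f : Pow} : act _ f (x n) = 0 ↔ f ∈ maxIdeal ^ n := by
    have h1 : (e n).hom.hom (act _ f (x n)) = act _ f (gen n κ) := by rw [map_act, hx]
    rw [← act_gen_eq_zero_iff (κ := κ), ← h1]
    constructor
    · intro h
      rw [h]
      exact map_zero (e n).hom.hom.hom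
    · intro h
      rw [← iso_inv_hom_apply (e n) (act _ f (x n)), h]
      exact map_zero (e n).inv.hom.hom
  choose f hf using fun n => exists_act_gen ((e n).hom.hom (β (P n) (x n)))
  -- the value on the generator of `κ ⊗ R̂/mⁿ` determines all values on vectors killed by `mⁿ`
  have key (n : ℕ) (M : FinLen G) (y : (F.obj M).obj) (hy : IsWt (rep (F.obj M)) κ y)
      (hk : ∀ f ∈ maxIdeal ^ n, act _ f y = 0) : β M y = act _ (f n) y := by
    let φ : F.obj (P n) ⟶ F.obj M := (e n).hom ≫ jetHom y hy hk
    have hφ : F.map (F.preimage φ) = φ := F.map_preimage φ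
    have hy' : φ.hom (x n) = y := by
      rw [comp_hom_apply, hx, jetHom_gen]
    have := hβ _ _ (F.preimage φ) (x n)
    rw [hφ, hy'] at this
    rw [this, comp_hom_apply, ← hf, jetHom_act_gen]
  have hcoh {m n : ℕ} (hmn : m ≤ n) : f n - f m ∈ maxIdeal ^ m := by
    rw [← hxk, act_sub, ← key m _ _ (hxw m) fun _ h => hxk.2 h,
      ← key n _ _ (hxw m) fun _ h => hxk.2 (Ideal.pow_le_pow_right hmn h), sub_self]
  -- the limit of the `f n`, which are determined modulo `mⁿ`
  let f' : Pow := fun d => MvPowerSeries.coeff d (f (d.degree + 1))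
  have hf' (n : ℕ) : f' - f n ∈ maxIdeal ^ n := by
    rw [mem_maxIdeal_pow_iff]
    intro d hd
    have := mem_maxIdeal_pow_iff.1 (hcoh (Nat.succ_le_of_lt hd)) d (Nat.lt_succ_self _)
    rw [map_sub, sub_eq_zero] at this ⊢
    exact this.symm
  refine ⟨f', fun M y hy => ?_, fun f'' h => ?_⟩
  · obtain ⟨n, hn⟩ := exists_killed (F.obj M)
    rw [key n M y hy fun f hf => hn f hf y, eq_comm, ← sub_eq_zero, ← act_sub]
    exact hn _ (hf' n) y
  · ext d
    have h1 : act _ f'' (x (d.degree + 1)) = act _ (f (d.degree + 1)) (x (d.degree + 1)) := by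
      rw [← h _ _ (hxw _), key _ _ _ (hxw _) fun _ h => hxk.2 h]
    rw [← sub_eq_zero, ← act_sub, hxk, mem_maxIdeal_pow_iff] at h1
    have := h1 d (Nat.lt_succ_self _)
    rwa [map_sub, sub_eq_zero] at this

/-! ### Comparison of a module with its image -/

/-- The projection `κ ⊗ R̂/mⁿ → κ ⊗ R̂/mᵏ`. -/
def jetProj {k n : ℕ} (h : k ≤ n) (κ : Character G) : jet n κ ⟶ jet k κ :=
  jetHom (gen k κ) (isWt_gen k κ) fun _ hf => killed_jet (Ideal.pow_le_pow_right h hf) _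

omit [Finite G] in
lemma jetProj_gen {k n : ℕ} (h : k ≤ n) (κ : Character G) :
    (jetProj h κ).hom (gen n κ) = gen k κ := jetHom_gen _ _

omit [Finite G] in
lemma jetProj_surjective {k n : ℕ} (h : k ≤ n) (κ : Character G) :
    Function.Surjective (jetProj h κ).hom := fun x => by
  obtain ⟨f, rfl⟩ := exists_act_gen x
  exact ⟨act _ f (gen n κ), by rw [map_act, jetProj_gen]⟩

/-- A compatible system of vectors in the images of the modules `κ ⊗ R̂/mⁿ` under a functor, which
play the role of the generators. -/
structure Framing (F : FinLen G ⥤ FinLen G) where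
  /-- the distinguished vectors -/
  p (n : ℕ) (κ : Character G) : (F.obj (jet (n + 1) κ)).obj
  isWt (n : ℕ) (κ : Character G) : IsWt (rep _) κ (p n κ)
  map_p {k n : ℕ} (h : k ≤ n) (κ : Character G) :
    (F.map (jetProj (Nat.succ_le_succ h) κ)).hom (p n κ) = p k κ
  ne_zero (κ : Character G) : p 0 κ ≠ 0

/-- An exact functor that preserves the simple modules has a framing: the vectors are lifted along
the surjections `F (κ ⊗ R̂/mⁿ⁺¹) → F (κ ⊗ R̂/mⁿ)`. -/
lemma exists_framing (F : FinLen G ⥤ FinLen G) [F.PreservesEpimorphisms]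
    (hF : ∀ κ, Nonempty (F.obj (jet 1 κ) ≅ jet 1 κ)) : Nonempty (Framing F) := by
  suffices ∀ κ, ∃ p : ∀ n : ℕ, (F.obj (jet (n + 1) κ)).obj, (∀ n, IsWt (rep _) κ (p n)) ∧
      (∀ n, (F.map (jetProj (n + 1).le_succ κ)).hom (p (n + 1)) = p n) ∧ p 0 ≠ 0 by
    choose p h1 h2 h3 using this
    refine ⟨⟨fun n κ => p κ n, fun n κ => h1 κ n, fun {k n} h κ => ?_, h3⟩⟩
    induction n, h using Nat.le_induction with
    | base =>
      have : jetProj (le_refl (k + 1)) κ = 𝟙 _ := jet_hom_ext (jetProj_gen _ κ)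
      rw [this, F.map_id]
      rfl
    | succ n h ih =>
      have : jetProj (Nat.succ_le_succ (h.trans n.le_succ)) κ =
          jetProj (n + 1).le_succ κ ≫ jetProj (Nat.succ_le_succ h) κ := jet_hom_ext <| by
        rw [comp_hom_apply, jetProj_gen, jetProj_gen, jetProj_gen]
      rw [this, F.map_comp, comp_hom_apply, h2, ih]
  intro κ
  obtain ⟨e⟩ := hF κ
  have hlift (n : ℕ) (q : (F.obj (jet (n + 1) κ)).obj) (hq : IsWt (rep _) κ q) :
      ∃ q' : (F.obj (jet (n + 2) κ)).obj, IsWt (rep _) κ q' ∧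
        (F.map (jetProj (n + 1).le_succ κ)).hom q' = q := by
    have : Epi (jetProj (n + 1).le_succ κ) := epi_of_surjective _ (jetProj_surjective _ κ)
    obtain ⟨q', hq'⟩ := surjective_of_epi (F.map (jetProj (n + 1).le_succ κ)) q
    exact ⟨wtProj (rep _) κ q', isWt_wtProj _, by rw [map_wtProj', hq', hq.wtProj_eq]⟩
  choose q' hq' hq'' using hlift
  have hne : gen 1 κ ≠ 0 := by
    rw [← act_one _ (gen 1 κ), Ne, act_gen_eq_zero_iff, pow_one, mem_maxIdeal_iff]
    simp
  let s (n : ℕ) : {q : (F.obj (jet (n + 1) κ)).obj // IsWt (rep _) κ q} :=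
    Nat.rec ⟨e.inv.hom (gen 1 κ), (isWt_gen 1 κ).map _⟩ (fun n s => ⟨q' n s.1 s.2, hq' n s.1 s.2⟩) n
  refine ⟨fun n => (s n).1, fun n => (s n).2, fun n => hq'' n _ (s n).2, fun h => hne ?_⟩
  rw [← iso_hom_inv_apply e (gen 1 κ), show e.inv.hom (gen 1 κ) = 0 from h]
  exact map_zero e.hom.hom.hom

namespace Framing

variable {F : FinLen G ⥤ FinLen G} (p : Framing F)

variable (M) in
/-- An exponent `n` such that `mⁿ⁺¹` annihilates `M`. -/
def exponent (_ : Framing F) : ℕ := (exists_killed M).choose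

omit [Finite G] in
variable (M) in
lemma killed_exponent {n : ℕ} (h : p.exponent M ≤ n) (f : Pow) (hf : f ∈ maxIdeal ^ (n + 1))
    (m : M.obj) : act M f m = 0 :=
  (exists_killed M).choose_spec f (Ideal.pow_le_pow_right (h.trans n.le_succ) hf) m

/-- The image of the framing under the morphism from `κ ⊗ R̂/mⁿ` defined by the component of weight
`κ` of a vector. -/
def evalWt (κ : Character G) (m : M.obj) : (F.obj M).obj :=
  (F.map (jetHom (wtProj (rep M) κ m) (isWt_wtProj m)
    fun f hf => p.killed_exponent M le_rfl f hf _)).hom (p.p _ κ)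

/-- The evaluation can be computed with any sufficiently large exponent. -/
lemma evalWt_eq {n : ℕ} (hn : p.exponent M ≤ n) {κ : Character G} {m : M.obj}
    (φ : jet (n + 1) κ ⟶ M) (h : φ.hom (gen _ κ) = wtProj (rep M) κ m) :
    p.evalWt κ m = (F.map φ).hom (p.p n κ) := by
  rw [evalWt, ← p.map_p hn κ, ← comp_hom_apply, ← F.map_comp]
  have : jetProj (Nat.succ_le_succ hn) κ ≫ jetHom (wtProj (rep M) κ m) (isWt_wtProj m)
      (fun f hf => p.killed_exponent M le_rfl f hf _) = φ := jet_hom_ext (by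
    rw [comp_hom_apply, jetProj_gen, jetHom_gen, h])
  rw [this]

lemma isWt_evalWt (κ : Character G) (m : M.obj) : IsWt (rep (F.obj M)) κ (p.evalWt κ m) :=
  (p.isWt _ κ).map _

lemma map_evalWt (φ : M ⟶ N) (κ : Character G) (m : M.obj) :
    (F.map φ).hom (p.evalWt κ m) = p.evalWt κ (φ.hom m) := by
  let n := max (p.exponent M) (p.exponent N)
  have hM : p.exponent M ≤ n := le_max_left _ _
  have hN : p.exponent N ≤ n := le_max_right _ _
  let ψ : jet (n + 1) κ ⟶ M := jetHom (wtProj (rep M) κ m) (isWt_wtProj m)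
    fun f hf => p.killed_exponent M hM f hf _
  have hψ : ψ.hom (gen _ κ) = wtProj (rep M) κ m := jetHom_gen _ _
  rw [p.evalWt_eq hM ψ hψ, p.evalWt_eq hN (ψ ≫ φ) (by rw [comp_hom_apply, hψ, map_wtProj']),
    F.map_comp, comp_hom_apply]

lemma evalWt_add [F.Additive] (κ : Character G) (m m' : M.obj) :
    p.evalWt κ (m + m') = p.evalWt κ m + p.evalWt κ m' := by
  rw [p.evalWt_eq le_rfl (jetHom (wtProj (rep M) κ m) (isWt_wtProj m)
    (fun f hf => p.killed_exponent M le_rfl f hf _) + jetHom (wtProj (rep M) κ m') (isWt_wtProj m')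
    (fun f hf => p.killed_exponent M le_rfl f hf _)), F.map_add]
  · rfl
  · rw [add_hom_apply, jetHom_gen, jetHom_gen, map_add]

lemma evalWt_smul [F.Linear ℂ] (κ : Character G) (c : ℂ) (m : M.obj) :
    p.evalWt κ (c • m) = c • p.evalWt κ m := by
  rw [p.evalWt_eq le_rfl (c • jetHom (wtProj (rep M) κ m) (isWt_wtProj m)
    (fun f hf => p.killed_exponent M le_rfl f hf _)), F.map_smul]
  · rfl
  · rw [smul_hom_apply, jetHom_gen, map_smul]

/-- If a vector of weight `κ` is not zero, then the module `κ` is a quotient of the submodule it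
generates, so that the framing has a nonzero image. -/
lemma eq_zero_of_evalWt_eq_zero [F.PreservesMonomorphisms] [IsCyclic G] {κ : Character G}
    {m : M.obj} (h : p.evalWt κ m = 0) : wtProj (rep M) κ m = 0 := by
  by_contra hne
  let n := p.exponent M
  let φ : jet (n + 1) κ ⟶ M := jetHom (wtProj (rep M) κ m) (isWt_wtProj m)
    fun f hf => p.killed_exponent M le_rfl f hf _
  let U : Submodule (SkewPow G) (jet (n + 1) κ).obj := LinearMap.ker φ.hom.hom
  let ι : quot _ U ⟶ M := quotDesc U φ fun x hx => hx
  have hι : Mono ι := mono_of_injective _ <| (injective_iff_map_eq_zero ι.hom.hom).2 fun x hx => by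
    obtain ⟨x, rfl⟩ := quotMk_surjective U x
    exact quotMk_eq_zero.2 hx
  have h1 : (F.map (quotMk _ U)).hom (p.p n κ) = 0 := by
    refine injective_of_mono (F.map ι) ?_
    rw [← comp_hom_apply, ← F.map_comp, show quotMk _ U ≫ ι = φ from rfl]
    exact h.trans (map_zero (F.map ι).hom.hom).symm
  let q : quot _ U ⟶ jet 1 κ := quotDesc U (jetProj (Nat.succ_le_succ n.zero_le) κ) fun x hx => by
    obtain ⟨f, rfl⟩ := exists_act_gen x
    rw [map_act, jetProj_gen, act_gen_eq_zero_iff, pow_one]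
    by_contra hf
    obtain ⟨f', hf'⟩ := (isUnit_iff_notMem_maxIdeal.2 hf).exists_left_inv
    have hx : act M f (wtProj (rep M) κ m) = 0 := by
      rw [← jetHom_act_gen (isWt_wtProj m) fun f hf => p.killed_exponent M le_rfl f hf _]
      exact hx
    apply hne
    rw [← act_one M (wtProj (rep M) κ m), ← hf', ← act_act, hx, act_zero]
  have h2 := p.map_p n.zero_le κ
  rw [show jetProj (Nat.succ_le_succ n.zero_le) κ = quotMk _ U ≫ q from rfl, F.map_comp,
    comp_hom_apply, h1] at h2
  exact p.ne_zero κ (h2.symm.trans (map_zero (F.map q).hom.hom))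

attribute [local instance] Fintype.ofFinite

variable (M) in
/-- The comparison map `M → F M`, which sends the vector corresponding to a morphism from
`κ ⊗ R̂/mⁿ` to the image of the framing. It is not linear over `R̂`. -/
def eta [F.Additive] [F.Linear ℂ] : M.obj →ₗ[ℂ] (F.obj M).obj where
  toFun m := ∑ κ, p.evalWt κ m
  map_add' m m' := by simp only [evalWt_add, Finset.sum_add_distrib]
  map_smul' c m := by simp only [evalWt_smul, Finset.smul_sum, RingHom.id_apply]

variable [F.Additive] [F.Linear ℂ]

lemma eta_apply (m : M.obj) : p.eta M m = ∑ κ, p.evalWt κ m := rfl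

lemma eta_natural (φ : M ⟶ N) (m : M.obj) :
    (F.map φ).hom (p.eta M m) = p.eta N (φ.hom m) := by
  rw [eta_apply, eta_apply]
  refine (map_sum (F.map φ).hom.hom _ _).trans ?_
  exact Finset.sum_congr rfl fun κ _ => p.map_evalWt φ κ m

lemma wtProj_eta (κ : Character G) (m : M.obj) :
    wtProj (rep (F.obj M)) κ (p.eta M m) = p.evalWt κ m :=
  wtProj_sum (fun κ => p.isWt_evalWt κ m) κ

variable [IsCyclic G]

omit [F.Additive] in
lemma evalWt_rep (κ : Character G) (g : G) (m : M.obj) :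
    p.evalWt κ (rep M g m) = (κ g : ℂ) • p.evalWt κ m := by
  rw [← evalWt_smul]
  refine p.evalWt_eq le_rfl _ ?_
  rw [jetHom_gen, ← map_wtProj (rep M g) (ρ := rep M) (ρ' := rep M), isWt_wtProj, map_smul]
  intro h v
  rw [← Module.End.mul_apply, ← Module.End.mul_apply, ← map_mul, ← map_mul,
    (IsCyclic.commGroup (α := G)).mul_comm]

lemma eta_rep (g : G) (m : M.obj) : p.eta M (rep M g m) = rep _ g (p.eta M m) := by
  rw [eta_apply, eta_apply, map_sum]
  refine Finset.sum_congr rfl fun κ _ => ?_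
  rw [p.isWt_evalWt, evalWt_rep]

/-- On the weight space of `κ` the comparison map is the evaluation `evalWt κ`, which has no kernel
there. -/
lemma eta_injective [F.PreservesMonomorphisms] : Function.Injective (p.eta M) := by
  refine (injective_iff_map_eq_zero _).2 fun m hm => ?_
  rw [← sum_wtProj (ρ := rep M) m]
  refine Finset.sum_eq_zero fun κ _ => p.eq_zero_of_evalWt_eq_zero ?_
  rw [← wtProj_eta, hm, map_zero]

end Framing

end KleinianSurface

end

noncomputable section

namespace KleinianSurface

attribute [local instance] ModuleCat.moduleOfAlgebraModule
  ModuleCat.isScalarTower_of_algebra_moduleCat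

attribute [local instance] Fintype.ofFinite

variable {G : Subgroup SL₂}

/-! ### Autoequivalences of the category of equivariant modules of finite length -/

lemma IsWt.rep {M : FinLen G} {κ : Character G} {m : M.obj} (hm : IsWt (rep M) κ m) (g : G) :
    IsWt (rep M) κ (rep M g m) := by
  rw [hm g]
  exact hm.smul _

lemma rep_inv_rep (M : FinLen G) (g : G) (m : M.obj) : rep M g (rep M g⁻¹ m) = m := by
  rw [← Module.End.mul_apply, ← map_mul, mul_inv_cancel, map_one, Module.End.one_apply]

lemma finrank_eq_of_iso {M N : FinLen G} (e : M ≅ N) :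
    Module.finrank ℂ M.obj = Module.finrank ℂ N.obj :=
  LinearEquiv.finrank_eq <| LinearEquiv.ofBijective (homLinear e.hom) <|
    Function.bijective_iff_has_inverse.2
      ⟨e.inv.hom, iso_inv_hom_apply e, iso_hom_inv_apply e⟩

namespace Framing

variable [Finite G] [IsCyclic G] {F : FinLen G ⥤ FinLen G} (p : Framing F) [F.Additive] [F.Linear ℂ]

/-- The operator `f` on the module `F M` corresponds to the operator `h` on `M`, on vectors of
weight `κ`. -/
def Corresponds (κ : Character G) (h f : Pow) : Prop :=
  ∀ (M : FinLen G) (m : M.obj), IsWt (rep M) κ m → p.eta M (act M h m) = act _ f (p.eta M m)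

variable {p} {κ : Character G}

lemma isWt_eta {M : FinLen G} {m : M.obj} (hm : IsWt (rep M) κ m) :
    IsWt (rep (F.obj M)) κ (p.eta M m) := fun g => by
  rw [← eta_rep, hm, map_smul]

namespace Corresponds

omit [IsCyclic G] in
lemma add {h f h' f' : Pow} (H : p.Corresponds κ h f) (H' : p.Corresponds κ h' f') :
    p.Corresponds κ (h + h') (f + f') := fun M m hm => by
  rw [act_add, act_add, map_add, H M m hm, H' M m hm]

omit [IsCyclic G] in
lemma smul {h f : Pow} (H : p.Corresponds κ h f) (c : ℂ) :
    p.Corresponds κ (c • h) (c • f) := fun M m hm => by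
  rw [act_smul_left, act_smul_left, map_smul, H M m hm]

lemma group_smul {h f : Pow} (H : p.Corresponds κ h f) (g : G) :
    p.Corresponds κ (g • h) (g • f) := fun M m hm => by
  rw [← rep_inv_rep M g m, ← rep_act, eta_rep, eta_rep, H M _ (hm.rep g⁻¹), rep_act]

omit [IsCyclic G] in
lemma mul {μ : Character G} {h f h' f' : Pow} (H : p.Corresponds κ h f)
    (H' : p.Corresponds (κ * μ) h' f') (hh : IsWt (powRep G) μ h) :
    p.Corresponds κ (h' * h) (f' * f) := fun M m hm => by
  rw [← act_act, ← act_act, H' M _ (hm.act hh), H M m hm]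

end Corresponds

variable (hp : ∀ M, Function.Bijective (p.eta M))

/-- The comparison map, as a linear equivalence. -/
def etaEquiv (M : FinLen G) : M.obj ≃ₗ[ℂ] (F.obj M).obj := LinearEquiv.ofBijective _ (hp M)

include hp

omit [IsCyclic G] in
/-- Operators given by functions on the modules `F M`, transported along the comparison maps, are
natural operators on the modules `M`, hence given by functions on each weight space. -/
lemma existsUnique_left (κ : Character G) (f : Pow) : ∃! h, p.Corresponds κ h f := by
  have := exists_series (𝟭 (FinLen G)) (fun M m => (etaEquiv hp M).symm (act _ f (p.eta M m)))
    (fun M N φ x => by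
      apply (etaEquiv hp N).injective
      rw [LinearEquiv.apply_symm_apply]
      refine Eq.trans ?_ (p.eta_natural φ _)
      change act (F.obj N) f (p.eta N (φ.hom x)) =
        (F.map φ).hom (etaEquiv hp M ((etaEquiv hp M).symm (act (F.obj M) f (p.eta M x))))
      rw [LinearEquiv.apply_symm_apply, map_act, eta_natural]) κ
  refine (existsUnique_congr fun h => ?_).1 this
  refine forall_congr' fun M => forall_congr' fun m => imp_congr_right fun hm => ?_
  rw [LinearEquiv.symm_apply_eq, eq_comm]
  rfl

/-- The converse of `existsUnique_left`, which uses that `F` is full and essentially surjective. -/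
lemma existsUnique_right [F.Full] [F.EssSurj] (κ : Character G) (h : Pow) :
    ∃! f, p.Corresponds κ h f := by
  have := exists_series F (fun M x => p.eta M (act M h ((etaEquiv hp M).symm x)))
    (fun M N φ x => by
      obtain ⟨m, rfl⟩ := (etaEquiv hp M).surjective x
      rw [LinearEquiv.symm_apply_apply, eta_natural, map_act]
      congr 2
      rw [LinearEquiv.symm_apply_eq]
      exact p.eta_natural φ m) κ
  refine (existsUnique_congr fun f => ?_).1 this
  refine forall_congr' fun M => ⟨fun H m hm => ?_, fun H x hx => ?_⟩
  · have := H (p.eta M m) (isWt_eta hm)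
    rwa [show (etaEquiv hp M).symm (p.eta M m) = m from (etaEquiv hp M).symm_apply_apply m] at this
  · obtain ⟨m, rfl⟩ := (etaEquiv hp M).surjective x
    rw [LinearEquiv.symm_apply_apply]
    refine H m fun g => (hp M).1 ?_
    rw [eta_rep, map_smul]
    exact hx g

/-- A fully faithful functor with a framing for which the comparison maps are bijective
transports the action of functions on the images of the modules to the modules. -/
lemma exists_weightedAut [F.Full] [F.EssSurj] :
    ∃ Ψ : WeightedAut G, ∀ κ f, p.Corresponds κ (Ψ.ψ κ f) f := by
  choose ψ hψ hψ' using existsUnique_left hp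
  have huniq {κ h h' f} (H : p.Corresponds κ h f) (H' : p.Corresponds κ h' f) : h = h' :=
    (hψ' κ f h H).trans (hψ' κ f h' H').symm
  have hsmul (κ : Character G) (g : G) (f : Pow) : ψ κ (g • f) = g • ψ κ f :=
    huniq (hψ κ _) ((hψ κ f).group_smul g)
  let ψl (κ : Character G) : Pow →ₗ[ℂ] Pow :=
    { toFun := ψ κ
      map_add' := fun f f' => huniq (hψ κ _) ((hψ κ f).add (hψ κ f'))
      map_smul' := fun c f => huniq (hψ κ _) ((hψ κ f).smul c) }
  have hbij (κ : Character G) : Function.Bijective (ψl κ) := by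
    refine ⟨fun f f' h => ?_, fun h => ?_⟩
    · refine (existsUnique_right hp κ (ψ κ f)).unique (hψ κ f) ?_
      rw [show ψ κ f = ψ κ f' from h]
      exact hψ κ f'
    · obtain ⟨f, hf, -⟩ := existsUnique_right hp κ h
      exact ⟨f, huniq (hψ κ f) hf⟩
  refine ⟨⟨fun κ => LinearEquiv.ofBijective (ψl κ) (hbij κ), hsmul, fun κ μ f f' hf => ?_⟩, hψ⟩
  refine huniq (hψ κ _) ((hψ κ f).mul (hψ (κ * μ) f') fun g => ?_)
  rw [powRep_apply, ← hsmul]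
  exact ((congrArg (ψ κ) (hf g)).trans ((ψl κ).map_smul _ f))

end Framing

section Rescale

variable [Finite G] (u : Character G → Powˣ)

variable (M : FinLen G) in
/-- The operator that acts on vectors of weight `κ` as the inverse of the function `u κ`. -/
def rescale : M.obj →ₗ[ℂ] M.obj where
  toFun m := ∑ κ, act M ((u κ)⁻¹ : Powˣ) (wtProj (rep M) κ m)
  map_add' m m' := by simp only [map_add, act_add_right, Finset.sum_add_distrib]
  map_smul' c m := by simp only [map_smul, act_smul, Finset.smul_sum, RingHom.id_apply]

variable {M N : FinLen G}

lemma rescale_apply (m : M.obj) :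
    rescale u M m = ∑ κ, act M ((u κ)⁻¹ : Powˣ) (wtProj (rep M) κ m) := rfl

lemma rescale_of_isWt {κ : Character G} {m : M.obj} (hm : IsWt (rep M) κ m) :
    rescale u M m = act M ((u κ)⁻¹ : Powˣ) m := by
  rw [rescale_apply, Finset.sum_eq_single κ, hm.wtProj_eq]
  · intro μ _ hμ
    rw [hm.wtProj_eq_zero hμ.symm, act_zero]
  · simp

lemma rescale_natural (φ : M ⟶ N) (m : M.obj) : φ.hom (rescale u M m) = rescale u N (φ.hom m) := by
  refine (map_sum φ.hom.hom _ _).trans (Finset.sum_congr rfl fun κ _ => ?_)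
  refine (map_act φ _ _).trans ?_
  rw [map_wtProj']

variable {u} (hu : ∀ κ (g : G), g • (u κ : Pow) = u κ)

include hu

omit [Finite G] in
lemma smul_unit_inv (κ : Character G) (g : G) :
    g • (((u κ)⁻¹ : Powˣ) : Pow) = ((u κ)⁻¹ : Powˣ) := by
  rw [← Units.mul_right_inj (u κ), Units.mul_inv, ← hu κ g, ← smul_mul', Units.mul_inv, smul_one]

omit [Finite G] in
lemma isWt_act_unit_inv (κ : Character G) {μ : Character G} {m : M.obj} (hm : IsWt (rep M) μ m) :
    IsWt (rep M) μ (act M ((u κ)⁻¹ : Powˣ) m) := by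
  have := hm.act (isWt_one_iff.2 (smul_unit_inv hu κ))
  rwa [mul_one] at this

lemma rescale_bijective [IsCyclic G] : Function.Bijective (rescale u M) := by
  have := finite_obj M
  have : Function.Injective (rescale u M) := by
    refine (injective_iff_map_eq_zero _).2 fun m hm => ?_
    rw [← sum_wtProj (ρ := rep M) m]
    refine Finset.sum_eq_zero fun κ _ => ?_
    have h := wtProj_sum (fun κ => isWt_act_unit_inv hu κ (isWt_wtProj (ρ := rep M) (κ := κ) m)) κ
    rw [← rescale_apply, hm, map_zero] at h
    rw [← act_one M (wtProj (rep M) κ m), ← Units.mul_inv (u κ), ← act_act, ← h, act_zero]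
  exact ⟨this, LinearMap.surjective_of_injective this⟩

lemma rescale_rep [IsCyclic G] (g : G) (m : M.obj) :
    rescale u M (rep M g m) = rep M g (rescale u M m) := by
  rw [← sum_wtProj (ρ := rep M) m, map_sum, map_sum, map_sum, map_sum]
  refine Finset.sum_congr rfl fun κ _ => ?_
  have h := isWt_wtProj (ρ := rep M) (κ := κ) m
  rw [rescale_of_isWt u h, h, map_smul, rescale_of_isWt u h, isWt_act_unit_inv hu κ h]

end Rescale

/-- The restriction to invariant functions of an equivariant automorphism. -/
def restrictInvariants (τ : Pow ≃ₐ[ℂ] Pow) (hτ : ∀ (g : G) (f : Pow), τ (g • f) = g • τ f) :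
    AutY G :=
  have hτ' (g : G) (f : Pow) : τ.symm (g • f) = g • τ.symm f := by
    rw [AlgEquiv.symm_apply_eq, hτ, AlgEquiv.apply_symm_apply]
  AlgEquiv.ofAlgHom
    ((τ.toAlgHom.comp (invariants G).val).codRestrict _ fun f g => by
      exact (hτ g f).symm.trans (congrArg τ (f.2 g)))
    ((τ.symm.toAlgHom.comp (invariants G).val).codRestrict _ fun f g => by
      exact (hτ' g f).symm.trans (congrArg τ.symm (f.2 g)))
    (by ext f : 2; exact τ.apply_symm_apply f) (by ext f : 2; exact τ.symm_apply_apply f)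

/-- An equivariant automorphism is a lift of its restriction to invariant functions. -/
def equivariantLift (τ : Pow ≃ₐ[ℂ] Pow) (hτ : ∀ (g : G) (f : Pow), τ (g • f) = g • τ f) :
    Lift (restrictInvariants τ hτ) where
  τ := τ
  θ := MulEquiv.refl G
  equivariant := hτ
  restricts _ := rfl

lemma act_pullback {σ : AutY G} (t : Lift σ) (M : FinLen G) (f : Pow) (m : M.obj) :
    act (t.pullback.obj M) f m = act M (t.τ.symm f) m := by
  refine (congrArg (fun s : SkewPow G => s • m) (t.skewInv_single 1 f)).trans ?_
  rw [map_one]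
  rfl

lemma rep_pullback {σ : AutY G} (t : Lift σ) (M : FinLen G) (g : G) (m : M.obj) :
    rep (t.pullback.obj M) g m = rep M (t.θ.symm g) m := by
  refine (congrArg (fun s : SkewPow G => s • m) (t.skewInv_single g 1)).trans ?_
  rw [map_one]
  rfl

variable [Finite G] [IsCyclic G]

/-- A `ℂ`-linear autoequivalence of the category of equivariant modules of finite length that
preserves the simple modules is isomorphic to the pullback along an equivariant automorphism. -/
theorem exists_iso_pullback (E : FinLen G ≌ FinLen G) [E.functor.Additive] [E.functor.Linear ℂ]
    (h : ∀ κ, Nonempty (E.functor.obj (jet 1 κ) ≅ jet 1 κ)) :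
    ∃ (σ : AutY G) (t : Lift σ), Nonempty (E.functor ≅ t.pullback) := by
  obtain ⟨p⟩ := exists_framing E.functor h
  obtain ⟨q⟩ := exists_framing E.inverse fun κ =>
    ⟨E.inverse.mapIso (h κ).some.symm ≪≫ (E.unitIso.app _).symm⟩
  have := E.inverse_additive
  have := Equivalence.inverseLinear (R := ℂ) E
  -- the comparison maps for `E` and its inverse are injective, so the dimensions are equal
  have hp (M : FinLen G) : Function.Bijective (p.eta M) := by
    have := finite_obj M
    have := finite_obj (E.functor.obj M)
    have := finite_obj (E.inverse.obj (E.functor.obj M))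
    have h1 : Function.Injective (p.eta M) := p.eta_injective
    have h2 : Function.Injective (q.eta (E.functor.obj M)) := q.eta_injective
    have h3 : Module.finrank ℂ M.obj = Module.finrank ℂ (E.inverse.obj (E.functor.obj M)).obj :=
      finrank_eq_of_iso (E.unitIso.app M)
    have h4 := LinearMap.finrank_le_finrank_of_injective h1
    have h5 := LinearMap.finrank_le_finrank_of_injective h2
    exact ⟨h1, (LinearMap.injective_iff_surjective_of_finrank_eq_finrank
      (le_antisymm h4 (h5.trans h3.ge))).1 h1⟩
  obtain ⟨Ψ, hΨ⟩ := Framing.exists_weightedAut hp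
  obtain ⟨u, τ, hu, hτ, huτ⟩ := Ψ.exists_algEquiv
  have hτ' (g : G) (f : Pow) : τ.symm (g • f) = g • τ.symm f := by
    rw [AlgEquiv.symm_apply_eq, hτ, AlgEquiv.apply_symm_apply]
  -- after rescaling, the comparison map is semilinear along `τ`
  let θ (M : FinLen G) : M.obj →ₗ[ℂ] (E.functor.obj M).obj := p.eta M ∘ₗ rescale u M
  have hθ (M : FinLen G) : Function.Bijective (θ M) := (hp M).comp (rescale_bijective hu)
  have hrep (M : FinLen G) (g : G) (m : M.obj) : θ M (rep M g m) = rep _ g (θ M m) := by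
    change p.eta M (rescale u M _) = rep _ g (p.eta M (rescale u M _))
    rw [rescale_rep hu, Framing.eta_rep]
  have hwt (M : FinLen G) {κ μ : Character G} {f : Pow} {m : M.obj} (hf : IsWt (powRep G) μ f)
      (hm : IsWt (rep M) κ m) : θ M (act M (τ f) m) = act _ f (θ M m) := by
    change p.eta M (rescale u M _) = act _ f (p.eta M (rescale u M _))
    have hτf : IsWt (powRep G) μ (τ f) := fun g => by
      rw [powRep_apply, ← hτ, ← map_smul τ]
      exact congrArg τ (hf g)
    rw [rescale_of_isWt u hm, rescale_of_isWt u (hm.act hτf),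
      ← hΨ κ f M _ (isWt_act_unit_inv hu κ hm), act_act, act_act]
    congr 2
    rw [Units.inv_mul_eq_iff_eq_mul, ← mul_assoc, Units.eq_mul_inv_iff_mul_eq, huτ κ μ f hf]
  have hact (M : FinLen G) (f : Pow) (m : M.obj) : θ M (act M (τ f) m) = act _ f (θ M m) := by
    rw [← sum_wtProj (ρ := rep M) m, ← sum_wtProj (ρ := powRep G) f]
    have hsum1 (N : FinLen G) (f : Pow) (s : Character G → N.obj) :
        act N f (∑ κ, s κ) = ∑ κ, act N f (s κ) := Finset.smul_sum
    have hsum2 (N : FinLen G) (s : Character G → Pow) (x : N.obj) :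
        act N (∑ κ, s κ) x = ∑ κ, act N (s κ) x :=
      map_sum (⟨⟨fun f => act N f x, act_zero_left _ _⟩, fun f f' => act_add N f f' x⟩ : Pow →+ N.obj)
        _ _
    rw [map_sum τ, hsum2, map_sum (θ M), hsum2]
    refine Finset.sum_congr rfl fun μ _ => ?_
    rw [hsum1, map_sum (θ M), map_sum (θ M), hsum1]
    exact Finset.sum_congr rfl fun κ _ => hwt M (isWt_wtProj _) (isWt_wtProj _)
  let t := equivariantLift τ.symm hτ'
  refine ⟨_, t, ⟨(NatIso.ofComponents (fun M => isoOfBijective (M := t.pullback.obj M)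
    (mkHom (M := t.pullback.obj M) (θ M).toAddMonoidHom (fun f m => ?_) (fun g m => ?_)) (hθ M))
      fun {M N} φ => ?_).symm⟩⟩
  · refine Eq.trans ?_ (hact M f m)
    exact congrArg (θ M) (act_pullback t M f m)
  · refine Eq.trans ?_ (hrep M g m)
    exact congrArg (θ M) (rep_pullback t M g m)
  · refine hom_ext_apply fun m => ?_
    change p.eta N (rescale u N (φ.hom m)) = (E.functor.map φ).hom (p.eta M (rescale u M m))
    rw [Framing.eta_natural]
    exact congrArg _ (rescale_natural u φ m).symm

end KleinianSurface

end

noncomputable section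

namespace KleinianSurface

attribute [local instance] ModuleCat.moduleOfAlgebraModule
  ModuleCat.isScalarTower_of_algebra_moduleCat

attribute [local instance] Fintype.ofFinite

variable {G : Subgroup SL₂}

/-! ### Uniqueness of lifts -/

variable [Finite G]

/-- An automorphism that fixes the invariant functions maps each function to a conjugate of it, so
it agrees with one of the elements of `G`, because a complex vector space is not a finite union of
proper subspaces. -/
lemma exists_eq_smul_of_fixes_invariants (ω : Pow ≃ₐ[ℂ] Pow) (h : ∀ f : invariants G, ω f = f) :
    ∃ g : G, ∀ f, ω f = g • f := by
  let W (g : G) : Submodule ℂ Pow := LinearMap.ker (ω.toLinearMap - powRep G g)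
  have hW (g : G) (f : Pow) : f ∈ W g ↔ ω f = g • f := by
    rw [LinearMap.mem_ker, LinearMap.sub_apply, sub_eq_zero]
    rfl
  suffices ⋃ g, (W g : Set Pow) = Set.univ by
    obtain ⟨g, hg⟩ := Subspace.exists_eq_top_of_iUnion_eq_univ this
    exact ⟨g, fun f => (hW g f).1 (hg ▸ Submodule.mem_top)⟩
  refine Set.eq_univ_of_forall fun f => Set.mem_iUnion.2 ?_
  -- `f` is a root of `∏ (X - g • f)`, whose coefficients are invariant
  let P := MulSemiringAction.charpoly G f
  have hP : P.map (ω : Pow →+* Pow) = P := by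
    ext1 n
    rw [Polynomial.coeff_map]
    exact h ⟨P.coeff n, fun g => MulSemiringAction.smul_coeff_charpoly f n g⟩
  have h0 : P.eval (ω f) = 0 := by
    have := Polynomial.eval_map_apply (f := (ω : Pow →+* Pow)) (p := P) f
    rw [hP, MulSemiringAction.eval_charpoly, map_zero] at this
    exact this
  rw [show P = _ from MulSemiringAction.charpoly_eq G f, Polynomial.eval_prod,
    Finset.prod_eq_zero_iff] at h0
  obtain ⟨g, -, hg⟩ := h0
  refine ⟨g, (hW g f).2 ?_⟩
  rwa [Polynomial.eval_sub, Polynomial.eval_X, Polynomial.eval_C, sub_eq_zero] at hg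

/-- The pullbacks along two lifts of the same automorphism are isomorphic: the lifts differ by an
element `g` of `G`, and the action of `g` on equivariant modules provides the isomorphism. -/
lemma nonempty_pullback_iso [IsCyclic G] {σ : AutY G} (t t' : Lift σ) :
    Nonempty (t.pullback ≅ t'.pullback) := by
  obtain ⟨g, hg⟩ := exists_eq_smul_of_fixes_invariants (G := G) (t'.τ.trans t.τ.symm) fun f => by
    change t.τ.symm (t'.τ f) = f
    rw [t'.restricts, ← t.restricts, AlgEquiv.symm_apply_apply]
  have hτ (f : Pow) : t'.τ f = t.τ (g • f) := by
    rw [← hg]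
    exact (t.τ.apply_symm_apply _).symm
  have hcomm (a b : G) : a * b = b * a := (IsCyclic.commGroup (α := G)).mul_comm a b
  have hθ (h : G) : t'.θ h = t.θ h := by
    have key (f : Pow) : t'.θ h • f = t.θ h • f := by
      obtain ⟨f, rfl⟩ := t'.τ.surjective f
      rw [← t'.equivariant, hτ, hτ, smul_smul, hcomm, ← smul_smul, t.equivariant]
    have := eq_one_of_smul_X ((t.θ h)⁻¹ * t'.θ h) fun i => by
      rw [mul_smul, key, inv_smul_smul]
    exact (inv_mul_eq_one.1 this).symm
  have hτ' (f : Pow) : t'.τ.symm f = g⁻¹ • t.τ.symm f := by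
    rw [AlgEquiv.symm_apply_eq, hτ, smul_inv_smul, AlgEquiv.apply_symm_apply]
  have hθ' (h : G) : t'.θ.symm h = t.θ.symm h := by
    rw [MulEquiv.symm_apply_eq, hθ, MulEquiv.apply_symm_apply]
  have hact (M : FinLen G) (f : Pow) (m : M.obj) :
      rep M g⁻¹ (act M (t.τ.symm f) m) = act M (t'.τ.symm f) (rep M g⁻¹ m) := by
    rw [rep_act, hτ']
  have hrep (M : FinLen G) (h : G) (m : M.obj) :
      rep M g⁻¹ (rep M (t.θ.symm h) m) = rep M (t'.θ.symm h) (rep M g⁻¹ m) := by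
    rw [← Module.End.mul_apply, ← Module.End.mul_apply, ← map_mul, ← map_mul, hθ', hcomm]
  refine ⟨NatIso.ofComponents (fun M => isoOfBijective
    (mkHom (M := t.pullback.obj M) (N := t'.pullback.obj M) (rep M g⁻¹).toAddMonoidHom
      (fun f m => ?_) (fun h m => ?_)) ?_) fun {M N} φ => ?_⟩
  · refine (congrArg (rep M g⁻¹) (act_pullback t M f m)).trans ?_
    exact (hact M f m).trans (act_pullback t' M f (rep M g⁻¹ m)).symm
  · refine (congrArg (rep M g⁻¹) (rep_pullback t M h m)).trans ?_
    exact (hrep M h m).trans (rep_pullback t' M h (rep M g⁻¹ m)).symm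
  · refine Function.bijective_iff_has_inverse.2 ⟨rep M g, fun m => rep_inv_rep M g m, fun m => ?_⟩
    have := rep_inv_rep M g⁻¹ m
    rw [inv_inv] at this
    exact this
  · exact hom_ext_apply fun m => (map_rep φ g⁻¹ m).symm

end KleinianSurface

end

noncomputable section

namespace KleinianSurface

attribute [local instance] ModuleCat.moduleOfAlgebraModule
  ModuleCat.isScalarTower_of_algebra_moduleCat

/-! ### Equivariant coherent sheaves supported at the origin -/

open MvPolynomial (idealOfVars)

lemma coe_mem_maxIdeal_pow_iff {n : ℕ} {f : Poly} :
    (f : Pow) ∈ maxIdeal ^ n ↔ f ∈ idealOfVars (Fin 2) ℂ ^ n := by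
  rw [mem_maxIdeal_pow_iff, MvPolynomial.mem_pow_idealOfVars_iff']
  simp only [MvPolynomial.coeff_coe]

/-- Power series are polynomials modulo each power of the maximal ideal. -/
lemma sub_truncTotal_mem (n : ℕ) (f : Pow) :
    f - (MvPowerSeries.truncTotal n f : Poly) ∈ maxIdeal ^ n := by
  rw [mem_maxIdeal_pow_iff]
  intro d hd
  rw [map_sub, MvPolynomial.coeff_coe, MvPowerSeries.coeff_truncTotal _ hd, sub_self]

instance finite_quotient_idealOfVars_pow (n : ℕ) :
    Module.Finite ℂ (Poly ⧸ idealOfVars (Fin 2) ℂ ^ n) := by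
  have hfin : Finite {d : Fin 2 →₀ ℕ | d.degree < n} := Finsupp.finite_of_degree_lt n
  let _ := Fintype.ofFinite {d : Fin 2 →₀ ℕ | d.degree < n}
  let b := Fintype.linearCombination ℂ
    (fun d : {d : Fin 2 →₀ ℕ | d.degree < n} => (MvPolynomial.monomial d.1 1 : Poly))
  refine Module.Finite.of_surjective
    ((Ideal.Quotient.mkₐ ℂ (idealOfVars (Fin 2) ℂ ^ n)).toLinearMap ∘ₗ b) fun x => ?_
  obtain ⟨x, rfl⟩ := Ideal.Quotient.mk_surjective x
  refine ⟨fun d => MvPolynomial.coeff d.1 x, ?_⟩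
  refine Ideal.Quotient.eq.2 ?_
  rw [MvPolynomial.mem_pow_idealOfVars_iff']
  intro d hd
  rw [MvPolynomial.coeff_sub, sub_eq_zero, Fintype.linearCombination_apply,
    MvPolynomial.coeff_sum, Finset.sum_eq_single ⟨d, hd⟩]
  · simp
  · intro d' _ hne
    have : d'.1 ≠ d := fun h => hne (Subtype.ext h)
    simp [MvPolynomial.coeff_monomial, this]
  · simp

lemma finite_complex_of_pow_smul_eq_zero {V : Type*} [AddCommGroup V] [Module Poly V] [Module ℂ V]
    [IsScalarTower ℂ Poly V] [Module.Finite Poly V] {n : ℕ}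
    (h : ∀ f ∈ idealOfVars (Fin 2) ℂ ^ n, ∀ v : V, f • v = 0) : Module.Finite ℂ V := by
  have hV : Module.IsTorsionBySet Poly V (idealOfVars (Fin 2) ℂ ^ n : Ideal Poly) :=
    fun v f => h f.1 f.2 v
  let _ := hV.module
  have := hV.isScalarTower (S := Poly)
  have : IsScalarTower ℂ (Poly ⧸ idealOfVars (Fin 2) ℂ ^ n) V := hV.isScalarTower
  have := Module.Finite.of_restrictScalars_finite Poly (Poly ⧸ idealOfVars (Fin 2) ℂ ^ n) V
  exact Module.Finite.trans (Poly ⧸ idealOfVars (Fin 2) ℂ ^ n) V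

open SkewMonoidAlgebra (single)

variable {G : Subgroup SL₂}

lemma toCoh_act (M : FinLen G) (f : Poly) (m : M.obj) :
    (show ((toCoh G).obj M).obj from (single (1 : G) f : SkewPoly G) •
      (show ((toCoh G).obj M).obj from m)) = act M f m :=
  congrArg (fun s : SkewPow G => s • m) (completion_single G 1 f)

lemma toCoh_single (M : FinLen G) (g : G) (f : Poly) (m : M.obj) :
    (show ((toCoh G).obj M).obj from (single g f : SkewPoly G) •
      (show ((toCoh G).obj M).obj from m)) = act M f (rep M g m) :=
  (congrArg (fun s : SkewPow G => s • m) (completion_single G g f)).trans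
    (single_smul_eq M g f m)

lemma toCoh_map_apply {M N : FinLen G} (φ : M ⟶ N) (m : M.obj) :
    ((toCoh G).map φ).hom.hom m = φ.hom m := rfl

instance : (toCoh G).Faithful where
  map_injective {M N φ φ'} h := hom_ext_apply fun m => by
    rw [← toCoh_map_apply, h, toCoh_map_apply]

/-- The restriction from `R̂` to `R` loses no information on modules of finite length, on which
power series act through their truncations. -/
instance : (toCoh G).Full where
  map_surjective {M N} φ := by
    let f : M.obj →+ N.obj := φ.hom.hom.toAddMonoidHom
    have hf (g : G) (p : Poly) (m : M.obj) : f (act M p (rep M g m)) = act N p (rep N g (f m)) :=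
      (congrArg f (toCoh_single M g p m)).symm.trans
        ((φ.hom.hom.map_smul (single g p) m).trans (toCoh_single N g p (f m)))
    have hact (p : Poly) (m : M.obj) : f (act M p m) = act N p (f m) := by
      have := hf 1 p m
      rwa [map_one, map_one] at this
    refine ⟨mkHom f (fun a m => ?_) (fun g m => ?_), ?_⟩
    · obtain ⟨k, hk⟩ := exists_killed M
      obtain ⟨l, hl⟩ := exists_killed N
      have h := sub_truncTotal_mem (k + l) a
      have h1 := hk _ (Ideal.pow_le_pow_right (k.le_add_right l) h) m
      have h2 := hl _ (Ideal.pow_le_pow_right (l.le_add_left k) h) (f m)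
      rw [act_sub, sub_eq_zero] at h1 h2
      rw [h1, h2, hact]
    · have := hf g 1 m
      rwa [MvPolynomial.coe_one, act_one, act_one] at this
    · rfl

instance : (toCoh G).Linear ℂ where
  map_smul {M N} φ c := by
    ext m
    change c • φ.hom m = _
    rw [← act_C, ← MvPolynomial.coe_C]
    exact (toCoh_act N _ (φ.hom m)).symm

lemma isSuppZero_of_pow_smul_eq_zero (M : CohG G) (n : ℕ)
    (h : ∀ f ∈ idealOfVars (Fin 2) ℂ ^ n, ∀ m : M.obj, (single (1 : G) f : SkewPoly G) • m = 0) :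
    isSuppZero G M := by
  intro p hp
  obtain ⟨m, hm⟩ := Module.mem_support_iff_exists_annihilator.1 hp
  rintro _ ⟨i, rfl⟩
  refine p.2.mem_of_pow_mem n (hm ((Submodule.mem_annihilator_span_singleton _ _).2 ?_))
  exact h _ (Ideal.pow_mem_pow (Ideal.subset_span (Set.mem_range_self i)) n) m

lemma isSuppZero_toCoh (M : FinLen G) : isSuppZero G ((toCoh G).obj M) :=
  let ⟨n, hn⟩ := exists_killed M
  isSuppZero_of_pow_smul_eq_zero _ n fun f hf m =>
    (toCoh_act M f m).trans (hn _ (coe_mem_maxIdeal_pow_iff.2 hf) m)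

section

variable {M : ModuleCat.{0} (SkewPoly G)} {n : ℕ}
  (hn : ∀ f ∈ idealOfVars (Fin 2) ℂ ^ n, ∀ m : M, (single (1 : G) f : SkewPoly G) • m = 0)

include hn in
lemma single_smul_congr {f f' : Poly} (h : (f : Pow) - f' ∈ maxIdeal ^ n) (m : M) :
    (single (1 : G) f : SkewPoly G) • m = (single (1 : G) f' : SkewPoly G) • m := by
  have h1 : f - f' ∈ idealOfVars (Fin 2) ℂ ^ n := by
    rw [← coe_mem_maxIdeal_pow_iff]
    have : ((f - f' : Poly) : Pow) = f - f' := map_sub MvPolynomial.coeToMvPowerSeries.ringHom f f'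
    rwa [this]
  have h2 := hn _ h1 m
  rwa [sub_eq_add_neg, SkewMonoidAlgebra.single_add, SkewMonoidAlgebra.single_neg, add_smul,
    neg_smul, ← sub_eq_add_neg, sub_eq_zero] at h2

/-- Power series act on a module annihilated by the polynomials of order at least `n` through their
truncations. -/
def truncAction : Pow →+* AddMonoid.End M where
  toFun f := DistribSMul.toAddMonoidHom M (single (1 : G) (MvPowerSeries.truncTotal n f) : SkewPoly G)
  map_one' := by
    ext m
    refine (single_smul_congr hn ?_ m).trans (one_smul (SkewPoly G) m)
    rw [← neg_mem_iff, neg_sub, MvPolynomial.coe_one]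
    exact sub_truncTotal_mem n 1
  map_mul' f f' := by
    ext m
    change _ = (single (1 : G) (MvPowerSeries.truncTotal n f) : SkewPoly G) •
      (single (1 : G) (MvPowerSeries.truncTotal n f') : SkewPoly G) • m
    rw [smul_smul, SkewMonoidAlgebra.single_mul_single, one_mul, one_smul]
    refine single_smul_congr hn ?_ m
    have h1 := Ideal.mul_mem_right f' _ (sub_truncTotal_mem n f)
    have h2 := Ideal.mul_mem_left (maxIdeal ^ n) ((MvPowerSeries.truncTotal n f : Poly) : Pow)
      (sub_truncTotal_mem n f')
    have h3 := sub_mem (add_mem h1 h2) (sub_truncTotal_mem n (f * f'))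
    rw [MvPolynomial.coe_mul]
    convert h3 using 1
    ring
  map_zero' := by
    ext m
    change (single (1 : G) (MvPowerSeries.truncTotal n (0 : Pow)) : SkewPoly G) • m = 0
    rw [map_zero, SkewMonoidAlgebra.single_zero_right, zero_smul]
  map_add' f f' := by
    ext m
    change (single (1 : G) (MvPowerSeries.truncTotal n (f + f')) : SkewPoly G) • m =
      (single (1 : G) (MvPowerSeries.truncTotal n f) : SkewPoly G) • m +
        (single (1 : G) (MvPowerSeries.truncTotal n f') : SkewPoly G) • m
    rw [map_add, SkewMonoidAlgebra.single_add, add_smul]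

lemma truncAction_apply {f : Pow} {p : Poly} (h : f - p ∈ maxIdeal ^ n) (m : M) :
    truncAction hn f m = (single (1 : G) p : SkewPoly G) • m := by
  refine single_smul_congr hn ?_ m
  have := sub_mem h (sub_truncTotal_mem n f)
  rwa [sub_sub_sub_cancel_left] at this

variable (M) in
/-- The action of `G` on the abelian group underlying an equivariant `R`-module. -/
def groupAction : G →* AddMonoid.End M where
  toFun g := DistribSMul.toAddMonoidHom M (single g 1 : SkewPoly G)
  map_one' := by
    ext m
    exact one_smul _ m
  map_mul' g h := by
    ext m
    change (single (g * h) 1 : SkewPoly G) • m = (single g 1 : SkewPoly G) •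
      (single h 1 : SkewPoly G) • m
    rw [smul_smul, SkewMonoidAlgebra.single_mul_single, smul_one, mul_one]

/-- The action of the completed skew group ring on an equivariant `R`-module annihilated by a power
of the maximal ideal. -/
def completedAction : SkewPow G →+* AddMonoid.End M :=
  SkewMonoidAlgebra.liftNCRingHom (truncAction hn) (groupAction M) fun {f g} => by
    ext m
    change truncAction hn (g • f) ((single g 1 : SkewPoly G) • m) =
      (single g 1 : SkewPoly G) • (truncAction hn f m)
    rw [truncAction_apply hn (sub_truncTotal_mem n f),
      truncAction_apply hn (p := g • MvPowerSeries.truncTotal n f), smul_smul, smul_smul,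
      single_mul_single_one]
    rw [show ((g • MvPowerSeries.truncTotal n f : Poly) : Pow) =
      g • ((MvPowerSeries.truncTotal n f : Poly) : Pow) from coe_smul _ _, ← smul_sub]
    exact smul_mem_maxIdeal_pow g (sub_truncTotal_mem n f)

lemma completedAction_single (g : G) (p : Poly) (m : M) :
    completedAction hn (single g (p : Pow)) m = (single g p : SkewPoly G) • m := by
  have : completedAction hn (single g (p : Pow)) = truncAction hn p * groupAction M g := by
    simp [completedAction, SkewMonoidAlgebra.liftNCRingHom]
  rw [this]
  change truncAction hn p ((single g 1 : SkewPoly G) • m) = _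
  rw [truncAction_apply hn (p := p) (by rw [sub_self]; exact zero_mem _), smul_smul,
    ← single_eq_single_one_mul]

end

/-- The annihilator of a coherent sheaf supported at the origin contains a power of the ideal of the
origin, because its support is the zero locus of its annihilator. -/
lemma exists_pow_smul_eq_zero (M : CohG G) (hM : isSuppZero G M) :
    ∃ n, ∀ f ∈ idealOfVars (Fin 2) ℂ ^ n, ∀ m : M.obj, (single (1 : G) f : SkewPoly G) • m = 0 := by
  have hfin : Module.Finite Poly ((forgetEquivariance G).obj M.obj) := M.property
  have h1 : idealOfVars (Fin 2) ℂ ≤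
      (Module.annihilator Poly ((forgetEquivariance G).obj M.obj)).radical := by
    have h : Module.support Poly ((forgetEquivariance G).obj M.obj) ⊆ _ := hM
    rw [Module.support_eq_zeroLocus, ← PrimeSpectrum.zeroLocus_span (Set.range _),
      PrimeSpectrum.zeroLocus_subset_zeroLocus_iff] at h
    exact h
  obtain ⟨n, hn⟩ := Ideal.exists_pow_le_of_le_radical_of_fg h1 (MvPolynomial.idealOfVars_fg _ _)
  exact ⟨n, fun f hf m => Module.mem_annihilator.1 (hn hf) m⟩

/-- Every equivariant coherent sheaf supported at the origin comes from an equivariant module of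
finite length over the completion. -/
lemma exists_toCoh_iso (M : CohG G) (hM : isSuppZero G M) :
    ∃ N : FinLen G, Nonempty ((toCoh G).obj N ≅ M) := by
  have hfin : Module.Finite Poly ((forgetEquivariance G).obj M.obj) := M.property
  obtain ⟨n, hn⟩ := exists_pow_smul_eq_zero M hM
  let N : ModuleCat.{0} (SkewPow G) := (ModuleCat.restrictScalars (completedAction hn)).obj
    (ModuleCat.of (AddMonoid.End M.obj) M.obj)
  have hN : isFinDim G N := by
    change Module.Finite ℂ ((ModuleCat.restrictScalars (algebraMap ℂ (SkewPow G))).obj N)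
    let _ : Module Poly ((ModuleCat.restrictScalars (algebraMap ℂ (SkewPow G))).obj N) :=
      ((forgetEquivariance G).obj M.obj).isModule
    have : Module.Finite Poly ((ModuleCat.restrictScalars (algebraMap ℂ (SkewPow G))).obj N) := hfin
    have : IsScalarTower ℂ Poly
        ((ModuleCat.restrictScalars (algebraMap ℂ (SkewPow G))).obj N) := ⟨fun c f m => by
      change (single (1 : G) (c • f) : SkewPoly G) • (show M.obj from m) =
        completedAction hn (single 1 (MvPowerSeries.C c))
          ((single (1 : G) f : SkewPoly G) • (show M.obj from m))
      rw [← MvPolynomial.coe_C, completedAction_single, smul_smul,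
        SkewMonoidAlgebra.single_mul_single, one_mul, one_smul, MvPolynomial.smul_eq_C_mul]⟩
    exact finite_complex_of_pow_smul_eq_zero (n := n) hn
  let e : ((toCoh G).obj ⟨N, hN⟩).obj →ₗ[SkewPoly G] M.obj :=
    skewLinearMap (AddMonoidHom.id M.obj) fun g f m => by
      refine Eq.trans ?_ (completedAction_single hn g f m)
      exact congrArg (fun s => completedAction hn s m) (completion_single G g f)
  exact ⟨⟨N, hN⟩, ⟨(isCoh G).isoMk
    (LinearEquiv.ofBijective e Function.bijective_id).toModuleIso⟩⟩

end KleinianSurface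

end

noncomputable section

namespace KleinianSurface

open DerivedCategory Pretriangulated

attribute [local instance] ModuleCat.moduleOfAlgebraModule
  ModuleCat.isScalarTower_of_algebra_moduleCat

/-! ### The heart of the derived category -/

variable {G : Subgroup SL₂}

/-- The one-dimensional representation defined by a character. -/
def charRep (κ : Character G) : Representation ℂ G ℂ where
  toFun g := (κ g : ℂ) • LinearMap.id
  map_one' := by simp; rfl
  map_mul' g h := by
    ext
    simp [mul_comm]

instance (κ : Character G) : (charRep κ).IsIrreducible := by
  refine { exists_pair_ne := ⟨⊥, ⊤, fun h => ?_⟩, eq_bot_or_eq_top := fun W => ?_ }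
  · exact bot_ne_top (α := Submodule ℂ ℂ) (congrArg Subrepresentation.toSubmodule h)
  · exact (eq_bot_or_eq_top W.toSubmodule).imp (fun h => Subrepresentation.toSubmodule_injective h)
      fun h => Subrepresentation.toSubmodule_injective h

section

open SkewMonoidAlgebra (single)

lemma simpleModule_single_smul (κ : Character G) (g : G) (f : Poly) (z : ℂ) :
    (show simpleModule (charRep κ) from (single g f : SkewPoly G) •
      (show simpleModule (charRep κ) from z)) = MvPolynomial.constantCoeff f * ((κ g : ℂ) * z) := by
  change simpleAction (charRep κ) (single g f) z = _
  simp [simpleAction, SkewMonoidAlgebra.liftNCRingHom, charRep, mul_left_comm]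

/-- The action of the skew group ring on `κ ⊗ R̂/m` in the basis given by the generator. -/
lemma act_rep_act_gen (κ : Character G) (g : G) (f : Poly) (z : ℂ) :
    act (jet 1 κ) f (rep _ g (act (jet 1 κ) (MvPowerSeries.C z) (gen 1 κ))) =
      act _ (MvPowerSeries.C (MvPolynomial.constantCoeff f * ((κ g : ℂ) * z))) (gen 1 κ) := by
  rw [rep_act, smul_C, isWt_gen, act_smul, act_smul, ← act_smul_left, act_act,
    ← sub_eq_zero, ← act_sub, act_gen_eq_zero_iff, pow_one, mem_maxIdeal_iff]
  have h : MvPowerSeries.constantCoeff (f : Pow) = MvPolynomial.constantCoeff f := by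
    rw [← MvPowerSeries.coeff_zero_eq_constantCoeff_apply, MvPolynomial.coeff_coe,
      MvPolynomial.constantCoeff_eq]
  rw [MvPowerSeries.smul_eq_C_mul, map_sub, map_mul, map_mul, MvPowerSeries.constantCoeff_C,
    MvPowerSeries.constantCoeff_C, MvPowerSeries.constantCoeff_C, h]
  ring

/-- The sheaf `κ ⊗ 𝒪₀` is the module `κ ⊗ R̂/m`. -/
lemma nonempty_simpleSheaf_iso (κ : Character G) :
    Nonempty (simpleSheaf (charRep κ) ≅ (toCoh G).obj (jet 1 κ)) := by
  let e : (simpleModule (charRep κ)) →ₗ[SkewPoly G] ((toCoh G).obj (jet 1 κ)).obj :=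
    skewLinearMap (M := simpleModule (charRep κ)) (N := ((toCoh G).obj (jet 1 κ)).obj)
      ({ toFun := fun z : ℂ => act (jet 1 κ) (MvPowerSeries.C z) (gen 1 κ)
         map_zero' := by rw [map_zero, act_zero_left]
         map_add' := fun z w => by rw [map_add, act_add] } : ℂ →+ (jet 1 κ).obj) fun g f z => by
      refine (congrArg (fun z => act (jet 1 κ) (MvPowerSeries.C z) (gen 1 κ))
        (simpleModule_single_smul κ g f z)).trans ?_
      exact (act_rep_act_gen κ g f z).symm.trans (toCoh_single (jet 1 κ) g f _).symm
  have he : Function.Bijective e := by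
    constructor
    · refine (injective_iff_map_eq_zero e).2 fun z hz => ?_
      change ℂ at z
      have h : act (jet 1 κ) (MvPowerSeries.C z) (gen 1 κ) = 0 := hz
      rw [act_gen_eq_zero_iff, pow_one, mem_maxIdeal_iff, MvPowerSeries.constantCoeff_C] at h
      exact h
    · intro x
      obtain ⟨f, rfl⟩ := exists_act_gen (n := 1) (κ := κ) x
      refine ⟨(MvPowerSeries.constantCoeff f : ℂ), ?_⟩
      change act (jet 1 κ) (MvPowerSeries.C _) (gen 1 κ) = act (jet 1 κ) f (gen 1 κ)
      rw [← sub_eq_zero, ← act_sub, act_gen_eq_zero_iff, pow_one, mem_maxIdeal_iff, map_sub,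
        MvPowerSeries.constantCoeff_C, sub_self]
  exact ⟨(isCoh G).isoMk (X := simpleSheaf (charRep κ)) (Y := (toCoh G).obj (jet 1 κ))
    (LinearEquiv.ofBijective e he).toModuleIso⟩

end

variable [HasDerivedCategory.{w} (CohG G)]

lemma boundedSuppZero_single (M : FinLen G) :
    boundedSuppZero G ((toCoh G ⋙ singleFunctor (CohG G) 0).obj M) := by
  refine ⟨⟨⟨0, inferInstanceAs (((singleFunctor (CohG G) 0).obj _).IsGE 0)⟩,
    ⟨0, inferInstanceAs (((singleFunctor (CohG G) 0).obj _).IsLE 0)⟩⟩, fun n => ?_⟩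
  change isSuppZero G ((homologyFunctor (CohG G) n).obj ((singleFunctor (CohG G) 0).obj _))
  rcases lt_trichotomy n 0 with h | rfl | h
  · exact (isSuppZero G).prop_of_isZero (DerivedCategory.isZero_of_isGE _ 0 n h)
  · exact (isSuppZero G).prop_of_iso
      ((singleFunctorCompHomologyFunctorIso (CohG G) 0).app _).symm (isSuppZero_toCoh M)
  · exact (isSuppZero G).prop_of_isZero (DerivedCategory.isZero_of_isLE _ 0 n h)

variable (G) in
/-- The embedding of the equivariant modules of finite length as the complexes concentrated in
degree `0`. -/
def deg₀ : FinLen G ⥤ DG₀ G :=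
  (boundedSuppZero G).lift (toCoh G ⋙ singleFunctor (CohG G) 0) boundedSuppZero_single

variable (G) in
/-- The functor `deg₀`, followed by the inclusion into the derived category. -/
def deg₀CompιIso : deg₀ G ⋙ (boundedSuppZero G).ι ≅ toCoh G ⋙ singleFunctor (CohG G) 0 :=
  Iso.refl _

instance : (deg₀ G).Full := by
  dsimp only [deg₀]; infer_instance

instance : (deg₀ G).Faithful := by
  dsimp only [deg₀]; infer_instance

instance : (deg₀ G).Additive := by
  dsimp only [deg₀]; infer_instance

instance : (deg₀ G).Linear ℂ where
  map_smul {M N} f c := by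
    refine (boundedSuppZero G).hom_ext ?_
    change (singleFunctor (CohG G) 0).map ((toCoh G).map (c • f)) =
      c • (singleFunctor (CohG G) 0).map ((toCoh G).map f)
    rw [Functor.map_smul, Functor.map_smul]

/-- The object `κ ⊗ 𝒪₀` is the image of `κ ⊗ R̂/m` in the derived category. -/
lemma nonempty_simpleObject_iso (κ : Character G) :
    Nonempty (simpleObject (charRep κ) ≅ (deg₀ G).obj (jet 1 κ)) :=
  (nonempty_simpleSheaf_iso κ).map fun e =>
    (boundedSuppZero G).isoMk ((singleFunctor (CohG G) 0).mapIso e)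

/-- The heart, the objects with cohomology in degree `0` only, is the image of `deg₀`. -/
lemma essImage_deg₀ {X : DG₀ G} (h₁ : X.obj.IsLE 0) (h₂ : X.obj.IsGE 0) :
    (deg₀ G).essImage X := by
  obtain ⟨M, ⟨e⟩⟩ := exists_iso_singleFunctor_obj_of_isGE_of_isLE X.obj 0
  obtain ⟨N, ⟨e'⟩⟩ := exists_toCoh_iso M <| (isSuppZero G).prop_of_iso
    ((homologyFunctor _ 0).mapIso e ≪≫ (singleFunctorCompHomologyFunctorIso (CohG G) 0).app M)
    (X.property.2 0)
  exact ⟨N, ⟨(boundedSuppZero G).isoMk ((singleFunctor (CohG G) 0).mapIso e' ≪≫ e.symm)⟩⟩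

end KleinianSurface

end

noncomputable section

namespace KleinianSurface

open DerivedCategory Pretriangulated

attribute [local instance] ModuleCat.moduleOfAlgebraModule
  ModuleCat.isScalarTower_of_algebra_moduleCat

/-! ### Distinguished triangles in full subcategories -/

section

variable {C : Type*} [Category* C] [HasZeroObject C] [HasShift C ℤ] [Preadditive C]
  [∀ n : ℤ, (shiftFunctor C n).Additive] [Pretriangulated C]

lemma distinguished_of_iso {X Y Z X' Y' Z' : C} {f : X ⟶ Y} {g : Y ⟶ Z} {h : Z ⟶ X⟦(1 : ℤ)⟧}
    (hT : Triangle.mk f g h ∈ distTriang C) {f' : X' ⟶ Y'} {g' : Y' ⟶ Z'} {h' : Z' ⟶ X'⟦(1 : ℤ)⟧}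
    (a : X' ≅ X) (b : Y' ≅ Y) (c : Z' ≅ Z) (h₁ : f' ≫ b.hom = a.hom ≫ f)
    (h₂ : g' ≫ c.hom = b.hom ≫ g) (h₃ : h' ≫ a.hom⟦(1 : ℤ)⟧' = c.hom ≫ h) :
    Triangle.mk f' g' h' ∈ distTriang C :=
  isomorphic_distinguished _ hT _ (Triangle.isoMk _ _ a b c h₁ h₂ h₃)

/-- Full triangulated subcategories contain the cones of their morphisms. -/
lemma distinguished_preimage {P : ObjectProperty C} [P.IsTriangulated] {X Y Z : P.FullSubcategory}
    {f : X ⟶ Y} {g : Y ⟶ Z} {h : Z.obj ⟶ X.obj⟦(1 : ℤ)⟧}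
    (hT : Triangle.mk (P.ι.map f) (P.ι.map g) h ∈ distTriang C) :
    Triangle.mk f g (P.fullyFaithfulι.preimage (h ≫ (P.ι.commShiftIso (1 : ℤ)).inv.app X)) ∈
      distTriang P.FullSubcategory := by
  refine isomorphic_distinguished _ hT _ (Triangle.isoMk _ _ (Iso.refl _) (Iso.refl _) (Iso.refl _)
    ((Category.comp_id _).trans (Category.id_comp _).symm)
    ((Category.comp_id _).trans (Category.id_comp _).symm) ?_)
  have key : P.ι.map (P.fullyFaithfulι.preimage
      (Y := X⟦(1 : ℤ)⟧) (h ≫ (P.ι.commShiftIso (1 : ℤ)).inv.app X)) ≫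
      (P.ι.commShiftIso (1 : ℤ)).hom.app X = h := by
    rw [Functor.FullyFaithful.map_preimage, Category.assoc, Iso.inv_hom_id_app]
    exact Category.comp_id h
  exact (congrArg₂ (· ≫ ·) key (CategoryTheory.Functor.map_id _ _)).trans
    ((Category.comp_id _).trans (Category.id_comp _).symm)

end

/-! ### Restriction of triangulated autoequivalences to the heart -/

variable {G : Subgroup SL₂}

lemma isZero_of_subsingleton (M : FinLen G) [Subsingleton M.obj] : IsZero M :=
  ⟨fun N => ⟨⟨⟨0⟩, fun φ => hom_ext_apply fun m => by
      rw [Subsingleton.elim m 0]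
      exact (map_zero φ.hom.hom).trans (map_zero (0 : M ⟶ N).hom.hom).symm⟩⟩,
    fun N => ⟨⟨⟨0⟩, fun φ => hom_ext_apply fun m => Subsingleton.elim _ _⟩⟩⟩

lemma inv_smul_mem (g : G) {a : Pow} (ha : a ∈ maxIdeal) : g⁻¹ • a ∈ maxIdeal := by
  have := smul_mem_maxIdeal_pow (n := 1) g⁻¹ (f := a) (by rwa [pow_one])
  rwa [pow_one] at this

/-- A nonzero equivariant module of finite length contains a simple submodule. -/
lemma exists_mono_jet_one [Finite G] [IsCyclic G] (M : FinLen G) [Nontrivial M.obj] :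
    ∃ (κ : Character G) (φ : jet 1 κ ⟶ M), Function.Injective φ.hom := by
  classical
  -- for the least `n` with `mⁿ M = 0`, the vectors in `mⁿ⁻¹ M` are annihilated by `m`
  let n := Nat.find (exists_killed M)
  have hn := Nat.find_spec (exists_killed M)
  have hn0 : n ≠ 0 := fun h => by
    obtain ⟨m, hm⟩ := exists_ne (0 : M.obj)
    refine hm ?_
    rw [← act_one M m]
    refine hn 1 ?_ m
    rw [show Nat.find (exists_killed M) = 0 from h, pow_zero, Ideal.one_eq_top]
    exact Submodule.mem_top
  have hn1 := Nat.find_min (exists_killed M) (Nat.sub_one_lt hn0)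
  push Not at hn1
  obtain ⟨f, hf, m, hm⟩ := hn1
  have hkill (a : Pow) (ha : a ∈ maxIdeal) : act M a (act M f m) = 0 := by
    rw [act_act]
    refine hn _ ?_ m
    rw [show Nat.find (exists_killed M) = (n - 1) + 1 by
      exact (Nat.succ_pred_eq_of_ne_zero hn0).symm, pow_succ, mul_comm a f]
    exact Ideal.mul_mem_mul hf ha
  let _ := Fintype.ofFinite (Character G)
  obtain ⟨κ, hκ⟩ : ∃ κ, wtProj (rep M) κ (act M f m) ≠ 0 := by
    by_contra! h
    refine hm ?_
    rw [← sum_wtProj (ρ := rep M) (act M f m)]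
    exact Finset.sum_eq_zero fun κ _ => h κ
  have hkill' (a : Pow) (ha : a ∈ maxIdeal) : act M a (wtProj (rep M) κ (act M f m)) = 0 := by
    let A : M.obj →+ M.obj := ⟨⟨act M a, act_zero M a⟩, act_add_right M a⟩
    rw [wtProj_apply, act_smul]
    refine (congrArg _ (map_sum A _ _)).trans ?_
    rw [Finset.sum_eq_zero, smul_zero]
    intro g _
    change act M a _ = 0
    have := rep_act M g (g⁻¹ • a) (act M f m)
    rw [smul_inv_smul] at this
    rw [act_smul, ← this, hkill _ (inv_smul_mem g ha), map_zero, smul_zero]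
  refine ⟨κ, jetHom _ (isWt_wtProj _) (by rwa [pow_one]), ?_⟩
  refine (injective_iff_map_eq_zero (jetHom _ (isWt_wtProj _) _).hom.hom).2 fun x hx => ?_
  obtain ⟨a, rfl⟩ := exists_act_gen x
  rw [act_gen_eq_zero_iff, pow_one]
  by_contra ha
  obtain ⟨b, hb⟩ := (isUnit_iff_notMem_maxIdeal.2 ha).exists_left_inv
  refine hκ ?_
  rw [← act_one M (wtProj (rep M) κ (act M f m)), ← hb, ← act_act]
  have : act M a (wtProj (rep M) κ (act M f m)) = 0 := by
    rw [← jetHom_act_gen (n := 1) (isWt_wtProj _) (by rwa [pow_one])]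
    exact hx
  rw [this, act_zero]

lemma gen_ne_zero (κ : Character G) : gen 1 κ ≠ 0 := fun h => by
  have h1 : act (jet 1 κ) 1 (gen 1 κ) = 0 := (act_one _ _).trans h
  rw [act_gen_eq_zero_iff, pow_one] at h1
  exact isUnit_iff_notMem_maxIdeal.1 isUnit_one h1

/-- The dimension drops in the quotient by a nonzero submodule, so that one can pass from simple
modules to all modules by induction. -/
lemma finrank_quot_lt {M : FinLen G} (U : Submodule (SkewPow G) M.obj) (hU : ∃ u ∈ U, u ≠ 0) :
    Module.finrank ℂ (quot M U).obj < Module.finrank ℂ M.obj := by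
  have := finite_obj M
  obtain ⟨u, hu, hu0⟩ := hU
  have h := (homLinear (quotMk M U)).finrank_range_add_finrank_ker
  rw [(LinearMap.range_eq_top (f := homLinear (quotMk M U))).2 (quotMk_surjective U),
    finrank_top] at h
  have hu' : u ∈ LinearMap.ker (homLinear (quotMk M U)) := quotMk_eq_zero.2 hu
  have : Nontrivial (LinearMap.ker (homLinear (quotMk M U))) :=
    ⟨⟨u, hu'⟩, 0, fun h => hu0 (congrArg Subtype.val h)⟩
  have := Module.finrank_pos (R := ℂ) (M := LinearMap.ker (homLinear (quotMk M U)))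
  lia

/-- The quotient by the image of an injective morphism gives a short exact sequence of sheaves. -/
lemma shortExact_toCoh {L M : FinLen G} (φ : L ⟶ M) (h : Function.Injective φ.hom) :
    (ShortComplex.mk ((toCoh G).map φ)
      ((toCoh G).map (quotMk M (LinearMap.range φ.hom.hom))) (by
        rw [← Functor.map_comp, show φ ≫ quotMk M (LinearMap.range φ.hom.hom) = 0 from
          hom_ext_apply fun m => quotMk_eq_zero.2 ⟨m, rfl⟩, Functor.map_zero])).ShortExact := by
  refine ShortExact.reflects_shortExact_of_faithful (isCoh G).ι ?_
  have h1 : Function.Injective ((isCoh G).ι.map ((toCoh G).map φ)).hom := h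
  have h2 : Function.Surjective ((isCoh G).ι.map ((toCoh G).map
      (quotMk M (LinearMap.range φ.hom.hom)))).hom := quotMk_surjective _
  refine .mk' ?_ ((ModuleCat.mono_iff_injective _).2 h1) ((ModuleCat.epi_iff_surjective _).2 h2)
  rw [ShortComplex.ShortExact.moduleCat_exact_iff_function_exact]
  exact fun m => quotMk_eq_zero (U := LinearMap.range φ.hom.hom)

variable [HasDerivedCategory.{w} (CohG G)] [Finite G] [IsCyclic G]

/-- A triangulated endofunctor which preserves the simple objects preserves the heart, because the
heart is closed under extensions. -/
lemma map_deg₀_mem_heart (Ψ : DG₀ G ⥤ DG₀ G) [Ψ.CommShift ℤ] [Ψ.IsTriangulated]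
    (hΨ : ∀ κ, Nonempty (Ψ.obj ((deg₀ G).obj (jet 1 κ)) ≅ (deg₀ G).obj (jet 1 κ)))
    (M : FinLen G) :
    (Ψ.obj ((deg₀ G).obj M)).obj.IsLE 0 ∧ (Ψ.obj ((deg₀ G).obj M)).obj.IsGE 0 := by
  have hiso {X Y : DG₀ G} (e : X ≅ Y) (h : X.obj.IsLE 0 ∧ X.obj.IsGE 0) :
      Y.obj.IsLE 0 ∧ Y.obj.IsGE 0 := by
    have h₁ : ((boundedSuppZero G).ι.obj X).IsLE 0 := h.1
    have h₂ : ((boundedSuppZero G).ι.obj X).IsGE 0 := h.2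
    have e' := (boundedSuppZero G).ι.mapIso e
    exact ⟨TStructure.t.isLE_of_iso e' 0, TStructure.t.isGE_of_iso e' 0⟩
  have hdeg (M : FinLen G) : ((deg₀ G).obj M).obj.IsLE 0 ∧ ((deg₀ G).obj M).obj.IsGE 0 :=
    ⟨inferInstanceAs (((singleFunctor (CohG G) 0).obj _).IsLE 0),
      inferInstanceAs (((singleFunctor (CohG G) 0).obj _).IsGE 0)⟩
  induction hd : Module.finrank ℂ M.obj using Nat.strong_induction_on generalizing M with
  | _ d ih =>
    rcases subsingleton_or_nontrivial M.obj with hM | hM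
    · have h0 := (deg₀ G).map_isZero (isZero_of_subsingleton M)
      exact hiso (h0.iso (Ψ.map_isZero h0)) (hdeg M)
    · obtain ⟨κ, φ, hφ⟩ := exists_mono_jet_one M
      have hS := shortExact_toCoh φ hφ
      let Q := quot M (LinearMap.range φ.hom.hom)
      have hT := distinguished_preimage (P := boundedSuppZero G) (f := (deg₀ G).map φ)
        (g := (deg₀ G).map (quotMk M (LinearMap.range φ.hom.hom))) hS.singleTriangle_distinguished
      have hT' := (boundedSuppZero G).ι.map_distinguished _ (Ψ.map_distinguished _ hT)
      have h1 := hiso (hΨ κ).some.symm (hdeg _)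
      have h3 := ih (Module.finrank ℂ Q.obj) (hd ▸ finrank_quot_lt _ ⟨_, ⟨gen 1 κ, rfl⟩, fun h =>
        gen_ne_zero κ (hφ (h.trans (map_zero _).symm))⟩) Q rfl
      exact ⟨TStructure.t.isLE₂ _ hT' 0 h1.1 h3.1, TStructure.t.isGE₂ _ hT' 0 h1.2 h3.2⟩

/-- A triangulated autoequivalence which preserves the simple objects restricts to an
autoequivalence of the category of equivariant modules of finite length. -/
theorem exists_restriction (Φ : DG₀ G ≌ DG₀ G) [Φ.functor.CommShift ℤ] [Φ.functor.IsTriangulated]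
    [Φ.functor.Linear ℂ]
    (hΦ : ∀ κ, Nonempty (Φ.functor.obj ((deg₀ G).obj (jet 1 κ)) ≅ (deg₀ G).obj (jet 1 κ))) :
    ∃ E : FinLen G ≌ FinLen G, E.functor.Additive ∧ E.functor.Linear ℂ ∧
      Nonempty (deg₀ G ⋙ Φ.functor ≅ E.functor ⋙ deg₀ G) := by
  have hess (Ψ : DG₀ G ⥤ DG₀ G) [Ψ.CommShift ℤ] [Ψ.IsTriangulated]
      (hΨ : ∀ κ, Nonempty (Ψ.obj ((deg₀ G).obj (jet 1 κ)) ≅ (deg₀ G).obj (jet 1 κ)))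
      (M : FinLen G) : (deg₀ G).essImage (Ψ.obj ((deg₀ G).obj M)) :=
    essImage_deg₀ (map_deg₀_mem_heart Ψ hΨ M).1 (map_deg₀_mem_heart Ψ hΨ M).2
  let F : FinLen G ⥤ FinLen G :=
    Functor.essImage.liftFunctor (deg₀ G ⋙ Φ.functor) (deg₀ G) (hess Φ.functor hΦ)
  let α : F ⋙ deg₀ G ≅ deg₀ G ⋙ Φ.functor := Functor.essImage.liftFunctorCompIso _ _ _
  have hF₁ : F.Faithful := Functor.Faithful.of_comp_iso α
  have hF₂ : F.Full := Functor.Full.of_comp_faithful_iso α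
  have hF₃ : F.EssSurj := by
    let _ := Φ.commShiftInverse ℤ
    have := Φ.commShift_of_functor ℤ
    have : Φ.IsTriangulated := .mk' Φ inferInstance
    refine ⟨fun N => ?_⟩
    obtain ⟨M, ⟨e⟩⟩ := hess Φ.inverse (fun κ =>
      ⟨Φ.inverse.mapIso (hΦ κ).some.symm ≪≫ (Φ.unitIso.app _).symm⟩) N
    exact ⟨M, ⟨(deg₀ G).preimageIso (α.app M ≪≫ Φ.functor.mapIso e ≪≫ Φ.counitIso.app _)⟩⟩
  have hF₄ : F.IsEquivalence := { }
  have hF₅ : (F ⋙ deg₀ G).Additive := Functor.additive_of_iso α.symm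
  have hF₆ : F.Additive := Functor.additive_of_comp_faithful F (deg₀ G)
  refine ⟨F.asEquivalence, hF₆, ⟨fun {M N} f c => ?_⟩, ⟨α.symm⟩⟩
  change F.map (c • f) = c • F.map f
  apply (deg₀ G).map_injective
  have h1 : (deg₀ G).map (F.map (c • f)) ≫ α.hom.app N = _ := α.hom.naturality (c • f)
  have h2 : (deg₀ G).map (F.map f) ≫ α.hom.app N = _ := α.hom.naturality f
  rw [← cancel_mono (α.hom.app N), h1, Functor.map_smul, Functor.comp_map, Functor.map_smul,
    Linear.comp_smul, Linear.smul_comp, h2, Functor.comp_map]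

end KleinianSurface

end

noncomputable section

namespace KleinianSurface

open Pretriangulated

/-! ### Iterated cones -/

section

variable {B B' C C' : Type*} [Category* B] [Category* B'] [Category* C] [Category* C']
  [HasZeroObject C] [HasShift C ℤ] [Preadditive C] [∀ n : ℤ, (shiftFunctor C n).Additive]
  [Pretriangulated C]
  [HasZeroObject C'] [HasShift C' ℤ] [Preadditive C'] [∀ n : ℤ, (shiftFunctor C' n).Additive]
  [Pretriangulated C']

/-- The object `X` of a triangulated category, with the morphism `p : X ⟶ S (A 0)`, is an iterated
cone of the first `n` terms of the sequence `A 0 ⟶ A 1 ⟶ ⋯`. The object `X'` in the recursion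
stands for the shift by one of the brutal truncation in degrees `≥ 1` of a complex `A`. -/
def IsIteratedCone (S : B ⥤ C) : ∀ (_ : ℕ) (A : ℕ → B) (_ : ∀ i, A i ⟶ A (i + 1)) (X : C)
    (_ : X ⟶ S.obj (A 0)), Prop
  | 0, _, _, X, _ => IsZero X
  | n + 1, A, d, X, p => ∃ (X' : C) (p' : X' ⟶ S.obj (A 1)) (δ : S.obj (A 0) ⟶ X')
      (i : X' ⟶ X⟦(1 : ℤ)⟧),
      IsIteratedCone S n (fun i => A (i + 1)) (fun i => d (i + 1)) X' p' ∧
        Triangle.mk p δ i ∈ distTriang C ∧ δ ≫ p' = S.map (d 0)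

namespace IsIteratedCone

/-- Isomorphic sequences have the same iterated cones. -/
lemma of_iso_seq {S : B ⥤ C} {n : ℕ} {A A' : ℕ → B} {d : ∀ i, A i ⟶ A (i + 1)}
    {d' : ∀ i, A' i ⟶ A' (i + 1)} (e : ∀ i, A i ≅ A' i)
    (he : ∀ i, d i ≫ (e (i + 1)).hom = (e i).hom ≫ d' i) {X : C} {p : X ⟶ S.obj (A 0)}
    (h : IsIteratedCone S n A d X p) :
    IsIteratedCone S n A' d' X (p ≫ S.map (e 0).hom) := by
  induction n generalizing A A' X with
  | zero => exact h
  | succ n ih =>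
    obtain ⟨X', p', δ, i, hX', hT, hδ⟩ := h
    refine ⟨X', p' ≫ S.map (e 1).hom, S.map (e 0).inv ≫ δ, i,
      ih (fun i => e (i + 1)) (fun i => he (i + 1)) hX', ?_, ?_⟩
    · refine distinguished_of_iso hT (Iso.refl _) (S.mapIso (e 0).symm) (Iso.refl _) ?_ ?_ ?_
      · simp
      · simp
      · simp
    · rw [Category.assoc, reassoc_of% hδ, ← Functor.map_comp, ← Functor.map_comp, he,
        Iso.inv_hom_id_assoc]

/-- Triangulated functors preserve iterated cones. -/
lemma map {S : B ⥤ C} {S' : B' ⥤ C'} (F : B ⥤ B') (Φ : C ⥤ C') [Φ.CommShift ℤ] [Φ.IsTriangulated]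
    (α : S ⋙ Φ ≅ F ⋙ S') {n : ℕ} {A : ℕ → B} {d : ∀ i, A i ⟶ A (i + 1)} {X : C}
    {p : X ⟶ S.obj (A 0)} (h : IsIteratedCone S n A d X p) :
    IsIteratedCone S' n (fun i => F.obj (A i)) (fun i => F.map (d i)) (Φ.obj X)
      (Φ.map p ≫ α.hom.app (A 0)) := by
  induction n generalizing A X with
  | zero => exact Φ.map_isZero h
  | succ n ih =>
    obtain ⟨X', p', δ, i, hX', hT, hδ⟩ := h
    refine ⟨Φ.obj X', Φ.map p' ≫ α.hom.app (A 1), α.inv.app (A 0) ≫ Φ.map δ,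
      Φ.map i ≫ (Φ.commShiftIso (1 : ℤ)).hom.app X, ih hX', ?_, ?_⟩
    · have hT' : Triangle.mk (Φ.map p) (Φ.map δ) (Φ.map i ≫ (Φ.commShiftIso (1 : ℤ)).hom.app X) ∈
        distTriang C' := Φ.map_distinguished _ hT
      refine distinguished_of_iso hT' (Iso.refl _) (α.symm.app (A 0))
        (Iso.refl _) ?_ ?_ ?_
      · simp
      · simp
      · simp
    · rw [Category.assoc, ← Functor.map_comp_assoc, hδ]
      have := α.hom.naturality (d 0)
      dsimp at this
      rw [this, Iso.inv_hom_id_app_assoc]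

/-- Morphisms to an iterated cone are determined by their composition with the projection, if there
are no morphisms of negative degree between the objects `S b`. -/
lemma hom_eq_zero {S : B ⥤ C} (N : ObjectProperty C) (hN : ∀ X, N X → N (X⟦(1 : ℤ)⟧))
    (hNS : ∀ (X : C) (b : B) (f : X ⟶ S.obj b), N X → f = 0)
    {n : ℕ} {A : ℕ → B} {d : ∀ i, A i ⟶ A (i + 1)} {X : C}
    {p : X ⟶ S.obj (A 0)} (h : IsIteratedCone S n A d X p) {W : C} (hW : N (W⟦(1 : ℤ)⟧))
    (f : W ⟶ X) (hf : f ≫ p = 0) : f = 0 := by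
  induction n generalizing A X W with
  | zero => exact IsZero.eq_zero_of_tgt h f
  | succ n ih =>
    obtain ⟨X', p', δ, i, hX', hT, hδ⟩ := h
    -- `f` factors through `X'⟦-1⟧ ⟶ X`; this is written in terms of the shift of `f`
    obtain ⟨g, hg⟩ : ∃ g : W⟦(1 : ℤ)⟧ ⟶ X', f⟦(1 : ℤ)⟧' = g ≫ i :=
        Triangle.coyoneda_exact₁ _ hT (f⟦(1 : ℤ)⟧') (by
      change f⟦(1 : ℤ)⟧' ≫ p⟦(1 : ℤ)⟧' = 0
      rw [← Functor.map_comp, hf, Functor.map_zero])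
    have hg0 : g = 0 := ih hX' (hN _ hW) g (hNS _ _ _ hW)
    apply (shiftFunctor C (1 : ℤ)).map_injective
    rw [hg, hg0, zero_comp, Functor.map_zero]

/-- If there are no morphisms of negative degree between the objects `S b`, then iterated cones are
unique up to isomorphism. -/
lemma exists_iso {S : B ⥤ C} (N : ObjectProperty C) (hN : ∀ X, N X → N (X⟦(1 : ℤ)⟧))
    (hNS : ∀ (X : C) (b : B) (f : X ⟶ S.obj b), N X → f = 0) (hS : ∀ b, N ((S.obj b)⟦(1 : ℤ)⟧))
    {n : ℕ} {A : ℕ → B} {d : ∀ i, A i ⟶ A (i + 1)} {X Y : C}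
    {p : X ⟶ S.obj (A 0)} (h : IsIteratedCone S n A d X p)
    {q : Y ⟶ S.obj (A 0)} (h' : IsIteratedCone S n A d Y q) :
    ∃ e : X ≅ Y, e.hom ≫ q = p := by
  induction n generalizing A X Y with
  | zero => exact ⟨IsZero.iso h h', IsZero.eq_of_src h _ _⟩
  | succ n ih =>
    obtain ⟨X', p', δ, i, hX', hT, hδ⟩ := h
    obtain ⟨Y', q', ε, j, hY', hT', hε⟩ := h'
    obtain ⟨e', he'⟩ := ih hX' hY'
    -- both sides have the same composition with `q'`, the image of `d 0`
    have hcomm : δ ≫ e'.hom = ε := by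
      rw [← sub_eq_zero]
      refine hom_eq_zero N hN hNS hY' (hS _) _ ?_
      rw [Preadditive.sub_comp, Category.assoc, he', hδ, hε, sub_self]
    obtain ⟨a, ha₁, ha₃⟩ := complete_distinguished_triangle_morphism₁ _ _ hT hT' (𝟙 _) e'.hom (by
      change δ ≫ e'.hom = 𝟙 _ ≫ ε
      rw [hcomm, Category.id_comp])
    let φ : Triangle.mk p δ i ⟶ Triangle.mk q ε j :=
      { hom₁ := a, hom₂ := 𝟙 _, hom₃ := e'.hom, comm₁ := ha₁
        comm₂ := hcomm.trans (Category.id_comp _).symm, comm₃ := ha₃ }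
    have : IsIso a := isIso₁_of_isIso₂₃ φ hT hT' (inferInstanceAs (IsIso (𝟙 _)))
      (inferInstanceAs (IsIso e'.hom))
    exact ⟨@asIso _ _ X Y a this, ha₁.symm.trans (Category.comp_id p)⟩

end IsIteratedCone

/-- An iterated cone in the ambient category of objects of a full triangulated subcategory is one in
the subcategory, which contains the intermediate objects. -/
lemma IsIteratedCone.of_ι {P : ObjectProperty C} [P.IsTriangulated] [P.IsClosedUnderIsomorphisms]
    {S : B ⥤ P.FullSubcategory}
    {n : ℕ} {A : ℕ → B} {d : ∀ i, A i ⟶ A (i + 1)} {X : P.FullSubcategory}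
    {p : X ⟶ S.obj (A 0)} (h : IsIteratedCone (S ⋙ P.ι) n A d X.obj (P.ι.map p)) :
    IsIteratedCone S n A d X p := by
  induction n generalizing A X with
  | zero =>
    have h : IsZero (P.ι.obj X) := h
    exact IsZero.of_full_of_faithful_of_isZero P.ι _ h
  | succ n ih =>
    obtain ⟨X', p', δ, i, hX', hT, hδ⟩ := h
    have hP : P X' := P.ext_of_isTriangulatedClosed₃ _ hT X.property (S.obj (A 0)).property
    refine ⟨⟨X', hP⟩, P.fullyFaithfulι.preimage p', P.fullyFaithfulι.preimage δ, _, ?_,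
      distinguished_preimage (h := i) (Y := S.obj (A 0)) (Z := ⟨X', hP⟩) (f := p)
        (g := P.fullyFaithfulι.preimage δ) hT, ?_⟩
    · exact ih hX'
    · exact P.ι.map_injective hδ

end

end KleinianSurface

end

noncomputable section

namespace KleinianSurface

open Pretriangulated DerivedCategory HomologicalComplex

/-! ### Bounded complexes as iterated cones -/

section

variable {A : Type*} [Category* A] [Abelian A]

/-- The projection of a complex in degrees `≥ 0` to its term of degree `0`. -/
def projZero (K : CochainComplex A ℤ) (hK : ∀ i, i < 0 → IsZero (K.X i)) :
    K ⟶ (single A (.up ℤ) 0).obj (K.X 0) :=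
  mkHomToSingle (𝟙 _) fun i hi => IsZero.eq_of_src (hK i (by have : i + 1 = 0 := hi; lia)) _ _

/-- The brutal truncation of a complex in degrees `≥ 0` gives a short complex. -/
abbrev truncShortComplex (K : CochainComplex A ℤ) (hK : ∀ i, i < 0 → IsZero (K.X i)) :
    ShortComplex (CochainComplex A ℤ) :=
  ShortComplex.mk (kernel.ι (projZero K hK)) (projZero K hK) (kernel.condition _)

variable (K : CochainComplex A ℤ) (hK : ∀ i, i < 0 → IsZero (K.X i))

lemma isIso_projZero_f : IsIso ((projZero K hK).f 0) := by
  rw [projZero, mkHomToSingle_f]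
  infer_instance

lemma projZero_comp_map_f {B : A} (f : K.X 0 ⟶ B) :
    (projZero K hK ≫ (single A (.up ℤ) 0).map f).f 0 = f ≫ (singleObjXSelf (.up ℤ) 0 B).inv := by
  rw [comp_f, single_map_f_self, projZero, mkHomToSingle_f, Category.id_comp,
    Iso.inv_hom_id_assoc]

lemma isZero_trunc_of_nonpos {i : ℤ} (hi : i ≤ 0) : IsZero ((kernel (projZero K hK)).X i) := by
  have hm : Mono ((kernel.ι (projZero K hK)).f i) := inferInstance
  rcases hi.lt_or_eq with hi | rfl
  · exact IsZero.of_mono ((kernel.ι (projZero K hK)).f i) (hK i hi)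
  · have := isIso_projZero_f K hK
    refine IsZero.of_mono_eq_zero ((kernel.ι (projZero K hK)).f 0) ?_
    rw [← cancel_mono ((projZero K hK).f 0), zero_comp, ← comp_f, kernel.condition, zero_f]

lemma shortExact_trunc : (truncShortComplex K hK).ShortExact := by
  have : Epi (projZero K hK) := by
    refine epi_of_epi_f _ fun i => ?_
    by_cases hi : i = 0
    · subst hi
      have := isIso_projZero_f K hK
      infer_instance
    · exact ⟨fun _ _ _ => (isZero_single_obj_X (.up ℤ) _ _ _ hi).eq_of_src _ _⟩
  exact .mk' (ShortComplex.exact_kernel _) inferInstance this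

lemma isIso_truncι_f {i : ℤ} (hi : 0 < i) : IsIso ((kernel.ι (projZero K hK)).f i) :=
  ((shortExact_trunc K hK).map_of_exact (eval A (.up ℤ) i)).isIso_f_iff.2
    (isZero_single_obj_X (.up ℤ) _ _ _ hi.ne')

/-- The brutal truncation is degreewise split. -/
def truncSplitting (i : ℤ) : ((truncShortComplex K hK).map (eval A (.up ℤ) i)).Splitting :=
  if hi : i ≤ 0 then
    if hi' : i < 0 then .ofIsIsoOfIsZero _
      ((isZero_trunc_of_nonpos K hK hi).isIso (hK i hi') _)
      (isZero_single_obj_X (.up ℤ) _ _ _ hi'.ne)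
    else .ofIsZeroOfIsIso _ (isZero_trunc_of_nonpos K hK hi)
      (by obtain rfl : i = 0 := by lia
          exact isIso_projZero_f K hK)
  else .ofIsIsoOfIsZero _ (isIso_truncι_f K hK (not_le.1 hi))
    (isZero_single_obj_X (.up ℤ) _ _ _ (fun h => hi h.le))

/-- The connecting morphism of the brutal truncation is given by the differential. -/
lemma projZero_comp_hom_truncι :
    (projZero K hK).f 0 ≫ (CochainComplex.homOfDegreewiseSplit _ (truncSplitting K hK)).f 0 ≫
      (kernel.ι (projZero K hK)).f 1 = K.d 0 1 := by
  let s : ((single A (.up ℤ) 0).obj (K.X 0)).X 0 ⟶ K.X 0 := (truncSplitting K hK 0).s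
  let r : K.X 1 ⟶ (kernel (projZero K hK)).X 1 := (truncSplitting K hK 1).r
  have hs : (projZero K hK).f 0 ≫ s = 𝟙 _ := by
    have h1 : s ≫ (projZero K hK).f 0 = 𝟙 _ := (truncSplitting K hK 0).s_g
    have := isIso_projZero_f K hK
    rw [← cancel_mono ((projZero K hK).f 0), Category.assoc, Category.id_comp, h1,
      Category.comp_id]
  have hr : r ≫ (kernel.ι (projZero K hK)).f 1 = 𝟙 _ := by
    have h1 : (kernel.ι (projZero K hK)).f 1 ≫ r = 𝟙 _ := (truncSplitting K hK 1).f_r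
    have := isIso_truncι_f K hK one_pos
    rw [← cancel_epi ((kernel.ι (projZero K hK)).f 1), Category.comp_id, reassoc_of% h1]
  have h : (CochainComplex.homOfDegreewiseSplit _ (truncSplitting K hK)).f 0 = s ≫ K.d 0 1 ≫ r :=
    CochainComplex.homOfDegreewiseSplit_f _ _ _
  rw [h]
  refine (congrArg (_ ≫ ·) (?_ : _ = s ≫ K.d 0 1)).trans ?_
  · change (s ≫ K.d 0 1 ≫ r) ≫ (kernel.ι (projZero K hK)).f 1 = _
    rw [Category.assoc, Category.assoc, hr, Category.comp_id]
  · rw [reassoc_of% hs]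

variable [HasDerivedCategory.{w} A]

/-- The triangle of the degreewise split brutal truncation, rotated so that its second morphism is
the connecting morphism that `projZero_comp_hom_truncι` describes. -/
lemma distinguished_trunc :
    ∃ i, Triangle.mk (Q.map (projZero K hK))
      (Q.map (CochainComplex.homOfDegreewiseSplit _ (truncSplitting K hK))) i ∈
        distTriang (DerivedCategory A) := by
  let T := CochainComplex.triangleOfDegreewiseSplit _ (truncSplitting K hK)
  refine ⟨_, (?_ : Q.mapTriangle.obj T.rotate ∈ distTriang _)⟩
  rw [rotate_distinguished_triangle]
  refine isomorphic_distinguished _ (mappingCone_triangle_distinguished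
    (CochainComplex.homOfDegreewiseSplit _ (truncSplitting K hK))) _ ?_
  exact Q.mapTriangleRotateIso.app T.rotate ≪≫ Q.mapTriangle.mapIso
    (CochainComplex.triangleOfDegreewiseSplitRotateRotateIso _ (truncSplitting K hK))

/-- A bounded complex in degrees `≥ 0` is an iterated cone of its terms. -/
theorem isIteratedCone_Q (n : ℕ) (K : CochainComplex A ℤ) (hK : ∀ i, i < 0 → IsZero (K.X i))
    (hn : ∀ i : ℤ, n ≤ i → IsZero (K.X i)) :
    IsIteratedCone (singleFunctor A 0) n (fun i => K.X i) (fun i => K.d i (i + 1 : ℕ)) (Q.obj K)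
      (Q.map (projZero K hK)) := by
  induction n generalizing K with
  | zero =>
    have : IsZero K := by
      rw [IsZero.iff_id_eq_zero]
      ext i
      exact IsZero.eq_of_src (if h : i < 0 then hK i h else hn i (not_lt.1 h)) _ _
    exact Q.map_isZero this
  | succ n ih =>
    obtain ⟨i, hT⟩ := distinguished_trunc K hK
    have hι (i : ℤ) : Mono ((kernel.ι (projZero K hK)).f i) := inferInstance
    let L : CochainComplex A ℤ := (kernel (projZero K hK))⟦(1 : ℤ)⟧
    have hL : ∀ i, i < 0 → IsZero (L.X i) := fun i hi =>
      isZero_trunc_of_nonpos K hK (i := i + 1) (by lia)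
    have hLn : ∀ i : ℤ, n ≤ i → IsZero (L.X i) := fun i hi =>
      have h : IsZero ((kernel (projZero K hK)).X (i + 1)) :=
        IsZero.of_mono ((kernel.ι (projZero K hK)).f (i + 1)) (hn (i + 1) (by push_cast; lia))
      h
    let u (i : ℕ) : L.X i ≅ K.X (i + 1 : ℕ) :=
      @asIso _ _ (L.X i) (K.X (i + 1)) ((kernel.ι (projZero K hK)).f (i + 1))
        (isIso_truncι_f K hK (by lia))
    -- the signs compensate those in the differential of the shift
    let e (i : ℕ) : L.X i ≅ K.X (i + 1 : ℕ) := ((-1 : ℤˣ) ^ i) • u i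
    have := (ih L hL hLn).of_iso_seq (d' := fun i => K.d (i + 1 : ℕ) (i + 1 + 1 : ℕ)) e fun i => by
      have h : L.d i (i + 1 : ℕ) ≫ (u (i + 1)).hom =
          - (u i).hom ≫ K.d (i + 1 : ℕ) (i + 1 + 1 : ℕ) := by
        change (Int.negOnePow 1 • (kernel (projZero K hK)).d (i + 1) (i + 1 + 1)) ≫
          (kernel.ι (projZero K hK)).f (i + 1 + 1) =
            - (kernel.ι (projZero K hK)).f (i + 1) ≫ K.d (i + 1) (i + 1 + 1)
        rw [Int.negOnePow_one, Units.neg_smul, one_smul, Preadditive.neg_comp, Hom.comm]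
      change L.d i (i + 1 : ℕ) ≫ ((-1 : ℤˣ) ^ (i + 1) • (u (i + 1)).hom) =
        ((-1 : ℤˣ) ^ i • (u i).hom) ≫ _
      rw [Linear.comp_units_smul, h, Linear.units_smul_comp, pow_succ, mul_neg, mul_one,
        Units.neg_smul, smul_neg, neg_neg]
    refine ⟨Q.obj L, _, _, i, this, hT, ?_⟩
    change Q.map _ ≫ Q.map (projZero L hL) ≫ Q.map ((single A (.up ℤ) 0).map (e 0).hom) =
      Q.map ((single A (.up ℤ) 0).map (K.d 0 1))
    rw [← Q.map_comp, ← Q.map_comp]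
    have := (shortExact_trunc K hK).epi_g
    have hp : Epi (projZero K hK) := this
    refine congrArg Q.map ?_
    rw [← cancel_epi (projZero K hK)]
    refine to_single_hom_ext ?_
    rw [comp_f, comp_f, projZero_comp_map_f, projZero_comp_map_f,
      show (e 0).hom = (kernel.ι (projZero K hK)).f 1 from one_smul _ _,
      ← projZero_comp_hom_truncι K hK]
    exact (Category.assoc _ _ _).symm.trans ((Category.assoc _ _ _).symm.trans
      (congrArg (· ≫ _) (Category.assoc _ _ _)))

end

end KleinianSurface

end

noncomputable section

namespace KleinianSurface

open Pretriangulated DerivedCategory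

/-! ### The action of an autoequivalence on bounded complexes -/

section

variable {B B' C : Type*} [Category* B] [Category* B'] [Category* C]
  [HasZeroObject C] [HasShift C ℤ] [Preadditive C] [∀ n : ℤ, (shiftFunctor C n).Additive]
  [Pretriangulated C]

lemma IsIteratedCone.comp {S : B ⥤ C} {T : B' ⥤ B} {n : ℕ} {A : ℕ → B'}
    {d : ∀ i, A i ⟶ A (i + 1)} {X : C} {p : X ⟶ S.obj (T.obj (A 0))}
    (h : IsIteratedCone S n (fun i => T.obj (A i)) (fun i => T.map (d i)) X p) :
    IsIteratedCone (T ⋙ S) n A d X p := by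
  induction n generalizing A X with
  | zero => exact h
  | succ n ih =>
    obtain ⟨X', p', δ, i, hX', hT, hδ⟩ := h
    exact ⟨X', p', δ, i, ih hX', hT, hδ⟩

lemma IsIteratedCone.of_iso {S : B ⥤ C} {n : ℕ} {A : ℕ → B} {d : ∀ i, A i ⟶ A (i + 1)} {X Y : C}
    (e : Y ≅ X) {p : X ⟶ S.obj (A 0)} (h : IsIteratedCone S n A d X p) :
    IsIteratedCone S n A d Y (e.hom ≫ p) := by
  cases n with
  | zero => exact IsZero.of_iso h e
  | succ n =>
    obtain ⟨X', p', δ, i, hX', hT, hδ⟩ := h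
    refine ⟨X', p', δ, i ≫ e.inv⟦(1 : ℤ)⟧', hX', ?_, hδ⟩
    refine distinguished_of_iso hT e (Iso.refl _) (Iso.refl _) ?_ ?_ ?_
    · simp
    · simp
    · simp [← Functor.map_comp]

end

variable {G : Subgroup SL₂} [HasDerivedCategory.{w} (CohG G)]

lemma represents_shift_iff {K : CochainComplex (FinLen G) ℤ} {α : DG₀ G} (a : ℤ) :
    Represents (K⟦a⟧) (α⟦a⟧) ↔ Represents K α := by
  let e : Q.obj (((toCoh G).mapHomologicalComplex _).obj (K⟦a⟧)) ≅
      (Q.obj (((toCoh G).mapHomologicalComplex _).obj K))⟦a⟧ :=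
    Q.mapIso ((((toCoh G).mapHomologicalComplex (.up ℤ)).commShiftIso a).app K) ≪≫
      (Q.commShiftIso a).app _
  let e' : (boundedSuppZero G).ι.obj (α⟦a⟧) ≅ ((boundedSuppZero G).ι.obj α)⟦a⟧ :=
    ((boundedSuppZero G).ι.commShiftIso a).app α
  constructor
  · rintro ⟨f⟩
    exact ⟨(shiftFunctor _ a).preimageIso (e.symm ≪≫ f ≪≫ e')⟩
  · rintro ⟨f⟩
    exact ⟨e ≪≫ (shiftFunctor _ a).mapIso f ≪≫ e'.symm⟩

/-- A triangulated functor which restricts to the functor `F` between equivariant modules of finite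
length acts on the objects represented by bounded complexes as `F`. -/
theorem Represents.map {Φ : DG₀ G ⥤ DG₀ G} [Φ.CommShift ℤ] [Φ.IsTriangulated]
    {F : FinLen G ⥤ FinLen G} [F.Additive] (e : deg₀ G ⋙ Φ ≅ F ⋙ deg₀ G)
    {K : CochainComplex (FinLen G) ℤ} (hK : IsBounded K) {α : DG₀ G} (hα : Represents K α) :
    Represents ((F.mapHomologicalComplex _).obj K) (Φ.obj α) := by
  obtain ⟨a, b, hab⟩ := hK
  -- shifting, one may assume that the complex starts in degree `0`
  wlog ha : a = 0 generalizing a b K α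
  · have := this (α := α⟦a⟧) ((represents_shift_iff a).2 hα) 0 (b - a)
      (fun i hi => hab (i + a) (by lia)) rfl
    obtain ⟨f⟩ := this
    rw [← represents_shift_iff a]
    refine ⟨Q.mapIso (((toCoh G).mapHomologicalComplex _).mapIso
      (((F.mapHomologicalComplex (.up ℤ)).commShiftIso a).symm.app K)) ≪≫ f ≪≫
      (boundedSuppZero G).ι.mapIso ((Φ.commShiftIso a).app α)⟩
  subst ha
  obtain ⟨f⟩ := hα
  obtain ⟨n, hn⟩ : ∃ n : ℕ, b < n := ⟨(b + 1).toNat, by lia⟩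
  have hcone (L : CochainComplex (FinLen G) ℤ) (hL : ∀ i, i < 0 ∨ b < i → IsZero (L.X i)) :
      IsIteratedCone (singleFunctor (CohG G) 0) n (fun i => (toCoh G).obj (L.X i))
        (fun i => (toCoh G).map (L.d i (i + 1 : ℕ)))
        (Q.obj (((toCoh G).mapHomologicalComplex _).obj L)) _ :=
    isIteratedCone_Q n (((toCoh G).mapHomologicalComplex _).obj L)
      (fun i hi => (toCoh G).map_isZero (hL i (.inl hi)))
      (fun i hi => (toCoh G).map_isZero (hL i (.inr (by lia))))
  have h1 := (hcone K hab).of_iso f.symm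
  have h2 : IsIteratedCone (deg₀ G) n (fun i => K.X i) (fun i => K.d i (i + 1 : ℕ)) α
      ((boundedSuppZero G).fullyFaithfulι.preimage (Y := (deg₀ G).obj (K.X (0 : ℕ))) _) :=
    IsIteratedCone.of_ι h1.comp
  have h3 := h2.map F Φ e
  -- `Φ α` and the complex `F K` are both iterated cones of the terms of `F K`
  have h4 := h3.map (toCoh G) (boundedSuppZero G).ι (deg₀CompιIso G)
  have h5 := hcone ((F.mapHomologicalComplex _).obj K) (fun i hi => F.map_isZero (hab i hi))
  -- the class of objects of cohomology in degrees `≤ -1` tests the vanishing of negative `Ext`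
  obtain ⟨g, -⟩ := IsIteratedCone.exists_iso (fun X => X.IsLE (-1))
    (fun X hX => by
      have : X.IsLE (-1) := hX
      have := TStructure.t.isLE_shift X (-1) 1 (-2)
      exact TStructure.t.isLE_of_le (X⟦(1 : ℤ)⟧) (-2) (-1))
    (fun X b f hX => by
      have : X.IsLE (-1) := hX
      have : ((singleFunctor (CohG G) 0).obj b).IsGE 0 := inferInstance
      exact TStructure.t.zero f (-1) 0)
    (fun b => by
      have : ((singleFunctor (CohG G) 0).obj b).IsLE 0 := inferInstance
      exact TStructure.t.isLE_shift _ 0 1 (-1)) h5 h4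
  exact ⟨g⟩

end KleinianSurface

end

noncomputable section

namespace KleinianSurface

open Pretriangulated DerivedCategory SkewMonoidAlgebra
open MvPolynomial (idealOfVars)

/-! ### Representing objects by bounded complexes of modules of finite length -/

variable {G : Subgroup SL₂}

lemma smul_mem_idealOfVars_pow (g : G) {n : ℕ} {f : Poly} (hf : f ∈ idealOfVars (Fin 2) ℂ ^ n) :
    g • f ∈ idealOfVars (Fin 2) ℂ ^ n := by
  rw [← coe_mem_maxIdeal_pow_iff] at hf ⊢
  have := smul_mem_maxIdeal_pow g hf
  rwa [show ((g • f : Poly) : Pow) = g • (f : Pow) from coe_smul (g : SL₂) f]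

/-- The equivariant submodule `mⁿ M`, where `m` is the maximal ideal of the origin. -/
def powSub (n : ℕ) (M : ModuleCat.{0} (SkewPoly G)) : Submodule (SkewPoly G) M where
  carrier := (idealOfVars (Fin 2) ℂ ^ n • ⊤ : Submodule Poly ((forgetEquivariance G).obj M)).carrier
  add_mem' := add_mem (S := Submodule Poly ((forgetEquivariance G).obj M))
  zero_mem' := zero_mem (idealOfVars (Fin 2) ℂ ^ n • ⊤ :
    Submodule Poly ((forgetEquivariance G).obj M))
  smul_mem' a x hx := by
    let U : Submodule Poly ((forgetEquivariance G).obj M) := idealOfVars (Fin 2) ℂ ^ n • ⊤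
    change a • x ∈ U.carrier
    induction a using SkewMonoidAlgebra.induction_on with
    | zero => rw [zero_smul]; exact zero_mem U
    | single g p =>
      induction (show x ∈ U from hx) using Submodule.smul_induction_on' with
      | smul f hf y hy =>
        have : (single g p : SkewPoly G) • (single (1 : G) f : SkewPoly G) • (show M from y) =
            (single (1 : G) (g • f) : SkewPoly G) • (single g p : SkewPoly G) • (show M from y) := by
          rw [smul_smul, smul_smul, single_mul_single, single_mul_single, mul_one, one_mul, one_smul,
            mul_comm]
        refine Eq.mpr (congrArg (· ∈ U.carrier) this) ?_
        exact Submodule.smul_mem_smul (M := (forgetEquivariance G).obj M)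
          (smul_mem_idealOfVars_pow g hf) Submodule.mem_top
      | add y hy z hz h1 h2 =>
        refine Eq.mpr (congrArg (· ∈ U.carrier) (smul_add (single g p : SkewPoly G)
          (show M from y) (show M from z))) ?_
        exact add_mem (S := Submodule Poly ((forgetEquivariance G).obj M)) (h1 hy) (h2 hz)
    | add a b h1 h2 =>
      rw [add_smul]
      exact add_mem (S := Submodule Poly ((forgetEquivariance G).obj M)) h1 h2

lemma smul_mem_powSub {n : ℕ} {M : ModuleCat.{0} (SkewPoly G)} {f : Poly}
    (hf : f ∈ idealOfVars (Fin 2) ℂ ^ n) (x : M) :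
    (single (1 : G) f : SkewPoly G) • x ∈ powSub n M := by
  have h : f • (show (forgetEquivariance G).obj M from x) ∈
    (idealOfVars (Fin 2) ℂ ^ n • ⊤ : Submodule Poly ((forgetEquivariance G).obj M)) :=
    Submodule.smul_mem_smul hf Submodule.mem_top
  exact h

/-- A scalar that annihilates the homology of a complex of modules moves cycles to boundaries. -/
lemma exists_eq_smul_of_smul_homology_eq_zero {R : Type*} [Ring R]
    (T : ShortComplex (ModuleCat.{0} R)) (r : R) (h : ∀ x : T.homology, r • x = 0) (z : T.X₂)
    (hz : T.g z = 0) : ∃ y, T.f y = r • z := by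
  let e := T.moduleCatHomologyIso.symm.toLinearEquiv
  let z' : LinearMap.ker T.g.hom := ⟨z, hz⟩
  let π : LinearMap.ker T.g.hom →ₗ[R] T.moduleCatLeftHomologyData.H :=
    (LinearMap.range T.moduleCatToCycles).mkQ
  have h1 : π (r • z') = 0 := by
    apply e.injective
    rw [map_smul, map_smul, map_zero]
    exact h _
  obtain ⟨y, hy⟩ := (Submodule.Quotient.mk_eq_zero _).1 h1
  exact ⟨y, congrArg Subtype.val hy⟩

/-- If the homology is supported at the origin, then the boundaries contain a multiple of the
cycles by a power of the maximal ideal. -/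
lemma exists_smul_mem_range (S : ShortComplex (CohG G)) (h : isSuppZero G S.homology) :
    ∃ s, ∀ f ∈ idealOfVars (Fin 2) ℂ ^ s, ∀ z : S.X₂.obj, S.g.hom z = 0 →
      ∃ y, S.f.hom y = (single (1 : G) f : SkewPoly G) • z := by
  obtain ⟨s, hs⟩ := exists_pow_smul_eq_zero _ h
  refine ⟨s, fun f hf => exists_eq_smul_of_smul_homology_eq_zero (S.map (isCoh G).ι) _ fun x => ?_⟩
  let e := (S.mapHomologyIso (isCoh G).ι).toLinearEquiv
  apply e.injective
  rw [map_smul, map_zero]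
  exact hs f hf _

/-- A consequence of the Artin–Rees lemma. -/
lemma exists_powSub (S : ShortComplex (CohG G)) (h : isSuppZero G S.homology) (n : ℕ) :
    ∃ m, ∀ z ∈ powSub m S.X₂.obj, S.g.hom z = 0 → ∃ y ∈ powSub n S.X₁.obj, S.f.hom y = z := by
  obtain ⟨s, hs⟩ := exists_smul_mem_range S h
  let f := ((forgetEquivariance G).map S.f.hom).hom
  let g := ((forgetEquivariance G).map S.g.hom).hom
  have : Module.Finite Poly ((forgetEquivariance G).obj S.X₂.obj) := S.X₂.property
  obtain ⟨k, hk⟩ := Ideal.exists_pow_inf_eq_pow_smul (idealOfVars (Fin 2) ℂ) (LinearMap.ker g)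
  -- `mⁿ⁺ˢ⁺ᵏ K ∩ ker g = mⁿ⁺ˢ (mᵏ K ∩ ker g)`, which is contained in `mⁿ mˢ ker g`, a part of the
  -- image of `mⁿ`
  refine ⟨n + s + k, fun z hz hz' => ?_⟩
  have h2 : idealOfVars (Fin 2) ℂ ^ s • LinearMap.ker g ≤ LinearMap.range f :=
    Submodule.smul_le.2 fun p hp x hx => hs p hp x hx
  have h3 : (idealOfVars (Fin 2) ℂ ^ (n + s + k) • ⊤ ⊓ LinearMap.ker g : Submodule Poly _) ≤
      (idealOfVars (Fin 2) ℂ ^ n • ⊤ : Submodule Poly _).map f := by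
    rw [hk _ (by lia), Nat.add_sub_cancel, pow_add, Submodule.mul_smul, Submodule.map_smul'',
      Submodule.map_top]
    exact Submodule.smul_mono le_rfl ((Submodule.smul_mono le_rfl inf_le_right).trans h2)
  obtain ⟨y, hy, hyz⟩ := h3 (x := z) ⟨hz, hz'⟩
  exact ⟨y, hy, hyz⟩

end KleinianSurface

end

noncomputable section

namespace KleinianSurface

open Pretriangulated DerivedCategory SkewMonoidAlgebra
open MvPolynomial (idealOfVars)

/-! ### Quotients of complexes by acyclic subcomplexes -/

section

variable {A B : Type*} [Category* A] [Category* B] [Preadditive A] [Preadditive B]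

/-- A complex whose terms are in the essential image of a fully faithful functor is in the essential
image. -/
lemma exists_mapHomologicalComplex_iso {ι : Type*} {c : ComplexShape ι} (F : A ⥤ B) [F.Additive]
    [F.Full] [F.Faithful] (C : HomologicalComplex B c)
    (h : ∀ i, ∃ N, Nonempty (F.obj N ≅ C.X i)) :
    ∃ D, Nonempty ((F.mapHomologicalComplex c).obj D ≅ C) := by
  choose N e using h
  let e' (i : ι) : F.obj (N i) ≅ C.X i := (e i).some
  let D : HomologicalComplex A c :=
    { X := N
      d i j := F.preimage ((e' i).hom ≫ C.d i j ≫ (e' j).inv)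
      shape i j hij := F.map_injective (by
        rw [F.map_preimage, C.shape i j hij, zero_comp, comp_zero, F.map_zero])
      d_comp_d' i j k _ _ := F.map_injective (by
        rw [F.map_comp, F.map_preimage, F.map_preimage, F.map_zero, Category.assoc, Category.assoc,
          Iso.inv_hom_id_assoc, C.d_comp_d_assoc, zero_comp, comp_zero]) }
  refine ⟨D, ⟨HomologicalComplex.Hom.isoOfComponents e' fun i j _ => ?_⟩⟩
  change (e' i).hom ≫ C.d i j = F.map (F.preimage ((e' i).hom ≫ C.d i j ≫ (e' j).inv)) ≫ _
  rw [F.map_preimage, Category.assoc, Category.assoc, Iso.inv_hom_id, Category.comp_id]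

end

variable {G : Subgroup SL₂}

/-- The quotient of an equivariant coherent sheaf by an equivariant submodule. -/
def cohQuot (M : CohG G) (U : Submodule (SkewPoly G) M.obj) : CohG G where
  obj := ModuleCat.of _ (M.obj ⧸ U)
  property := by
    have : Epi (ModuleCat.ofHom U.mkQ) := (ModuleCat.epi_iff_surjective _).2 U.mkQ_surjective
    exact finGen.prop_of_epi ((forgetEquivariance G).map (ModuleCat.ofHom U.mkQ)) M.property

/-- The projection to a quotient. -/
def cohMk (M : CohG G) (U : Submodule (SkewPoly G) M.obj) : M ⟶ cohQuot M U :=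
  ObjectProperty.homMk (ModuleCat.ofHom U.mkQ)

/-- The morphism induced on quotients. -/
def cohMap {M M' : CohG G} (φ : M ⟶ M') (U : Submodule (SkewPoly G) M.obj)
    (U' : Submodule (SkewPoly G) M'.obj) (h : U ≤ U'.comap φ.hom.hom) :
    cohQuot M U ⟶ cohQuot M' U' :=
  ObjectProperty.homMk (ModuleCat.ofHom (U.mapQ U' φ.hom.hom h))

lemma cohMk_comp_cohMap {M M' : CohG G} (φ : M ⟶ M') (U : Submodule (SkewPoly G) M.obj)
    (U' : Submodule (SkewPoly G) M'.obj) (h : U ≤ U'.comap φ.hom.hom) :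
    cohMk M U ≫ cohMap φ U U' h = φ ≫ cohMk M' U' := rfl

lemma cohMk_eq_zero {M : CohG G} {U : Submodule (SkewPoly G) M.obj} {m : M.obj} :
    (cohMk M U).hom m = 0 ↔ m ∈ U := Submodule.Quotient.mk_eq_zero U

instance (M : CohG G) (U : Submodule (SkewPoly G) M.obj) : Epi (cohMk M U) :=
  (isCoh G).ι.epi_of_epi_map ((ModuleCat.epi_iff_surjective _).2 U.mkQ_surjective)

/-- The quotient of a complex by a subcomplex. -/
def quotComplex (K : CochainComplex (CohG G) ℤ) (U : ∀ i, Submodule (SkewPoly G) (K.X i).obj)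
    (h : ∀ i j, U i ≤ (U j).comap (K.d i j).hom.hom) : CochainComplex (CohG G) ℤ where
  X i := cohQuot (K.X i) (U i)
  d i j := cohMap (K.d i j) (U i) (U j) (h i j)
  shape i j hij := by
    rw [← cancel_epi (cohMk _ _), cohMk_comp_cohMap, K.shape i j hij, zero_comp, comp_zero]
  d_comp_d' i j k _ _ := by
    rw [← cancel_epi (cohMk _ _), ← Category.assoc, cohMk_comp_cohMap, Category.assoc,
      cohMk_comp_cohMap, K.d_comp_d_assoc, zero_comp, comp_zero]

/-- The projection to the quotient complex. -/
def quotComplexMk (K : CochainComplex (CohG G) ℤ) (U : ∀ i, Submodule (SkewPoly G) (K.X i).obj)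
    (h : ∀ i j, U i ≤ (U j).comap (K.d i j).hom.hom) : K ⟶ quotComplex K U h where
  f _ := cohMk _ _
  comm' _ _ _ := rfl

/-- The projection to the quotient by an acyclic subcomplex is an isomorphism in the derived
category. -/
lemma isIso_Q_quotComplexMk [HasDerivedCategory.{w} (CohG G)] (K : CochainComplex (CohG G) ℤ)
    (U : ∀ i, Submodule (SkewPoly G) (K.X i).obj)
    (h : ∀ i j, U i ≤ (U j).comap (K.d i j).hom.hom)
    (hU : ∀ i, ∀ x ∈ U i, (K.d i (i + 1)).hom x = 0 → ∃ y ∈ U (i - 1), (K.d (i - 1) i).hom y = x) :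
    IsIso (Q.map (quotComplexMk K U h)) := by
  let q := quotComplexMk K U h
  have hq : Epi q := HomologicalComplex.epi_of_epi_f _ fun i =>
    inferInstanceAs (Epi (cohMk (K.X i) (U i)))
  have hS : (ShortComplex.mk (kernel.ι q) q (kernel.condition q)).ShortExact :=
    .mk' (ShortComplex.exact_kernel _) inferInstance hq
  have hSi (i : ℤ) := (hS.map_of_exact (HomologicalComplex.eval _ _ i)).map_of_exact (isCoh G).ι
  let k (i : ℤ) : ((kernel q).X i).obj → (K.X i).obj := ((kernel.ι q).f i).hom
  have hk (i : ℤ) : Function.Injective (k i) := (hSi i).moduleCat_injective_f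
  have hkU (i : ℤ) (x : (K.X i).obj) : x ∈ U i ↔ ∃ y, k i y = x := by
    rw [← cohMk_eq_zero]
    exact (ShortComplex.ShortExact.moduleCat_exact_iff_function_exact _).1 (hSi i).exact x
  have hkd (i j : ℤ) (x : ((kernel q).X i).obj) :
      (K.d i j).hom (k i x) = k j (((kernel q).d i j).hom x) := by
    exact congrArg (fun φ => φ.hom x) ((kernel.ι q).comm i j)
  have hacyc : ∀ i, (kernel q).ExactAt i := fun i => by
    rw [HomologicalComplex.exactAt_iff' _ (i - 1) i (i + 1) (by simp) (by simp),
      ← ShortComplex.exact_map_iff_of_faithful _ (isCoh G).ι, ShortComplex.moduleCat_exact_iff]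
    intro (x : ((kernel q).X i).obj) (hx : ((kernel q).d i (i + 1)).hom x = 0)
    obtain ⟨y, hy, hyx⟩ := hU i (k i x) ((hkU i _).2 ⟨x, rfl⟩) (by
      rw [hkd, hx]
      exact map_zero ((kernel.ι q).f (i + 1)).hom.hom)
    obtain ⟨y', rfl⟩ := (hkU _ _).1 hy
    exact ⟨y', hk i ((hkd _ _ _).symm.trans hyx)⟩
  have hz : IsZero (Q.obj (kernel q)) := by
    have h0 : QuasiIso (0 : kernel q ⟶ kernel q) :=
      (quasiIso_iff _).2 fun i => (quasiIsoAt_iff_exactAt _ i (hacyc i)).2 (hacyc i)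
    rw [← isIso_Q_map_iff_quasiIso, Functor.map_zero] at h0
    exact (isZero_zero _).of_iso (isIsoZeroEquivIsoZero _ _ h0).1
  exact (Triangle.isZero₁_iff_isIso₂ _ (triangleOfSES_distinguished hS)).1 hz

/-- There are exponents such that the subcomplex with the terms `mᴺ⁽ⁱ⁾ Kⁱ + d (mᴺ⁽ⁱ⁻¹⁾ Kⁱ⁻¹)` is
acyclic, if the homology of `K` is supported at the origin. -/
lemma exists_exponents (K : CochainComplex (CohG G) ℤ) (hK : ∀ i, isSuppZero G (K.homology i))
    (a : ℤ) (ha : ∀ i, i < a → IsZero (K.X i)) :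
    ∃ N : ℤ → ℕ, ∀ i, ∀ z ∈ powSub (N i) (K.X i).obj, (K.d i (i + 1)).hom z = 0 →
      ∃ y ∈ powSub (N (i - 1)) (K.X (i - 1)).obj, (K.d (i - 1) i).hom y = z := by
  have h (i : ℤ) : isSuppZero G (K.sc' (i - 1) i (i + 1)).homology :=
    (isSuppZero G).prop_of_iso (K.homologyIsoSc' (i - 1) i (i + 1) (by simp) (by simp)) (hK i)
  choose f hf using fun i => exists_powSub _ (h i)
  let s : ℕ → ℕ := fun k => Nat.rec 0 (fun k n => f (a + k) n) k
  -- the exponent in degree `i ≥ a` is determined by the one in degree `i - 1`; below `a` the terms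
  -- of the complex vanish and any exponent will do
  refine ⟨fun i => s (i - a + 1).toNat, fun i z hz hz' => ?_⟩
  rcases lt_or_ge i a with hi | hi
  · have h0 : z = 0 := congrArg (fun φ => φ.hom z) ((IsZero.iff_id_eq_zero _).1 (ha i hi))
    exact ⟨0, zero_mem _, (map_zero (K.d (i - 1) i).hom.hom).trans h0.symm⟩
  · obtain ⟨k, rfl⟩ := Int.le.dest hi
    have h1 : (a + k - a + 1).toNat = k + 1 := by lia
    have h2 : (a + k - 1 - a + 1).toNat = k := by lia
    dsimp only at hz ⊢
    rw [h1] at hz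
    rw [h2]
    exact hf (a + k) (s k) z hz hz'

variable [HasDerivedCategory.{w} (CohG G)]

/-- Every object of `D^G_{0}(ℂ²)` is represented by a bounded complex of equivariant modules of
finite length. -/
theorem exists_represents (α : DG₀ G) :
    ∃ K : CochainComplex (FinLen G) ℤ, IsBounded K ∧ Represents K α := by
  obtain ⟨⟨⟨a, ha⟩, ⟨b, hb⟩⟩, hsupp⟩ := α.property
  have : α.obj.IsLE b := hb
  have : α.obj.IsGE a := ha
  obtain ⟨K, hKa, hKb, ⟨e⟩⟩ := exists_iso_Q_obj_of_isGE_of_isLE α.obj a b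
  have hKa (i : ℤ) (hi : i < a) : IsZero (K.X i) := K.isZero_of_isStrictlyGE a i hi
  have hKb (i : ℤ) (hi : b < i) : IsZero (K.X i) := K.isZero_of_isStrictlyLE b i hi
  obtain ⟨N, hN⟩ := exists_exponents K (fun i => (isSuppZero G).prop_of_iso
    ((homologyFunctor _ i).mapIso e ≪≫ (homologyFunctorFactors _ i).app K) (hsupp i)) a hKa
  -- the quotient of `K` by this acyclic subcomplex has terms annihilated by powers of the ideal of
  -- the origin
  let U (i : ℤ) : Submodule (SkewPoly G) (K.X i).obj :=
    powSub (N i) _ ⊔ (powSub (N (i - 1)) _).map (K.d (i - 1) i).hom.hom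
  have hU {i : ℤ} {x : (K.X i).obj} (hx : x ∈ U i) : ∃ y ∈ powSub (N i) (K.X i).obj,
      ∃ z ∈ powSub (N (i - 1)) (K.X (i - 1)).obj, y + (K.d (i - 1) i).hom z = x := by
    obtain ⟨y, hy, _, ⟨z, hz, rfl⟩, h⟩ := Submodule.mem_sup.1 hx
    exact ⟨y, hy, z, hz, h⟩
  have hdd (i j k : ℤ) (x : (K.X i).obj) : (K.d j k).hom ((K.d i j).hom x) = 0 :=
    congrArg (fun φ => φ.hom x) (K.d_comp_d i j k)
  have hadd (i j : ℤ) (x y : (K.X i).obj) :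
      (K.d i j).hom (x + y) = (K.d i j).hom x + (K.d i j).hom y := map_add (K.d i j).hom.hom x y
  have hd (i j : ℤ) : U i ≤ (U j).comap (K.d i j).hom.hom := fun x hx => by
    change (K.d i j).hom x ∈ U j
    by_cases hij : i + 1 = j
    · obtain rfl : i = j - 1 := by lia
      obtain ⟨y, hy, z, hz, rfl⟩ := hU hx
      rw [hadd, hdd, add_zero]
      exact Submodule.mem_sup_right ⟨y, hy, rfl⟩
    · have : (K.d i j).hom x = 0 := congrArg (fun φ => φ.hom x) (K.shape i j hij)
      rw [this]
      exact zero_mem _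
  have hiso := isIso_Q_quotComplexMk K U hd fun i x hx hx0 => by
    obtain ⟨y, hy, z, hz, rfl⟩ := hU hx
    rw [hadd, hdd, add_zero] at hx0
    obtain ⟨y', hy', rfl⟩ := hN i y hy hx0
    exact ⟨y' + z, Submodule.mem_sup_left (add_mem hy' hz), hadd _ _ _ _⟩
  obtain ⟨D, ⟨e'⟩⟩ := exists_mapHomologicalComplex_iso (toCoh G) (quotComplex K U hd) fun i =>
    exists_toCoh_iso _ (isSuppZero_of_pow_smul_eq_zero _ (N i) fun f hf m => by
      obtain ⟨m, rfl⟩ := (U i).mkQ_surjective m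
      refine (map_smul (U i).mkQ (single (1 : G) f : SkewPoly G) m).symm.trans ?_
      exact cohMk_eq_zero.2 (Submodule.mem_sup_left (smul_mem_powSub hf m)))
  refine ⟨D, ⟨a, b, fun i hi => ?_⟩, ⟨Q.mapIso e' ≪≫ (asIso (Q.map (quotComplexMk K U hd))).symm ≪≫
    e.symm⟩⟩
  have hi : IsZero (K.X i) := hi.elim (hKa i) (hKb i)
  have hi' : IsZero (cohQuot (K.X i) (U i)) := IsZero.of_epi (cohMk (K.X i) (U i)) hi
  exact IsZero.of_full_of_faithful_of_isZero (toCoh G) _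
    (hi'.of_iso ((HomologicalComplex.eval _ _ i).mapIso e'))

end KleinianSurface

end

noncomputable section

namespace KleinianSurface

variable {G : Subgroup SL₂} [HasDerivedCategory.{w} (CohG G)]

/-- Isomorphic functors act on represented objects in the same way. -/
lemma Represents.congr {F F' : FinLen G ⥤ FinLen G} [F.Additive] [F'.Additive] (e : F ≅ F')
    {K : CochainComplex (FinLen G) ℤ} {α : DG₀ G}
    (h : Represents ((F.mapHomologicalComplex _).obj K) α) :
    Represents ((F'.mapHomologicalComplex _).obj K) α :=
  Nonempty.map (fun f => DerivedCategory.Q.mapIso (((toCoh G).mapHomologicalComplex _).mapIso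
    ((NatIso.mapHomologicalComplex e (.up ℤ)).symm.app K)) ≪≫ f) h

end KleinianSurface

end

theorem mainTheorem8 (G : Subgroup (Matrix.SpecialLinearGroup (Fin 2) ℂ)) [Finite G] [IsCyclic G]
    [HasDerivedCategory.{w} (KleinianSurface.CohG G)]
    (Φ : KleinianSurface.DG₀ G ≌ KleinianSurface.DG₀ G)
    [Φ.functor.CommShift ℤ] [Φ.functor.IsTriangulated] [Φ.functor.Linear ℂ]
    (hΦ : ∀ (V : Type) [AddCommGroup V] [Module ℂ V] [FiniteDimensional ℂ V]
      (ρ : Representation ℂ G V) [ρ.IsIrreducible],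
      Nonempty (Φ.functor.obj (KleinianSurface.simpleObject ρ) ≅
        KleinianSurface.simpleObject ρ)) :
    ∃ σ : KleinianSurface.AutY G, ∀ α : KleinianSurface.DG₀ G,
      KleinianSurface.IsPullback σ α (Φ.functor.obj α) := by
  have hjet (κ : KleinianSurface.Character G) :
      Nonempty (Φ.functor.obj ((KleinianSurface.deg₀ G).obj (KleinianSurface.jet 1 κ)) ≅
        (KleinianSurface.deg₀ G).obj (KleinianSurface.jet 1 κ)) := by
    obtain ⟨e⟩ := KleinianSurface.nonempty_simpleObject_iso κ
    obtain ⟨f⟩ := hΦ ℂ (KleinianSurface.charRep κ)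
    exact ⟨Φ.functor.mapIso e.symm ≪≫ f ≪≫ e⟩
  obtain ⟨E, _, _, ⟨e⟩⟩ := KleinianSurface.exists_restriction Φ hjet
  obtain ⟨σ, t, ⟨f⟩⟩ := KleinianSurface.exists_iso_pullback E fun κ => by
    obtain ⟨g⟩ := hjet κ
    exact ⟨(KleinianSurface.deg₀ G).preimageIso (e.symm.app _ ≪≫ g)⟩
  refine ⟨σ, fun α => ⟨KleinianSurface.exists_represents α, ⟨t⟩, fun t' K hK hα => ?_⟩⟩
  obtain ⟨f'⟩ := KleinianSurface.nonempty_pullback_iso t t'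
  exact (KleinianSurface.Represents.map e hK hα).congr (f ≪≫ f')
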